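/- Let $T=\mathbb R/\mathbb Z$, identified with the unit circle via $\beta\mapsto e^{2\pi i\beta}$, let $h(\beta)=2\beta \bmod 1$, and let $h$ act on chords $\beta_1\beta_2$ of the unit disk by acting on their ends. The length of a chord is the length of the shorter arc between its ends. A chord is non-degenerate if its ends are different. Two chords cross if they are different but have a common interior point. A chord $B$ of length less than $\frac12$ divides the disk into a smaller and a bigger open part; a subset of the disk lies behind $B$ if at least one of its points lies in the smaller part and none in the bigger part. A chord lies between two disjoint chords $B_1,B_2$ if it is contained in the closed part of the disk bounded by $B_1$ and $B_2$ and has a point outside $B_1\cup B_2$; a chord $S_3$ separates $S_1$ and $S_2$ if $S_3$ lies between $S_1$ and $S_2$ but $S_2$ does not lie between $S_1$ and $S_3$. Periodic parameter leaves. For $m>1$, a chord $S=\alpha\gamma$ with $\alpha\ne\gamma$ is a periodic parameter leaf of period $m$ if $\alpha$ and $\gamma$ both have exact period $m$ under $h$, the iterates $h^i(S)$, $i\ge 0$, do not cross each other, and they do not cross the diameters $\frac{\alpha}{2}\frac{\alpha+1}{2}$ and $\frac{\gamma}{2}\frac{\gamma+1}{2}$. (These are the chords connecting the two external angles of the root of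 a hyperbolic component of period $m$ of the Mandelbrot set.) Let $\mathcal B_*$ be the set of all of them. Let $S,B\in\mathcal B_*$ with $B$ behind $S$. Then $B$ is immediately visible from $S$ if no leaf of $\mathcal B_*$ separates $S$ and $B$, and visible from $S$ if no leaf of $\mathcal B_*$ whose period is less than the period of $B$ separates $S$ and $B$. Dynamic lamination. Let $S\in\mathcal B_*$ have period $m$, let $\dot S=h^{m-1}(S)$ be the preimage of $S$ with periodic ends, and let $\ddot S$ be the chord obtained from $\dot S$ by a half turn (the preimage of $S$ with preperiodic ends). Let $\mathcal B_*(S)$ be the set of all chords $R$ such that some iterate $h^n(R)$, $n\ge0$, equals $S$, no iterate of $R$ is longer than $\dot S$ and $\ddot S$ or crosses one of them, and an iterate of $R$ that lies between $\dot S$ and $\ddot S$ has no end in common with them. Let $\mathcal B(S)$ be the union of $\mathcal B_*(S)$ with all non-degenerate limits of converging sequences of mutually different elements of $\mathcal B_*(S)$. An infinite gap of $\mathcal B(S)$ is the closure of a connected component of the open unit disk minus $\bigcup\mathcal B(S)$ whose boundary contains infinitely many leaves of $\mathcal B(S)$; the leaves contained in its boundary are its boundary leaves. The critical value gap of $\mathcal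 B(S)$ is the infinite gap that has $S$ as a boundary leaf and lies behind $S$. Proposition. Let $S\in\mathcal B_*$ have period $m$, let $q\ge 2$, and let $B\in\mathcal B_*$ be immediately visible from $S$ and of period $qm$. Then $\mathcal B(S)$ has exactly one critical value gap, and this gap has a unique boundary leaf $R_B$ with the following properties: the smallest $n\ge 0$ with $h^n(R_B)=S$ is $n=(q-1)m$; $R_B$ lies behind $B$; and each leaf of $\mathcal B_*$ that lies behind $B$ and is visible from $S$ lies behind $R_B$. -/

import Mathlib

noncomputable section

namespace QuadLam

/-- The circle `ℝ / ℤ` of angles. -/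
abbrev Angle : Type := UnitAddCircle

/-- Angle doubling. -/
def dbl (x : Angle) : Angle := (2 : ℕ) • x

/-- The half turn `1/2 ∈ ℝ / ℤ`. -/
def halfTurn : Angle := ((1 / 2 : ℝ) : UnitAddCircle)

/-- The point `e^{2 π i x}` of the unit circle in the complex plane. -/
def pt (x : Angle) : ℂ := ((AddCircle.toCircle x : Circle) : ℂ)

/-- A chord of the unit disk, given by the unordered pair of its ends.
It is non-degenerate if it is not a diagonal element of `Sym2`. -/
abbrev Chord : Type := Sym2 Angle

namespace Chord

/-- The `n`-th iterate of a chord under angle doubling. -/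
def iter (n : ℕ) (c : Chord) : Chord := Sym2.map (dbl^[n]) c

/-- The length of a chord: the length of the shorter arc between its ends
(the whole circle has length 1). -/
def length (c : Chord) : ℝ :=
  Sym2.lift ⟨fun a b : Angle => dist a b, fun a b => dist_comm a b⟩ c

/-- The two ends of the chord as points of the plane. -/
def endSet (c : Chord) : Set ℂ := {z | ∃ x ∈ c, z = pt x}

/-- The chord as a straight segment in the closed unit disk. -/
def seg (c : Chord) : Set ℂ := convexHull ℝ c.endSet

/-- The sum of the two ends in the plane. A chord that is not a diameter lies on the line of the
`z` with `2 ⟪z, w⟫ = ‖w‖ ^ 2`, `w` being this sum. -/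
def endSum (c : Chord) : ℂ :=
  Sym2.lift ⟨fun a b : Angle => pt a + pt b, fun a b => add_comm (pt a) (pt b)⟩ c

/-- The smaller of the two parts into which a chord of length less than `1/2` divides
the disk: the part that does not contain the centre. -/
def smallPart (c : Chord) : Set ℂ :=
  {z | ‖z‖ ≤ 1 ∧ ‖c.endSum‖ ^ 2 < 2 * inner ℝ z c.endSum}

/-- The bigger of the two parts into which a chord of length less than `1/2` divides
the disk: the part that contains the centre. -/
def bigPart (c : Chord) : Set ℂ :=
  {z | ‖z‖ ≤ 1 ∧ 2 * inner ℝ z c.endSum < ‖c.endSum‖ ^ 2}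

/-- Two chords cross if they are different, but have a common interior point. -/
def Cross (c d : Chord) : Prop :=
  c ≠ d ∧ ∃ z, z ∈ c.seg ∧ z ∈ d.seg ∧ z ∉ c.endSet ∧ z ∉ d.endSet

/-- The subset `X` of the disk is behind the chord `c`. -/
def SetBehind (X : Set ℂ) (c : Chord) : Prop :=
  (∃ z ∈ X, z ∈ c.smallPart) ∧ ∀ z ∈ X, z ∉ c.bigPart

/-- The chord `d` is behind the chord `c`. -/
def Behind (d c : Chord) : Prop := SetBehind d.seg c

/-- The point `z` and the set `X` lie strictly on opposite sides of the chord `c`. -/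
def Opposite (c : Chord) (z : ℂ) (X : Set ℂ) : Prop :=
  (z ∈ c.smallPart ∧ X ⊆ c.bigPart) ∨ (z ∈ c.bigPart ∧ X ⊆ c.smallPart)

/-- The closed part of the disk bounded by two disjoint chords. -/
def strip (c d : Chord) : Set ℂ :=
  {z | ‖z‖ ≤ 1 ∧ ¬ c.Opposite z d.seg ∧ ¬ d.Opposite z c.seg}

/-- The chord `x` lies between the disjoint chords `c` and `d`. -/
def Between (x c d : Chord) : Prop :=
  Disjoint c.seg d.seg ∧ x.seg ⊆ strip c d ∧ ∃ z ∈ x.seg, z ∉ c.seg ∧ z ∉ d.seg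

/-- The chord `x` separates the chords `c` and `d`. -/
def Separates (x c d : Chord) : Prop := Between x c d ∧ ¬ Between d c x

end Chord

open Chord

/-! ### The periodic parameter lamination -/

/-- `S` is a periodic parameter leaf of period `m > 1`: its two ends are different and have
exact period `m` under angle doubling, the iterates of `S` do not cross each other, and they do
not cross the two diameters that join the preimages `y` and `y + 1/2` of an end of `S`. -/
def IsParamLeaf (m : ℕ) (S : Chord) : Prop :=
  1 < m ∧ ¬ S.IsDiag ∧ (∀ x ∈ S, Function.minimalPeriod dbl x = m) ∧
    (∀ i j : ℕ, ¬ Cross (iter i S) (iter j S)) ∧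
    ∀ (i : ℕ) (y : Angle), dbl y ∈ S → ¬ Cross (iter i S) s(y, y + halfTurn)

/-- `B` (a periodic parameter leaf) is immediately visible from `S`. -/
def ImmediatelyVisible (S B : Chord) : Prop :=
  Behind B S ∧ ¬ ∃ (k : ℕ) (L : Chord), IsParamLeaf k L ∧ Separates L S B

/-- `B` is a periodic parameter leaf visible from `S`. -/
def Visible (S B : Chord) : Prop :=
  ∃ n : ℕ, IsParamLeaf n B ∧ Behind B S ∧
    ¬ ∃ (k : ℕ) (L : Chord), k < n ∧ IsParamLeaf k L ∧ Separates L S B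

/-! ### The dynamic lamination of a periodic parameter leaf `S` of period `m` -/

/-- The preimage of `S` with periodic ends. -/
def dotLeaf (m : ℕ) (S : Chord) : Chord := iter (m - 1) S

/-- The preimage of `S` with preperiodic ends (the other preimage of each end). -/
def ddotLeaf (m : ℕ) (S : Chord) : Chord := Sym2.map (fun x => x + halfTurn) (dotLeaf m S)

/-- The generating dynamic lamination of `S`. The preimages of `S` with periodic and with
preperiodic ends are equally long. -/
def genLam (m : ℕ) (S : Chord) : Set Chord :=
  {R | (∃ n, iter n R = S) ∧
    ∀ n, (iter n R).length ≤ (dotLeaf m S).length ∧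
      (iter n R).length ≤ (ddotLeaf m S).length ∧
      ¬ Cross (iter n R) (dotLeaf m S) ∧ ¬ Cross (iter n R) (ddotLeaf m S) ∧
      (Between (iter n R) (dotLeaf m S) (ddotLeaf m S) →
        ∀ x ∈ iter n R, x ∉ dotLeaf m S ∧ x ∉ ddotLeaf m S)}

/-- `c` is the limit of a converging sequence of mutually different elements of `A`. -/
def IsAccumulation (A : Set Chord) (c : Chord) : Prop :=
  ∃ (a b : ℕ → Angle) (x y : Angle),
    (∀ n, s(a n, b n) ∈ A) ∧ Function.Injective (fun n => s(a n, b n)) ∧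
    Filter.Tendsto a Filter.atTop (nhds x) ∧ Filter.Tendsto b Filter.atTop (nhds y) ∧
    c = s(x, y)

/-- The entire dynamic lamination of `S`: the generating one together with its non-degenerate
accumulation chords. -/
def dynLam (m : ℕ) (S : Chord) : Set Chord :=
  genLam m S ∪ {c | ¬ c.IsDiag ∧ IsAccumulation (genLam m S) c}

/-- The open unit disk without the leaves of the entire dynamic lamination of `S`. -/
def leafComplement (m : ℕ) (S : Chord) : Set ℂ :=
  {z | ‖z‖ < 1 ∧ ∀ L ∈ dynLam m S, z ∉ L.seg}

/-- `R` is a leaf of the entire dynamic lamination of `S` in the boundary of `G`. -/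
def IsBoundaryLeaf (m : ℕ) (S : Chord) (G : Set ℂ) (R : Chord) : Prop :=
  R ∈ dynLam m S ∧ R.seg ⊆ frontier G

/-- `G` is an infinite gap of the entire dynamic lamination of `S`: the closure of a connected
component of the complement of the leaves that is bounded by infinitely many leaves. -/
def IsInfiniteGap (m : ℕ) (S : Chord) (G : Set ℂ) : Prop :=
  (∃ z ∈ leafComplement m S, G = closure (connectedComponentIn (leafComplement m S) z)) ∧
    {R | IsBoundaryLeaf m S G R}.Infinite

/-- `G` is the critical value gap of the entire dynamic lamination of `S`: the infinite gap
bounded by `S` and lying behind `S`. -/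
def IsCriticalValueGap (m : ℕ) (S : Chord) (G : Set ℂ) : Prop :=
  IsInfiniteGap m S G ∧ IsBoundaryLeaf m S G S ∧ SetBehind G S

end QuadLam

end

/-!
Let `α < γ` be lifts of the ends of `S`, and put `M = 2 ^ m`. In the coordinate `arcPt` in which the
arc from `α` to `γ` is the unit interval, the `m`-th iterate of doubling expands the first and the
last subinterval of length `1 / M` onto the whole interval. The points that never enter the middle
gap under the iteration of these two branches form a Cantor set, and the chords over its gaps are the
leaves `gapLeaf`, one for each finite word of branches. All of them belong to the dynamic lamination
(`LeafData.gapLeaf_mem_genLam`). No leaf of the lamination is linked with a chord joining two points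
of the Cantor set (`LeafData.not_linked_cantor`): linkedness would persist under doubling until it
contradicts the conditions on length, crossing and common ends at the two preimages of `S`. Hence
the critical value gap is unique, and it is bounded by `S` and the gap leaves
(`LeafData.eq_of_isCriticalValueGap`, `LeafData.eq_of_isBoundaryLeaf`). The gap leaf of a word `w`
needs exactly `(w.length + 1) * m` steps to reach `S` (`LeafData.isLeast_iter_gapLeaf`).

The main point is that an immediately visible leaf `B` of period `q * m` is a satellite of `S`. For
each rotation number `p / k` the two branches have a unique periodic orbit on which they preserve the
cyclic order; its points are given by the explicit formula `rotPt`. The chord joining the images of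
its last and first point, the critical values, is a parameter leaf (`LeafData.satellite`). On the
other hand, cutting off the expanding map at an end of `B` yields a monotone circle map of degree
one with a plateau, and since the iterates of `B` cross neither each other nor the preimages of `S`
and `B`, the two ends of `B` have the same rotation number for their plateau maps
(`LeafData.sameRotation`). Therefore both ends lie between the critical values of one rotation set
(`exists_rotData`). If `B` were not the chord joining these critical values, then that chord would be
a parameter leaf separating `S` and `B` (`LeafData.eq_satellite`).

The orbits of the two ends of `B` follow the same word `w` of length `q - 2`, until the middle gap
lies between them (`RotData.exists_word`), so the gap leaf of `w` lies behind `B`. Gaps with words of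
this length are so long that there is only one of them behind `B` (`LeafData.gap_unique`). An angle
between `B` and the gap leaf has no period up to `q * m`, because its first `q - 1` returns are not
behind `B`, and the next one is farther away from the end of `B` (`LeafData.mem_gap_of_periodic`). The
period of a visible leaf behind `B` other than `B` is at most `q * m`, since `B` separates it from
`S`; thus each of its ends is an end of `B` or lies in the gap. It has no end in common with `B`, as
otherwise some iterate of it would be linked with the largest gap leaf
(`LeafData.behind_gapLeaf_of_visible`).
-/

noncomputable section

namespace QuadLam

open Chord

/-! ### Angles and their real lifts -/

theorem coe_eq_coe_iff {x y : ℝ} : (x : Angle) = (y : Angle) ↔ ∃ n : ℤ, x = y + n := by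
  have h : (x : Angle) = (y : Angle) ↔ ((x - y : ℝ) : Angle) = 0 := by
    rw [AddCircle.coe_sub, sub_eq_zero]
  rw [h, AddCircle.coe_eq_zero_iff]
  constructor
  · rintro ⟨n, hn⟩
    exact ⟨n, by simp at hn; linarith⟩
  · rintro ⟨n, hn⟩
    exact ⟨n, by simp; linarith⟩

theorem coe_add_int (x : ℝ) (n : ℤ) : ((x + n : ℝ) : Angle) = (x : Angle) :=
  coe_eq_coe_iff.2 ⟨n, rfl⟩

theorem coe_add_one (x : ℝ) : ((x + 1 : ℝ) : Angle) = (x : Angle) :=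
  coe_eq_coe_iff.2 ⟨1, by simp⟩

theorem coe_sub_one (x : ℝ) : ((x - 1 : ℝ) : Angle) = (x : Angle) :=
  coe_eq_coe_iff.2 ⟨-1, by simp; ring⟩

theorem coe_sub_int (x : ℝ) (n : ℤ) : ((x - n : ℝ) : Angle) = (x : Angle) :=
  coe_eq_coe_iff.2 ⟨-n, by push_cast; ring⟩

/-- Every angle has a lift in any half-open interval of length one. -/
theorem exists_lift (t : Angle) (c : ℝ) : ∃ r : ℝ, c ≤ r ∧ r < c + 1 ∧ (r : Angle) = t := by
  obtain ⟨x, rfl⟩ := QuotientAddGroup.mk_surjective t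
  refine ⟨x - ⌊x - c⌋, ?_, ?_, coe_sub_int x _⟩
  · linarith [Int.floor_le (x - c)]
  · linarith [Int.lt_floor_add_one (x - c)]

theorem dbl_coe (x : ℝ) : dbl (x : Angle) = ((2 * x : ℝ) : Angle) := by
  unfold dbl
  rw [← AddCircle.coe_nsmul]
  simp

theorem dbl_iterate_coe (n : ℕ) (x : ℝ) : dbl^[n] (x : Angle) = ((2 ^ n * x : ℝ) : Angle) := by
  induction n with
  | zero => simp
  | succ n ih => rw [Function.iterate_succ_apply', ih, dbl_coe]; congr 1; ring

theorem iter_mk (n : ℕ) (x y : ℝ) :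
    iter n s((x : Angle), (y : Angle)) = s(((2 ^ n * x : ℝ) : Angle), ((2 ^ n * y : ℝ) : Angle)) := by
  simp [iter, dbl_iterate_coe]

theorem iter_add (n k : ℕ) (c : Chord) : iter (n + k) c = iter n (iter k c) := by
  induction c using Sym2.ind with
  | _ x y => simp [iter, Function.iterate_add_apply]

/-- An angle different from that of `x` has a lift strictly between `x` and `x + 1`. -/
theorem exists_lift_lt {x : ℝ} {Y : Angle} (h : (x : Angle) ≠ Y) :
    ∃ y : ℝ, x < y ∧ y < x + 1 ∧ (y : Angle) = Y := by
  obtain ⟨y, h1, h2, rfl⟩ := exists_lift Y x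
  refine ⟨y, lt_of_le_of_ne h1 ?_, h2, rfl⟩
  rintro rfl
  exact h rfl

theorem exists_coe_mk_lt {c : Chord} (h : ¬ c.IsDiag) :
    ∃ x y : ℝ, 0 ≤ x ∧ x < 1 ∧ x < y ∧ y < x + 1 ∧ c = s((x : Angle), (y : Angle)) := by
  induction c using Sym2.ind with
  | _ X Y =>
    obtain ⟨x, h0, h1, rfl⟩ := exists_lift X 0
    obtain ⟨y, h2, h3, rfl⟩ := exists_lift_lt (x := x) (Y := Y) (by simpa using h)
    exact ⟨x, y, h0, by linarith, h2, h3, rfl⟩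

/-- The angle `t` lies in the open arc from `x` to `y`. -/
def OpArc (x y : ℝ) (t : Angle) : Prop := ∃ r : ℝ, x < r ∧ r < y ∧ (r : Angle) = t

/-- The angle `t` lies in the closed arc from `x` to `y`. -/
def ClArc (x y : ℝ) (t : Angle) : Prop := ∃ r : ℝ, x ≤ r ∧ r ≤ y ∧ (r : Angle) = t

theorem OpArc.clArc {x y : ℝ} {t : Angle} (h : OpArc x y t) : ClArc x y t :=
  let ⟨r, h1, h2, h3⟩ := h
  ⟨r, h1.le, h2.le, h3⟩

theorem OpArc.mono {x y x' y' : ℝ} {t : Angle} (h : OpArc x y t) (hx : x' ≤ x) (hy : y ≤ y') :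
    OpArc x' y' t :=
  let ⟨r, h1, h2, h3⟩ := h
  ⟨r, by linarith, by linarith, h3⟩

theorem ClArc.mono {x y x' y' : ℝ} {t : Angle} (h : ClArc x y t) (hx : x' ≤ x) (hy : y ≤ y') :
    ClArc x' y' t :=
  let ⟨r, h1, h2, h3⟩ := h
  ⟨r, by linarith, by linarith, h3⟩

theorem opArc_add_int {x y : ℝ} {t : Angle} (n : ℤ) : OpArc (x + n) (y + n) t ↔ OpArc x y t := by
  constructor
  · rintro ⟨r, h1, h2, h3⟩
    exact ⟨r - n, by linarith, by linarith, by rw [coe_sub_int, h3]⟩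
  · rintro ⟨r, h1, h2, h3⟩
    exact ⟨r + n, by linarith, by linarith, by rw [coe_add_int, h3]⟩

theorem opArc_coe_iff {x y t : ℝ} : OpArc x y (t : Angle) ↔ ∃ n : ℤ, x < t - n ∧ t - n < y := by
  constructor
  · rintro ⟨r, h1, h2, h3⟩
    obtain ⟨n, hn⟩ := coe_eq_coe_iff.1 h3.symm
    exact ⟨n, by linarith, by linarith⟩
  · rintro ⟨n, h1, h2⟩
    exact ⟨t - n, h1, h2, coe_sub_int t n⟩

theorem clArc_coe_iff {x y t : ℝ} : ClArc x y (t : Angle) ↔ ∃ n : ℤ, x ≤ t - n ∧ t - n ≤ y := by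
  constructor
  · rintro ⟨r, h1, h2, h3⟩
    obtain ⟨n, hn⟩ := coe_eq_coe_iff.1 h3.symm
    exact ⟨n, by linarith, by linarith⟩
  · rintro ⟨n, h1, h2⟩
    exact ⟨t - n, h1, h2, coe_sub_int t n⟩

theorem eq_of_coe_eq {x y : ℝ} (h : (x : Angle) = y) (h1 : x < y + 1) (h2 : y < x + 1) :
    x = y := by
  obtain ⟨n, hn⟩ := coe_eq_coe_iff.1 h
  have h3 : (n : ℝ) < 1 := by linarith
  have h4 : (-1 : ℝ) < n := by linarith
  have h5 : n < 1 := by exact_mod_cast h3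
  have h6 : -1 < n := by exact_mod_cast h4
  have : n = 0 := by omega
  subst this
  simpa using hn

/-- An open arc and the complementary closed arc are disjoint. -/
theorem OpArc.not_clArc {x y z w : ℝ} {t : Angle} (h : OpArc x y t) (hz : y ≤ z) (hw : w ≤ x + 1) :
    ¬ ClArc z w t := by
  rintro ⟨r, h1, h2, h3⟩
  obtain ⟨u, h4, h5, h6⟩ := h
  have := eq_of_coe_eq (h3.trans h6.symm) (by linarith) (by linarith)
  linarith

theorem opArc_or_clArc {x y : ℝ} (hxy : y ≤ x + 1) (t : Angle) : OpArc x y t ∨ ClArc y (x + 1) t := by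
  obtain ⟨r, h1, h2, h3⟩ := exists_lift t x
  by_cases h : r < y
  · rcases h1.eq_or_lt with h4 | h4
    · exact Or.inr ⟨r + 1, by linarith, by linarith, by rw [coe_add_one, h3]⟩
    · exact Or.inl ⟨r, h4, h, h3⟩
  · exact Or.inr ⟨r, by linarith, h2.le, h3⟩

theorem clArc_or_opArc (x y : ℝ) (t : Angle) : ClArc x y t ∨ OpArc y (x + 1) t := by
  obtain ⟨r, h1, h2, h3⟩ := exists_lift t x
  by_cases h : r ≤ y
  · exact Or.inl ⟨r, h1, h, h3⟩
  · exact Or.inr ⟨r, by linarith, h2, h3⟩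

theorem OpArc.ne_left {x y : ℝ} {t : Angle} (h : OpArc x y t) (hy : y ≤ x + 1) : t ≠ x := by
  rintro rfl
  exact h.not_clArc hy le_rfl ⟨x + 1, le_rfl, le_rfl, coe_add_one x⟩

theorem OpArc.ne_right {x y : ℝ} {t : Angle} (h : OpArc x y t) (hy : y ≤ x + 1) : t ≠ y := by
  rintro rfl
  exact h.not_clArc le_rfl le_rfl ⟨y, le_rfl, hy, rfl⟩

theorem ClArc.opArc {x y : ℝ} {t : Angle} (h : ClArc x y t) (hx : t ≠ x) (hy : t ≠ y) :
    OpArc x y t := by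
  obtain ⟨r, h1, h2, rfl⟩ := h
  refine ⟨r, lt_of_le_of_ne h1 ?_, lt_of_le_of_ne h2 ?_, rfl⟩
  · rintro rfl; exact hx rfl
  · rintro rfl; exact hy rfl

/-! ### Linked chords -/

/-- The ends of the two chords are different and alternate on the circle. -/
def Linked (c d : Chord) : Prop :=
  ∃ x z y w : ℝ, x < z ∧ z < y ∧ y < w ∧ w < x + 1 ∧
    c = s((x : Angle), (y : Angle)) ∧ d = s((z : Angle), (w : Angle))

theorem Linked.symm {c d : Chord} (h : Linked c d) : Linked d c := by
  obtain ⟨x, z, y, w, h1, h2, h3, h4, rfl, rfl⟩ := h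
  exact ⟨z, y, w, x + 1, h2, h3, h4, by linarith, rfl, by rw [coe_add_one, Sym2.eq_swap]⟩

theorem linked_iff {x y : ℝ} (hxy : x < y) (hyx : y < x + 1) (Z W : Angle) :
    Linked s((x : Angle), (y : Angle)) s(Z, W) ↔
      (OpArc x y Z ∧ OpArc y (x + 1) W) ∨ (OpArc x y W ∧ OpArc y (x + 1) Z) := by
  constructor
  · rintro ⟨x', z, y', w, h1, h2, h3, h4, h5, h6⟩
    have key : (OpArc x y z ∧ OpArc y (x + 1) w) ∨ (OpArc x y w ∧ OpArc y (x + 1) z) := by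
      rcases Sym2.eq_iff.1 h5 with ⟨ha, hb⟩ | ⟨ha, hb⟩
      · obtain ⟨n, hn⟩ := coe_eq_coe_iff.1 ha
        have hy : y = y' + n := by
          refine eq_of_coe_eq (by rw [hb, coe_add_int]) (by linarith) (by linarith)
        left
        exact ⟨⟨z + n, by linarith, by linarith, coe_add_int _ _⟩,
          ⟨w + n, by linarith, by linarith, coe_add_int _ _⟩⟩
      · obtain ⟨n, hn⟩ := coe_eq_coe_iff.1 ha
        have hy : y = x' + 1 + n := by
          refine eq_of_coe_eq (by rw [hb, coe_add_int, coe_add_one]) (by linarith) (by linarith)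
        right
        refine ⟨⟨w + n, by linarith, by linarith, coe_add_int _ _⟩,
          ⟨z + n + 1, by linarith, by linarith, by rw [coe_add_one, coe_add_int]⟩⟩
    rcases Sym2.eq_iff.1 h6 with ⟨rfl, rfl⟩ | ⟨rfl, rfl⟩
    · exact key
    · exact key.symm
  · rintro (⟨⟨z, h1, h2, rfl⟩, ⟨w, h3, h4, rfl⟩⟩ | ⟨⟨z, h1, h2, rfl⟩, ⟨w, h3, h4, rfl⟩⟩)
    · exact ⟨x, z, y, w, h1, h2, h3, h4, rfl, rfl⟩
    · exact ⟨x, z, y, w, h1, h2, h3, h4, rfl, Sym2.eq_swap⟩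

theorem Linked.not_isDiag_right {c d : Chord} (h : Linked c d) : ¬ d.IsDiag := by
  obtain ⟨x, z, y, w, h1, h2, h3, h4, rfl, rfl⟩ := h
  intro h
  have := eq_of_coe_eq (Sym2.mk_isDiag_iff.1 h) (by linarith) (by linarith)
  linarith

/-- A chord with an end strictly inside and an end strictly outside an arc links the chord of the
arc. -/
theorem linked_of_opArc {x y : ℝ} {Z W : Angle} (hxy : x < y) (hyx : y < x + 1)
    (hZ : OpArc x y Z) (hW : OpArc y (x + 1) W) : Linked s((x : Angle), (y : Angle)) s(Z, W) :=
  (linked_iff hxy hyx Z W).2 (Or.inl ⟨hZ, hW⟩)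

/-- A chord linked with a chord whose ends lie in the closed arc from `p` to `q` has an end in the
open arc. -/
theorem Linked.exists_opArc {p q z w : ℝ} {X Y : Angle} (hq : q < p + 1)
    (hz : p ≤ z) (hz' : z ≤ q) (hw : p ≤ w) (hw' : w ≤ q)
    (h : Linked s(X, Y) s((z : Angle), (w : Angle))) : OpArc p q X ∨ OpArc p q Y := by
  rcases lt_trichotomy z w with hzw | rfl | hzw
  · rcases (linked_iff hzw (by linarith) X Y).1 h.symm with ⟨h1, -⟩ | ⟨h1, -⟩
    · exact Or.inl (h1.mono hz hw')
    · exact Or.inr (h1.mono hz hw')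
  · exact absurd rfl h.not_isDiag_right
  · rw [Sym2.eq_swap (a := (z : Angle))] at h
    rcases (linked_iff hzw (by linarith) X Y).1 h.symm with ⟨h1, -⟩ | ⟨h1, -⟩
    · exact Or.inl (h1.mono hw hz')
    · exact Or.inr (h1.mono hw hz')

/-- A chord linked with a chord whose ends lie in a closed arc, but not linked with the chord of
this arc, has its ends in the arc, too. -/
theorem Linked.trapped {p q z w : ℝ} {X Y : Angle} (hpq : p < q) (hq : q < p + 1)
    (hz : p ≤ z) (hz' : z ≤ q) (hw : p ≤ w) (hw' : w ≤ q)
    (h : Linked s(X, Y) s((z : Angle), (w : Angle)))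
    (h' : ¬ Linked s(X, Y) s((p : Angle), (q : Angle))) : ClArc p q X ∧ ClArc p q Y := by
  have key : ∀ {X Y : Angle}, ¬ Linked s(X, Y) s((p : Angle), (q : Angle)) →
      OpArc p q X → ClArc p q X ∧ ClArc p q Y := by
    intro X Y h' hX
    refine ⟨hX.clArc, ?_⟩
    rcases clArc_or_opArc p q Y with hY | hY
    · exact hY
    · exact absurd (linked_of_opArc hpq hq hX hY).symm h'
  rcases h.exists_opArc hq hz hz' hw hw' with hX | hY
  · exact key h' hX
  · exact (key (by rwa [Sym2.eq_swap]) hY).symm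

/-- Doubling preserves linkedness of chords with ends in an arc of length less than `1/2`. -/
theorem Linked.double {p q : ℝ} {X Y Z W : Angle} (hq : q < p + 1 / 2)
    (hX : ClArc p q X) (hY : ClArc p q Y) (hZ : ClArc p q Z) (hW : ClArc p q W)
    (h : Linked s(X, Y) s(Z, W)) : Linked s(dbl X, dbl Y) s(dbl Z, dbl W) := by
  obtain ⟨x, hx, hx', rfl⟩ := hX
  obtain ⟨y, hy, hy', rfl⟩ := hY
  have key : ∀ x y : ℝ, x < y → p ≤ x → y ≤ q → Linked s((x : Angle), (y : Angle)) s(Z, W) →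
      Linked s(dbl (x : Angle), dbl (y : Angle)) s(dbl Z, dbl W) := by
    intro x y hxy hx hy h
    have outer : ∀ {T : Angle}, ClArc p q T → OpArc y (x + 1) T →
        OpArc (2 * y) (2 * x + 1) (dbl T) := by
      rintro T ⟨t, ht, ht', rfl⟩ hT
      rw [opArc_coe_iff] at hT
      obtain ⟨n, h1, h2⟩ := hT
      have h3 : (n : ℝ) < 1 := by linarith
      have h4 : (-2 : ℝ) < n := by linarith
      have h5 : n < 1 := by exact_mod_cast h3
      have h6 : -2 < n := by exact_mod_cast h4
      obtain rfl | rfl : n = 0 ∨ n = -1 := by omega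
      · refine ⟨2 * t, ?_, ?_, (dbl_coe t).symm⟩
        · push_cast at h1; linarith
        · linarith
      · refine ⟨2 * t + 1, ?_, ?_, by rw [coe_add_one, dbl_coe]⟩
        · linarith
        · push_cast at h2; linarith
    have inner' : ∀ {T : Angle}, OpArc x y T → OpArc (2 * x) (2 * y) (dbl T) := by
      rintro T ⟨t, ht, ht', rfl⟩
      exact ⟨2 * t, by linarith, by linarith, (dbl_coe t).symm⟩
    rw [dbl_coe, dbl_coe, linked_iff (by linarith) (by linarith)]
    rcases (linked_iff hxy (by linarith) Z W).1 h with ⟨h1, h2⟩ | ⟨h1, h2⟩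
    · exact Or.inl ⟨inner' h1, outer hW h2⟩
    · exact Or.inr ⟨inner' h1, outer hZ h2⟩
  rcases lt_trichotomy x y with hxy | rfl | hxy
  · exact key x y hxy hx hy' h
  · exact absurd rfl h.symm.not_isDiag_right
  · rw [Sym2.eq_swap (a := dbl (x : Angle))]
    rw [Sym2.eq_swap (a := (x : Angle))] at h
    exact key y x hxy hy hx' h

/-! ### Chords in the plane -/

theorem pt_coe (x : ℝ) : pt (x : Angle) = Complex.exp ((2 * Real.pi * x : ℝ) * Complex.I) := by
  unfold pt
  rw [AddCircle.toCircle_apply_mk, Circle.coe_exp]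
  simp

theorem pt_re (x : ℝ) : (pt (x : Angle)).re = Real.cos (2 * Real.pi * x) := by
  rw [pt_coe, Complex.exp_ofReal_mul_I_re]

theorem pt_im (x : ℝ) : (pt (x : Angle)).im = Real.sin (2 * Real.pi * x) := by
  rw [pt_coe, Complex.exp_ofReal_mul_I_im]

theorem norm_pt (x : Angle) : ‖pt x‖ = 1 := Circle.norm_coe _

theorem pt_injective : Function.Injective pt := fun _ _ h =>
  AddCircle.injective_toCircle one_ne_zero (Subtype.ext h)

theorem continuous_pt : Continuous pt :=
  continuous_subtype_val.comp AddCircle.continuous_toCircle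

/-- The signed distance of `z` from the line through the points of the circle with angles `x` and
`y`, positive on the side of the arc from `x` to `y` if `x < y < x + 1`. -/
def side (x y : ℝ) (z : ℂ) : ℝ :=
  z.re * Real.cos (Real.pi * (x + y)) + z.im * Real.sin (Real.pi * (x + y)) -
    Real.cos (Real.pi * (y - x))

theorem side_pt (x y t : ℝ) :
    side x y (pt (t : Angle)) =
      -2 * Real.sin (Real.pi * (t - x)) * Real.sin (Real.pi * (t - y)) := by
  unfold side
  rw [pt_re, pt_im, ← Real.cos_sub, show Real.pi * (y - x) =
    Real.pi * (t - x) - Real.pi * (t - y) by ring, show 2 * Real.pi * t - Real.pi * (x + y) =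
    Real.pi * (t - x) + Real.pi * (t - y) by ring, Real.cos_add, Real.cos_sub]
  ring

theorem sin_pi_mul_pos {t : ℝ} (h0 : 0 < t) (h1 : t < 1) : 0 < Real.sin (Real.pi * t) :=
  Real.sin_pos_of_pos_of_lt_pi (by positivity) (by nlinarith [Real.pi_pos])

theorem sin_pi_mul_neg {t : ℝ} (h0 : -1 < t) (h1 : t < 0) : Real.sin (Real.pi * t) < 0 := by
  have := sin_pi_mul_pos (t := -t) (by linarith) (by linarith)
  rw [mul_neg, Real.sin_neg] at this
  linarith

theorem side_pt_left (x y : ℝ) : side x y (pt (x : Angle)) = 0 := by simp [side_pt]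

theorem side_pt_right (x y : ℝ) : side x y (pt (y : Angle)) = 0 := by simp [side_pt]

theorem side_pt_pos {x y : ℝ} {t : Angle} (hyx : y ≤ x + 1) (h : OpArc x y t) :
    0 < side x y (pt t) := by
  obtain ⟨r, h1, h2, rfl⟩ := h
  rw [side_pt]
  have := mul_pos (sin_pi_mul_pos (t := r - x) (by linarith) (by linarith))
    (neg_pos.2 (sin_pi_mul_neg (t := r - y) (by linarith) (by linarith)))
  linarith

theorem side_pt_neg {x y : ℝ} {t : Angle} (hxy : x ≤ y) (h : OpArc y (x + 1) t) :
    side x y (pt t) < 0 := by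
  obtain ⟨r, h1, h2, rfl⟩ := h
  rw [side_pt]
  have := mul_pos (sin_pi_mul_pos (t := r - x) (by linarith) (by linarith))
    (sin_pi_mul_pos (t := r - y) (by linarith) (by linarith))
  linarith

theorem side_pt_nonneg {x y : ℝ} {t : Angle} (hyx : y ≤ x + 1) (h : ClArc x y t) :
    0 ≤ side x y (pt t) := by
  by_cases h1 : t = x
  · rw [h1, side_pt_left]
  by_cases h2 : t = y
  · rw [h2, side_pt_right]
  exact (side_pt_pos hyx (h.opArc h1 h2)).le

theorem side_pt_nonpos {x y : ℝ} {t : Angle} (hxy : x ≤ y) (h : ClArc y (x + 1) t) :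
    side x y (pt t) ≤ 0 := by
  by_cases h1 : t = y
  · rw [h1, side_pt_right]
  by_cases h2 : t = x
  · rw [h2, side_pt_left]
  exact (side_pt_neg hxy (h.opArc h1 (by rwa [coe_add_one]))).le

theorem opArc_of_side_pos {x y : ℝ} {t : Angle} (hxy : x ≤ y) (h : 0 < side x y (pt t)) :
    OpArc x y t := by
  obtain ⟨r, h1, h2, rfl⟩ := exists_lift t x
  by_cases hr : y ≤ r
  · exact absurd (side_pt_nonpos hxy ⟨r, hr, h2.le, rfl⟩) (not_le.2 h)
  · push Not at hr
    rcases h1.eq_or_lt with rfl | h1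
    · rw [side_pt_left] at h; exact absurd h (lt_irrefl _)
    · exact ⟨r, h1, hr, rfl⟩

theorem opArc_of_side_neg {x y : ℝ} {t : Angle} (hyx : y ≤ x + 1) (h : side x y (pt t) < 0) :
    OpArc y (x + 1) t := by
  obtain ⟨r, h1, h2, rfl⟩ := exists_lift t x
  by_cases hr : y < r
  · exact ⟨r, hr, h2, rfl⟩
  · exact absurd (side_pt_nonneg hyx ⟨r, h1, not_lt.1 hr, rfl⟩) (not_le.2 h)

theorem eq_or_eq_of_side_eq_zero {x y : ℝ} {t : Angle} (hxy : x ≤ y) (hyx : y ≤ x + 1)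
    (h : side x y (pt t) = 0) : t = x ∨ t = y := by
  rcases opArc_or_clArc hyx t with h1 | h1
  · exact absurd h (side_pt_pos hyx h1).ne'
  · by_contra! h2
    exact (side_pt_neg hxy (h1.opArc h2.2 (by rw [coe_add_one]; exact h2.1))).ne h

theorem side_combo (x y : ℝ) (z w : ℂ) {a b : ℝ} (h : a + b = 1) :
    side x y (a • z + b • w) = a * side x y z + b * side x y w := by
  simp only [side, Complex.add_re, Complex.add_im, Complex.smul_re, Complex.smul_im, smul_eq_mul]
  linear_combination Real.cos (Real.pi * (y - x)) * h

theorem continuous_side (x y : ℝ) : Continuous (side x y) := by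
  unfold side; fun_prop

theorem convex_side_nonneg (x y : ℝ) : Convex ℝ {z | 0 ≤ side x y z} := by
  intro z hz w hw a b ha hb hab
  simp only [Set.mem_ofPred_eq] at *
  rw [side_combo x y z w hab]; positivity

theorem convex_side_nonpos (x y : ℝ) : Convex ℝ {z | side x y z ≤ 0} := by
  intro z hz w hw a b ha hb hab
  simp only [Set.mem_ofPred_eq] at *
  rw [side_combo x y z w hab]; nlinarith

theorem convex_side_neg (x y : ℝ) : Convex ℝ {z | side x y z < 0} := by
  intro z hz w hw a b ha hb hab
  simp only [Set.mem_ofPred_eq] at *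
  rw [side_combo x y z w hab]
  rcases ha.eq_or_lt with rfl | ha
  · have : b = 1 := by linarith
    subst this; linarith
  · nlinarith

theorem convex_side_pos (x y : ℝ) : Convex ℝ {z | 0 < side x y z} := by
  intro z hz w hw a b ha hb hab
  simp only [Set.mem_ofPred_eq] at *
  rw [side_combo x y z w hab]
  rcases ha.eq_or_lt with rfl | ha
  · have : b = 1 := by linarith
    subst this; linarith
  · nlinarith [mul_nonneg hb hw.le, mul_pos ha hz]

theorem endSet_mk (X Y : Angle) : endSet s(X, Y) = {pt X, pt Y} := by
  ext z
  simp [endSet]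

theorem seg_mk (X Y : Angle) : seg s(X, Y) = segment ℝ (pt X) (pt Y) := by
  rw [seg, endSet_mk, convexHull_pair]

theorem pt_mem_seg {c : Chord} {x : Angle} (h : x ∈ c) : pt x ∈ c.seg :=
  subset_convexHull ℝ _ ⟨x, h, rfl⟩

theorem seg_subset {c : Chord} {A : Set ℂ} (hA : Convex ℝ A) (h : ∀ x ∈ c, pt x ∈ A) :
    c.seg ⊆ A := by
  refine convexHull_min ?_ hA
  rintro z ⟨x, hx, rfl⟩
  exact h x hx

theorem norm_le_one_of_mem_seg {c : Chord} {z : ℂ} (h : z ∈ c.seg) : ‖z‖ ≤ 1 := by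
  have : c.seg ⊆ Metric.closedBall (0 : ℂ) 1 :=
    seg_subset (convex_closedBall _ _) fun x _ => by simp [norm_pt]
  simpa using this h

theorem side_eq_zero_of_mem_seg {x y : ℝ} {z : ℂ} (h : z ∈ seg s((x : Angle), (y : Angle))) :
    side x y z = 0 := by
  rw [seg_mk] at h
  obtain ⟨a, b, ha, hb, hab, rfl⟩ := h
  rw [side_combo x y _ _ hab, side_pt_left, side_pt_right]
  ring

/-- The coordinate along the line through two points of the circle. -/
def tangentCoord (x y : ℝ) (z : ℂ) : ℝ :=
  -z.re * Real.sin (Real.pi * (x + y)) + z.im * Real.cos (Real.pi * (x + y))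

theorem re_eq_side_add_tangentCoord (x y : ℝ) (z : ℂ) :
    z.re = (side x y z + Real.cos (Real.pi * (y - x))) * Real.cos (Real.pi * (x + y)) -
      tangentCoord x y z * Real.sin (Real.pi * (x + y)) := by
  unfold side tangentCoord
  linear_combination (-z.re) * Real.sin_sq_add_cos_sq (Real.pi * (x + y))

theorem im_eq_side_add_tangentCoord (x y : ℝ) (z : ℂ) :
    z.im = (side x y z + Real.cos (Real.pi * (y - x))) * Real.sin (Real.pi * (x + y)) +
      tangentCoord x y z * Real.cos (Real.pi * (x + y)) := by
  unfold side tangentCoord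
  linear_combination (-z.im) * Real.sin_sq_add_cos_sq (Real.pi * (x + y))

theorem tangentCoord_left (x y : ℝ) :
    tangentCoord x y (pt (x : Angle)) = -Real.sin (Real.pi * (y - x)) := by
  unfold tangentCoord
  rw [pt_re, pt_im, show Real.pi * (y - x) = Real.pi * (x + y) - 2 * Real.pi * x by ring,
    Real.sin_sub]
  ring

theorem tangentCoord_right (x y : ℝ) :
    tangentCoord x y (pt (y : Angle)) = Real.sin (Real.pi * (y - x)) := by
  unfold tangentCoord
  rw [pt_re, pt_im, show Real.pi * (y - x) = 2 * Real.pi * y - Real.pi * (x + y) by ring,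
    Real.sin_sub]
  ring

/-- The part in the disk of the line through two points of the circle is the chord. -/
theorem mem_seg_of_side_eq_zero {x y : ℝ} {z : ℂ} (hxy : x < y) (hyx : y < x + 1)
    (h : side x y z = 0) (hz : ‖z‖ ≤ 1) : z ∈ seg s((x : Angle), (y : Angle)) := by
  rw [seg_mk]
  have hs : 0 < Real.sin (Real.pi * (y - x)) := sin_pi_mul_pos (by linarith) (by linarith)
  have hre := re_eq_side_add_tangentCoord x y z
  have him := im_eq_side_add_tangentCoord x y z
  have hxre := re_eq_side_add_tangentCoord x y (pt (x : Angle))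
  have hxim := im_eq_side_add_tangentCoord x y (pt (x : Angle))
  have hyre := re_eq_side_add_tangentCoord x y (pt (y : Angle))
  have hyim := im_eq_side_add_tangentCoord x y (pt (y : Angle))
  rw [side_pt_left, tangentCoord_left] at hxre hxim
  rw [side_pt_right, tangentCoord_right] at hyre hyim
  rw [h] at hre him
  set T := tangentCoord x y z
  set s := Real.sin (Real.pi * (y - x))
  set c := Real.cos (Real.pi * (y - x))
  set u := Real.cos (Real.pi * (x + y))
  set v := Real.sin (Real.pi * (x + y))
  have hT : T ^ 2 ≤ s ^ 2 := by
    have h1 : z.re ^ 2 + z.im ^ 2 ≤ 1 := by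
      have h2 := Complex.sq_norm z
      rw [Complex.normSq_apply] at h2
      nlinarith [norm_nonneg z]
    have h2 : z.re ^ 2 + z.im ^ 2 = c ^ 2 + T ^ 2 := by
      rw [hre, him]
      have := Real.sin_sq_add_cos_sq (Real.pi * (x + y))
      linear_combination (c ^ 2 + T ^ 2) * this
    have h3 : s ^ 2 + c ^ 2 = 1 := Real.sin_sq_add_cos_sq _
    linarith
  have hT' := abs_le_of_sq_le_sq' hT hs.le
  refine ⟨(s - T) / (2 * s), (s + T) / (2 * s), ?_, ?_, ?_, ?_⟩
  · exact div_nonneg (by linarith) (by linarith)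
  · exact div_nonneg (by linarith) (by linarith)
  · field_simp; ring
  · apply Complex.ext
    · simp only [Complex.add_re, Complex.smul_re, smul_eq_mul]
      rw [hre, hxre, hyre]; field_simp; ring
    · simp only [Complex.add_im, Complex.smul_im, smul_eq_mul]
      rw [him, hxim, hyim]; field_simp; ring

/-- Chords cross in the plane if and only if their ends alternate on the circle. -/
theorem cross_iff_linked {c d : Chord} : Cross c d ↔ Linked c d := by
  constructor
  · rintro ⟨hne, P, hPc, hPd, hPc', hPd'⟩
    induction c using Sym2.ind with
    | _ X Y =>
    induction d using Sym2.ind with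
    | _ Z W =>
    rw [seg_mk] at hPc hPd
    rw [endSet_mk] at hPc' hPd'
    simp only [Set.mem_insert_iff, Set.mem_singleton_iff, not_or] at hPc' hPd'
    have hXY : X ≠ Y := by
      rintro rfl
      simp at hPc
      exact hPc'.1 hPc
    have hZW : Z ≠ W := by
      rintro rfl
      simp at hPd
      exact hPd'.1 hPd
    obtain ⟨x, -, -, rfl⟩ := exists_lift X 0
    obtain ⟨y, hxy, hyx, rfl⟩ := exists_lift_lt hXY
    have hP0 : side x y P = 0 := side_eq_zero_of_mem_seg (by rwa [seg_mk])
    obtain ⟨a, b, ha, hb, hab, rfl⟩ := hPd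
    have ha' : 0 < a := by
      refine lt_of_le_of_ne ha fun h => hPd'.2 ?_
      subst h
      obtain rfl : b = 1 := by linarith
      simp
    have hb' : 0 < b := by
      refine lt_of_le_of_ne hb fun h => hPd'.1 ?_
      subst h
      obtain rfl : a = 1 := by linarith
      simp
    rw [side_combo x y _ _ hab] at hP0
    rw [linked_iff hxy hyx]
    rcases lt_trichotomy (side x y (pt Z)) 0 with h | h | h
    · right
      refine ⟨opArc_of_side_pos hxy.le ?_, opArc_of_side_neg hyx.le h⟩
      nlinarith
    · have hW : side x y (pt W) = 0 := by
        rw [h] at hP0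
        simpa [hb'.ne'] using hP0
      exfalso
      apply hne
      rcases eq_or_eq_of_side_eq_zero hxy.le hyx.le h with h1 | h1 <;>
      rcases eq_or_eq_of_side_eq_zero hxy.le hyx.le hW with h2 | h2
      · exact absurd (h1.trans h2.symm) hZW
      · rw [h1, h2]
      · rw [h1, h2, Sym2.eq_swap]
      · exact absurd (h1.trans h2.symm) hZW
    · left
      refine ⟨opArc_of_side_pos hxy.le h, opArc_of_side_neg hyx.le ?_⟩
      nlinarith
  · rintro ⟨x, z, y, w, h1, h2, h3, h4, rfl, rfl⟩
    have hz : 0 < side x y (pt (z : Angle)) := side_pt_pos (by linarith) ⟨z, h1, h2, rfl⟩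
    have hw : side x y (pt (w : Angle)) < 0 := side_pt_neg (by linarith) ⟨w, h3, h4, rfl⟩
    set A := side x y (pt (z : Angle))
    set B := side x y (pt (w : Angle))
    have hAB : 0 < A - B := by linarith
    have hab : (-B) / (A - B) + A / (A - B) = 1 := by field_simp; ring
    set P : ℂ := ((-B) / (A - B)) • pt (z : Angle) + (A / (A - B)) • pt (w : Angle) with hP
    have hPd : P ∈ seg s((z : Angle), (w : Angle)) := by
      rw [seg_mk]
      exact ⟨_, _, div_nonneg (by linarith) hAB.le, div_nonneg hz.le hAB.le, hab, rfl⟩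
    have hP0 : side x y P = 0 := by
      rw [hP, side_combo x y _ _ hab]
      field_simp
      ring
    have hPc : P ∈ seg s((x : Angle), (y : Angle)) :=
      mem_seg_of_side_eq_zero (by linarith) (by linarith) hP0 (norm_le_one_of_mem_seg hPd)
    refine ⟨?_, P, hPc, hPd, ?_, ?_⟩
    · intro h
      have h5 : ((z : ℝ) : Angle) ∈ s((x : Angle), (y : Angle)) := by rw [h]; simp
      rcases Sym2.mem_iff.1 h5 with h6 | h6
      · have := eq_of_coe_eq h6 (by linarith) (by linarith); linarith
      · have := eq_of_coe_eq h6 (by linarith) (by linarith); linarith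
    · have hP1 : side z w P = 0 := side_eq_zero_of_mem_seg hPd
      rw [endSet_mk]
      rintro (h | h)
      · rw [h] at hP1
        exact (side_pt_neg (x := z) (y := w) (t := (x : Angle)) (by linarith)
          ⟨x + 1, by linarith, by linarith, coe_add_one x⟩).ne hP1
      · rw [Set.mem_singleton_iff] at h
        rw [h] at hP1
        exact (side_pt_pos (x := z) (y := w) (t := (y : Angle)) (by linarith)
          ⟨y, by linarith, by linarith, rfl⟩).ne' hP1
    · rw [endSet_mk]
      rintro (h | h)
      · rw [h] at hP0; exact hz.ne' hP0
      · rw [Set.mem_singleton_iff] at h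
        rw [h] at hP0; exact hw.ne hP0

theorem endSum_mk (X Y : Angle) : endSum s(X, Y) = pt X + pt Y := rfl

theorem length_mk (X Y : Angle) : length s(X, Y) = dist X Y := rfl

theorem endSum_re (x y : ℝ) : (pt (x : Angle) + pt (y : Angle)).re =
    2 * Real.cos (Real.pi * (y - x)) * Real.cos (Real.pi * (x + y)) := by
  rw [Complex.add_re, pt_re, pt_re, show 2 * Real.pi * x = Real.pi * (x + y) - Real.pi * (y - x)
    by ring, show 2 * Real.pi * y = Real.pi * (x + y) + Real.pi * (y - x) by ring, Real.cos_add,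
    Real.cos_sub]
  ring

theorem endSum_im (x y : ℝ) : (pt (x : Angle) + pt (y : Angle)).im =
    2 * Real.cos (Real.pi * (y - x)) * Real.sin (Real.pi * (x + y)) := by
  rw [Complex.add_im, pt_im, pt_im, show 2 * Real.pi * x = Real.pi * (x + y) - Real.pi * (y - x)
    by ring, show 2 * Real.pi * y = Real.pi * (x + y) + Real.pi * (y - x) by ring, Real.sin_add,
    Real.sin_sub]
  ring

theorem inner_endSum_sub (x y : ℝ) (z : ℂ) :
    2 * inner ℝ z (endSum s((x : Angle), (y : Angle))) -
      ‖endSum s((x : Angle), (y : Angle))‖ ^ 2 =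
      4 * Real.cos (Real.pi * (y - x)) * side x y z := by
  rw [endSum_mk, Complex.inner, Complex.sq_norm, Complex.normSq_apply, Complex.mul_re,
    Complex.conj_re, Complex.conj_im, endSum_re, endSum_im, side]
  linear_combination (-4 * Real.cos (Real.pi * (y - x)) ^ 2) *
    Real.sin_sq_add_cos_sq (Real.pi * (x + y))

theorem cos_pi_mul_pos {t : ℝ} (h0 : 0 ≤ t) (h1 : t < 1 / 2) : 0 < Real.cos (Real.pi * t) :=
  Real.cos_pos_of_mem_Ioo ⟨by nlinarith [Real.pi_pos], by nlinarith [Real.pi_pos]⟩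

theorem mem_smallPart {x y : ℝ} (hxy : x < y) (hyx : y < x + 1 / 2) {z : ℂ} :
    z ∈ smallPart s((x : Angle), (y : Angle)) ↔ ‖z‖ ≤ 1 ∧ 0 < side x y z := by
  have h1 := inner_endSum_sub x y z
  have h2 := cos_pi_mul_pos (t := y - x) (by linarith) (by linarith)
  refine and_congr_right fun _ => ?_
  rw [← sub_pos, h1, mul_pos_iff_of_pos_left (by positivity)]

theorem mem_bigPart {x y : ℝ} (hxy : x < y) (hyx : y < x + 1 / 2) {z : ℂ} :
    z ∈ bigPart s((x : Angle), (y : Angle)) ↔ ‖z‖ ≤ 1 ∧ side x y z < 0 := by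
  have h1 := inner_endSum_sub x y z
  have h2 := cos_pi_mul_pos (t := y - x) (by linarith) (by linarith)
  refine and_congr_right fun _ => ?_
  rw [← sub_neg, h1]
  constructor
  · intro h; by_contra! h3; nlinarith
  · intro h; nlinarith

/-- A chord lies behind the chord of a short arc if and only if both ends lie in the closed arc
and one of them in the open arc. -/
theorem behind_iff {x y : ℝ} (hxy : x < y) (hyx : y < x + 1 / 2) {d : Chord} :
    Behind d s((x : Angle), (y : Angle)) ↔ (∀ t ∈ d, ClArc x y t) ∧ ∃ t ∈ d, OpArc x y t := by
  constructor
  · rintro ⟨⟨z, hz, hz'⟩, h⟩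
    have hcl : ∀ t ∈ d, ClArc x y t := by
      intro t ht
      rcases clArc_or_opArc x y t with h1 | h1
      · exact h1
      · refine absurd ((mem_bigPart hxy hyx).2 ⟨(norm_pt t).le, side_pt_neg hxy.le h1⟩) ?_
        exact h _ (pt_mem_seg ht)
    refine ⟨hcl, ?_⟩
    by_contra! hno
    have hle : d.seg ⊆ {z | side x y z ≤ 0} := by
      refine seg_subset (convex_side_nonpos x y) fun t ht => ?_
      by_contra! h1
      exact hno t ht (opArc_of_side_pos hxy.le (by simpa using h1))
    have := hle hz
    have h2 := ((mem_smallPart hxy hyx).1 hz').2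
    simp only [Set.mem_ofPred_eq] at this
    linarith
  · rintro ⟨h1, t, ht, h2⟩
    refine ⟨⟨pt t, pt_mem_seg ht, (mem_smallPart hxy hyx).2
      ⟨(norm_pt t).le, side_pt_pos (by linarith) h2⟩⟩, fun z hz hz' => ?_⟩
    have hge : d.seg ⊆ {z | 0 ≤ side x y z} :=
      seg_subset (convex_side_nonneg x y) fun t ht => side_pt_nonneg (by linarith) (h1 t ht)
    have := hge hz
    have h2 := ((mem_bigPart hxy hyx).1 hz').2
    simp only [Set.mem_ofPred_eq] at this
    linarith

/-- The distance of two angles is the distance of suitable lifts. -/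
theorem dist_coe_le_iff {x y c : ℝ} :
    dist (x : Angle) (y : Angle) ≤ c ↔ ∃ n : ℤ, |x - y - n| ≤ c := by
  rw [dist_eq_norm, ← AddCircle.coe_sub, UnitAddCircle.norm_eq]
  constructor
  · intro h; exact ⟨_, h⟩
  · rintro ⟨n, hn⟩
    exact (round_le _ n).trans hn

/-! ### Real coordinates of a parameter leaf -/

/-- The closed arc that remains, on one of the two sides, when the preimages of the arc from `α` to
`γ` under doubling are removed from the circle. It depends on the parity of `i` only, and the two
arcs are interchanged by the half turn. -/
def Quarter (α γ : ℝ) (i : ℤ) (t : Angle) : Prop := ClArc ((γ - 1 + i) / 2) ((α + i) / 2) t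

theorem quarter_coe_iff {α γ t : ℝ} {i : ℤ} : Quarter α γ i (t : Angle) ↔
    ∃ n : ℤ, γ - 1 + i + 2 * n ≤ 2 * t ∧ 2 * t ≤ α + i + 2 * n := by
  unfold Quarter
  rw [clArc_coe_iff]
  refine exists_congr fun n => ?_
  constructor <;> rintro ⟨h1, h2⟩ <;> constructor <;> linarith

/-- The properties of the lifts `α < γ` of the ends of a parameter leaf of period `m` that are used
in the sequel. -/
structure LeafData (m : ℕ) (α γ : ℝ) : Prop where
  one_lt : 1 < m
  pos : 0 < α
  lt : α < γ
  short : γ < α + 1 / 2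
  lt_one : γ < 1
  per_left : ∃ N : ℤ, 2 ^ m * α = α + N
  per_right : ∃ N : ℤ, 2 ^ m * γ = γ + N
  exact_left : ∀ s : ℕ, 0 < s → s < m → ∀ N : ℤ, 2 ^ s * α ≠ α + N
  exact_right : ∀ s : ℕ, 0 < s → s < m → ∀ N : ℤ, 2 ^ s * γ ≠ γ + N
  same : ∀ l : ℕ, ∃ i : ℤ, Quarter α γ i ((2 ^ l * α : ℝ) : Angle) ∧
    Quarter α γ i ((2 ^ l * γ : ℝ) : Angle)

/-- The ends of a chord that is not linked with a diameter lie in one of the two closed half circles. -/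
theorem not_linked_diameter {c : ℝ} {X Y : Angle}
    (h : ¬ Linked s(X, Y) s((c : Angle), ((c + 1 / 2 : ℝ) : Angle))) :
    ∃ u : ℤ, ClArc (c + u / 2) (c + (u + 1) / 2) X ∧ ClArc (c + u / 2) (c + (u + 1) / 2) Y := by
  have key : ∀ {X Y : Angle}, ¬ Linked s(X, Y) s((c : Angle), ((c + 1 / 2 : ℝ) : Angle)) →
      ClArc c (c + 1 / 2) X → OpArc (c + 1 / 2) (c + 1) Y → ClArc (c + 1 / 2) (c + 1) X := by
    intro X Y h hX hY
    by_cases h1 : X = c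
    · exact ⟨c + 1, by linarith, le_rfl, by rw [h1, coe_add_one]⟩
    by_cases h2 : X = ((c + 1 / 2 : ℝ) : Angle)
    · exact ⟨c + 1 / 2, le_rfl, by linarith, h2.symm⟩
    exact absurd (linked_of_opArc (by linarith) (by linarith) (hX.opArc h1 h2) hY).symm h
  have h0 : c + ((0 : ℤ) : ℝ) / 2 = c := by simp
  have h0' : c + (((0 : ℤ) : ℝ) + 1) / 2 = c + 1 / 2 := by simp
  have h1 : c + ((1 : ℤ) : ℝ) / 2 = c + 1 / 2 := by simp
  have h1' : c + (((1 : ℤ) : ℝ) + 1) / 2 = c + 1 := by push_cast; ring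
  rcases clArc_or_opArc c (c + 1 / 2) X with hX | hX <;>
  rcases clArc_or_opArc c (c + 1 / 2) Y with hY | hY
  · exact ⟨0, by rw [h0, h0']; exact ⟨hX, hY⟩⟩
  · exact ⟨1, by rw [h1, h1']; exact ⟨key h hX hY, hY.clArc⟩⟩
  · exact ⟨1, by rw [h1, h1']; exact ⟨hX.clArc, key (by rwa [Sym2.eq_swap]) hY hX⟩⟩
  · exact ⟨1, by rw [h1, h1']; exact ⟨hX.clArc, hY.clArc⟩⟩

/-- A chord `XY` whose length is at least that of the arc from `α` to `γ`, and which is linked with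
neither of the diameters at `α / 2` and `γ / 2`, has its ends in one quarter. -/
theorem exists_quarter {α γ X Y : ℝ} (hlt : α < γ) (hshort : γ < α + 1 / 2)
    (hα : ¬ Linked s((X : Angle), (Y : Angle)) s(((α / 2 : ℝ) : Angle), ((α / 2 + 1 / 2 : ℝ) : Angle)))
    (hγ : ¬ Linked s((X : Angle), (Y : Angle)) s(((γ / 2 : ℝ) : Angle), ((γ / 2 + 1 / 2 : ℝ) : Angle)))
    (hlen : ∀ N : ℤ, γ - α ≤ |Y - X - N|) :
    ∃ i : ℤ, Quarter α γ i (X : Angle) ∧ Quarter α γ i (Y : Angle) := by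
  obtain ⟨u, hu, hu'⟩ := not_linked_diameter hα
  obtain ⟨v, hv, hv'⟩ := not_linked_diameter hγ
  rw [clArc_coe_iff] at hu hu' hv hv'
  obtain ⟨n1, a1, a2⟩ := hu
  obtain ⟨n2, b1, b2⟩ := hu'
  obtain ⟨n3, c1, c2⟩ := hv
  obtain ⟨n4, d1, d2⟩ := hv'
  -- the half circles containing `X` and `Y`, indexed by integers
  have e1 : u + 2 * n1 ≤ v + 2 * n3 + 1 := by
    have : ((u + 2 * n1 : ℤ) : ℝ) < ((v + 2 * n3 + 2 : ℤ) : ℝ) := by push_cast; linarith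
    have := Int.cast_lt.1 this
    omega
  have e2 : v + 2 * n3 ≤ u + 2 * n1 := by
    have : ((v + 2 * n3 : ℤ) : ℝ) < ((u + 2 * n1 + 1 : ℤ) : ℝ) := by push_cast; linarith
    have := Int.cast_lt.1 this
    omega
  have e3 : u + 2 * n2 ≤ v + 2 * n4 + 1 := by
    have : ((u + 2 * n2 : ℤ) : ℝ) < ((v + 2 * n4 + 2 : ℤ) : ℝ) := by push_cast; linarith
    have := Int.cast_lt.1 this
    omega
  have e4 : v + 2 * n4 ≤ u + 2 * n2 := by
    have : ((v + 2 * n4 : ℤ) : ℝ) < ((u + 2 * n2 + 1 : ℤ) : ℝ) := by push_cast; linarith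
    have := Int.cast_lt.1 this
    omega
  by_cases hcase : v + 2 * n3 = u + 2 * n1
  · have h4 : v + 2 * n4 = u + 2 * n2 := by omega
    have h3' : (v : ℝ) + 2 * n3 = u + 2 * n1 := by exact_mod_cast hcase
    have h4' : (v : ℝ) + 2 * n4 = u + 2 * n2 := by exact_mod_cast h4
    refine ⟨u + 1, quarter_coe_iff.2 ⟨n1, ?_, ?_⟩, quarter_coe_iff.2 ⟨n2, ?_, ?_⟩⟩ <;>
      push_cast <;> linarith
  · exfalso
    have h3 : v + 2 * n3 = u + 2 * n1 - 1 := by omega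
    have h4 : v + 2 * n4 = u + 2 * n2 - 1 := by omega
    have h3' : (v : ℝ) + 2 * n3 = u + 2 * n1 - 1 := by exact_mod_cast h3
    have h4' : (v : ℝ) + 2 * n4 = u + 2 * n2 - 1 := by exact_mod_cast h4
    have := hlen (n2 - n1)
    rw [le_abs] at this
    push_cast at this
    rcases this with h | h <;> linarith

/-- Doubling does not bring two angles closer together than `a` if their distance is at least `a` and
at most `(1 - a) / 2`. -/
theorem double_length {a δ : ℝ} {N : ℤ} (h1 : a ≤ |δ - N|) (h2 : |δ - N| ≤ (1 - a) / 2) (K : ℤ) :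
    a ≤ |2 * δ - K| := by
  have ha : a ≤ 1 / 2 := by linarith
  have h0 : 0 ≤ |δ - N| := abs_nonneg _
  by_cases ha0 : a ≤ 0
  · exact ha0.trans (abs_nonneg _)
  push Not at ha0
  have hKN : K - 2 * N = 0 ∨ 1 ≤ K - 2 * N ∨ K - 2 * N ≤ -1 := by omega
  have e : 2 * δ - K = 2 * (δ - N) - ((K - 2 * N : ℤ) : ℝ) := by push_cast; ring
  rw [e]
  set η := δ - N
  rw [abs_le] at h2
  rcases hKN with h | h | h
  · rw [h]; simp only [Int.cast_zero, sub_zero]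
    rw [abs_mul]; norm_num; linarith
  · have : (1 : ℝ) ≤ ((K - 2 * N : ℤ) : ℝ) := by exact_mod_cast h
    rw [le_abs]; right; linarith [h2.2]
  · have : ((K - 2 * N : ℤ) : ℝ) ≤ -1 := by exact_mod_cast h
    rw [le_abs]; left; linarith [h2.1]

/-- No iterate of a chord that is never linked with the diameters at the preimages of its ends is
shorter than the chord itself, and hence each iterate has its ends in one quarter. -/
theorem same_quarter_of_not_linked {α γ : ℝ} (hlt : α < γ) (hshort : γ < α + 1 / 2)
    (hα : ∀ l : ℕ, ¬ Linked s(((2 ^ l * α : ℝ) : Angle), ((2 ^ l * γ : ℝ) : Angle))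
      s(((α / 2 : ℝ) : Angle), ((α / 2 + 1 / 2 : ℝ) : Angle)))
    (hγ : ∀ l : ℕ, ¬ Linked s(((2 ^ l * α : ℝ) : Angle), ((2 ^ l * γ : ℝ) : Angle))
      s(((γ / 2 : ℝ) : Angle), ((γ / 2 + 1 / 2 : ℝ) : Angle))) (l : ℕ) :
    ∃ i : ℤ, Quarter α γ i ((2 ^ l * α : ℝ) : Angle) ∧
    Quarter α γ i ((2 ^ l * γ : ℝ) : Angle) := by
  have hlen : ∀ l : ℕ, ∀ N : ℤ, γ - α ≤ |2 ^ l * γ - 2 ^ l * α - N| := by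
    intro l
    induction l with
    | zero =>
      intro N
      simp only [pow_zero, one_mul]
      rcases le_or_gt N 0 with h | h
      · have : (N : ℝ) ≤ 0 := by exact_mod_cast h
        rw [le_abs]; left; linarith
      · have : (1 : ℝ) ≤ N := by exact_mod_cast h
        rw [le_abs]; right; linarith
    | succ l ih =>
      intro K
      obtain ⟨i, h1, h2⟩ := exists_quarter hlt hshort (hα l) (hγ l) ih
      rw [quarter_coe_iff] at h1 h2
      obtain ⟨n1, a1, a2⟩ := h1
      obtain ⟨n2, b1, b2⟩ := h2
      have := double_length (δ := 2 ^ l * γ - 2 ^ l * α) (N := n2 - n1) (ih _)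
        (by rw [abs_le]; push_cast; constructor <;> linarith) K
      rw [pow_succ]
      convert this using 2
      ring
  exact exists_quarter hlt hshort (hα l) (hγ l) (hlen l)

theorem quarter_add_int {α γ : ℝ} {i n : ℤ} {t : Angle} :
    Quarter (α + n) (γ + n) (i - n) t ↔ Quarter α γ i t := by
  unfold Quarter
  rw [show (γ + n - 1 + ((i - n : ℤ) : ℝ)) / 2 = (γ - 1 + i) / 2 by push_cast; ring,
    show (α + n + ((i - n : ℤ) : ℝ)) / 2 = (α + i) / 2 by push_cast; ring]

theorem exists_half_of_double {x u : ℝ} {N : ℤ} (h : 2 * u = x + N) :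
    ∃ η : ℤ, (η = 0 ∨ η = 1) ∧ ∃ K : ℤ, u = (x + η) / 2 + K := by
  refine ⟨N % 2, Int.emod_two_eq_zero_or_one N, N / 2, ?_⟩
  have h1 : N % 2 + 2 * (N / 2) = N := Int.emod_add_mul_ediv N 2
  have h2 : (((N % 2 : ℤ) : ℝ)) + 2 * ((N / 2 : ℤ) : ℝ) = N := by exact_mod_cast h1
  linarith

/-- The index of the quarter containing the half of `α`. -/
theorem quarter_half_left {α γ : ℝ} (hlt : α < γ) {i η K : ℤ}
    (h : Quarter α γ i (((α + η) / 2 + K : ℝ) : Angle)) : ∃ r : ℤ, η = i + 2 * r := by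
  rw [quarter_coe_iff] at h
  obtain ⟨n, h1, h2⟩ := h
  refine ⟨n - K, ?_⟩
  have h3 : ((η + 2 * K : ℤ) : ℝ) ≤ ((i + 2 * n : ℤ) : ℝ) := by push_cast; linarith
  have h4 : ((i + 2 * n : ℤ) : ℝ) < ((η + 2 * K + 1 : ℤ) : ℝ) := by push_cast; linarith
  have h3 := Int.cast_le.1 h3
  have h4 := Int.cast_lt.1 h4
  omega

/-- The index of the quarter containing the half of `γ`. -/
theorem quarter_half_right {α γ : ℝ} (hlt : α < γ) {i η K : ℤ}
    (h : Quarter α γ i (((γ + η) / 2 + K : ℝ) : Angle)) : ∃ r : ℤ, η = i + 1 + 2 * r := by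
  rw [quarter_coe_iff] at h
  obtain ⟨n, h1, h2⟩ := h
  refine ⟨n - K - 1, ?_⟩
  have h3 : ((i + 2 * n - 1 : ℤ) : ℝ) ≤ ((η + 2 * K : ℤ) : ℝ) := by push_cast; linarith
  have h4 : ((η + 2 * K : ℤ) : ℝ) < ((i + 2 * n : ℤ) : ℝ) := by push_cast; linarith
  have h3 := Int.cast_le.1 h3
  have h4 := Int.cast_lt.1 h4
  omega

theorem minimalPeriod_data {m : ℕ} {x : ℝ}
    (h : Function.minimalPeriod dbl (x : Angle) = m) :
    (∃ N : ℤ, 2 ^ m * x = x + N) ∧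
      ∀ s : ℕ, 0 < s → s < m → ∀ N : ℤ, 2 ^ s * x ≠ x + N := by
  have h1 := Function.isPeriodicPt_minimalPeriod dbl (x : Angle)
  rw [h] at h1
  constructor
  · have h2 : dbl^[m] (x : Angle) = x := h1
    rw [dbl_iterate_coe] at h2
    exact coe_eq_coe_iff.1 h2
  · intro s hs hsm N hN
    have h2 : Function.IsPeriodicPt dbl s (x : Angle) := by
      show dbl^[s] (x : Angle) = x
      rw [dbl_iterate_coe, hN, coe_add_int]
    have := h2.minimalPeriod_le hs
    omega

/-- The last digits of the periods of the two ends are different. -/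
theorem exists_dot {m : ℕ} {α γ : ℝ} (hm : 0 < m) (hlt : α < γ)
    (hα : ∃ N : ℤ, 2 ^ m * α = α + N) (hγ : ∃ N : ℤ, 2 ^ m * γ = γ + N)
    (hs : ∃ i : ℤ, Quarter α γ i ((2 ^ (m - 1) * α : ℝ) : Angle) ∧
      Quarter α γ i ((2 ^ (m - 1) * γ : ℝ) : Angle)) :
    ∃ ε : ℤ, (ε = 0 ∨ ε = 1) ∧ (∃ K : ℤ, 2 ^ (m - 1) * α = (α + ε) / 2 + K) ∧
      ∃ K : ℤ, 2 ^ (m - 1) * γ = (γ + (1 - ε)) / 2 + K := by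
  obtain ⟨N, hN⟩ := hα
  obtain ⟨N', hN'⟩ := hγ
  have e : (2 : ℝ) ^ m = 2 * 2 ^ (m - 1) := by
    rw [← pow_succ', Nat.sub_add_cancel hm]
  obtain ⟨η, hη, K, hK⟩ := exists_half_of_double (x := α) (u := 2 ^ (m - 1) * α) (N := N)
    (by rw [← hN, e]; ring)
  obtain ⟨η', hη', K', hK'⟩ := exists_half_of_double (x := γ) (u := 2 ^ (m - 1) * γ) (N := N')
    (by rw [← hN', e]; ring)
  obtain ⟨i, h1, h2⟩ := hs
  rw [hK] at h1
  rw [hK'] at h2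
  obtain ⟨r, hr⟩ := quarter_half_left hlt h1
  obtain ⟨r', hr'⟩ := quarter_half_right hlt h2
  refine ⟨η, hη, ⟨K, hK⟩, K', ?_⟩
  have : η' = 1 - η := by omega
  rw [hK', this]
  push_cast
  ring

theorem halfTurn_add_coe (x : ℝ) : (x : Angle) + halfTurn = ((x + 1 / 2 : ℝ) : Angle) := by
  rw [halfTurn, ← AddCircle.coe_add]

/-- A parameter leaf has lifts `0 < α < γ < 1` of its ends with the properties collected in
`LeafData`. That the arc between them does not contain the angle `0` holds since otherwise the
preimage of the leaf with periodic ends would cross the leaf. -/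
theorem IsParamLeaf.exists_leafData {m : ℕ} {S : Chord} (hS : IsParamLeaf m S) :
    ∃ α γ : ℝ, S = s((α : Angle), (γ : Angle)) ∧ LeafData m α γ := by
  obtain ⟨hm, hd, hper, hnc, hdiam⟩ := hS
  have hm0 : 0 < m := by omega
  obtain ⟨x, y, hx0, hx1, hxy, hyx, rfl⟩ := exists_coe_mk_lt hd
  obtain ⟨⟨Nx, hNx⟩, hex⟩ := minimalPeriod_data (hper x (by simp))
  obtain ⟨⟨Ny, hNy⟩, hey⟩ := minimalPeriod_data (hper y (by simp))
  -- the ends are not opposite, since doubling is injective on the periodic angles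
  have hhalf : y ≠ x + 1 / 2 := by
    rintro rfl
    have e : (2 : ℝ) ^ m = 2 * 2 ^ (m - 1) := by rw [← pow_succ', Nat.sub_add_cancel hm0]
    have h1 : (2 : ℝ) ^ (m - 1) = 1 / 2 + (Ny - Nx) := by
      rw [e] at hNx hNy; linarith
    have h2 : ((2 ^ m : ℤ) : ℝ) = ((1 + 2 * (Ny - Nx) : ℤ) : ℝ) := by
      push_cast; rw [e]; linarith
    have h3 := Int.cast_injective h2
    have h4 : (2 : ℤ) ^ m = 2 * 2 ^ (m - 1) := by rw [← pow_succ', Nat.sub_add_cancel hm0]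
    omega
  -- lifts with the short arc between them
  obtain ⟨α, γ, hS, hlt, hshort⟩ : ∃ α γ : ℝ, s((x : Angle), (y : Angle)) =
      s((α : Angle), (γ : Angle)) ∧ α < γ ∧ γ < α + 1 / 2 := by
    rcases lt_or_gt_of_ne hhalf with h | h
    · exact ⟨x, y, rfl, hxy, h⟩
    · refine ⟨y - 1, x, ?_, by linarith, by linarith⟩
      rw [coe_sub_one, Sym2.eq_swap]
  rw [hS] at hper hnc hdiam
  clear hNx hNy hex hey hhalf hxy hyx hx0 hx1 hd
  obtain ⟨pα, eα⟩ := minimalPeriod_data (hper α (by simp))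
  obtain ⟨pγ, eγ⟩ := minimalPeriod_data (hper γ (by simp))
  have hsame : ∀ l : ℕ, ∃ i : ℤ, Quarter α γ i ((2 ^ l * α : ℝ) : Angle) ∧
      Quarter α γ i ((2 ^ l * γ : ℝ) : Angle) := by
    refine same_quarter_of_not_linked hlt hshort ?_ ?_
    · intro l hl
      refine hdiam l ((α / 2 : ℝ) : Angle) ?_ ?_
      · rw [dbl_coe, show 2 * (α / 2) = α by ring]; simp
      · rw [cross_iff_linked, iter_mk, halfTurn_add_coe]; exact hl
    · intro l hl
      refine hdiam l ((γ / 2 : ℝ) : Angle) ?_ ?_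
      · rw [dbl_coe, show 2 * (γ / 2) = γ by ring]; simp
      · rw [cross_iff_linked, iter_mk, halfTurn_add_coe]; exact hl
  -- no integer lies in the arc
  have hint : ∀ N : ℤ, ¬ (α < N ∧ N < γ) := by
    rintro N ⟨h1, h2⟩
    obtain ⟨ε, hε, ⟨K, hK⟩, ⟨K', hK'⟩⟩ := exists_dot hm0 hlt pα pγ (hsame (m - 1))
    refine hnc 0 (m - 1) (cross_iff_linked.2 ?_)
    rw [iter_mk, iter_mk, hK, hK', coe_add_int, coe_add_int]
    simp only [pow_zero, one_mul]
    rw [linked_iff hlt (by linarith)]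
    have hN : ∃ r : ℤ, ∃ ν : ℤ, (ν = 0 ∨ ν = 1) ∧ N = ν + 2 * r :=
      ⟨N / 2, N % 2, Int.emod_two_eq_zero_or_one N, (Int.emod_add_mul_ediv N 2).symm⟩
    obtain ⟨r, ν, hν, rfl⟩ := hN
    simp only [opArc_coe_iff]
    push_cast at h1 h2
    rcases hε with rfl | rfl <;> rcases hν with rfl | rfl
    · left; constructor
      · refine ⟨-r, ?_, ?_⟩ <;> push_cast at * <;> linarith
      · refine ⟨-r, ?_, ?_⟩ <;> push_cast at * <;> linarith
    · right; constructor
      · refine ⟨-r, ?_, ?_⟩ <;> push_cast at * <;> linarith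
      · refine ⟨-r - 1, ?_, ?_⟩ <;> push_cast at * <;> linarith
    · right; constructor
      · refine ⟨-r, ?_, ?_⟩ <;> push_cast at * <;> linarith
      · refine ⟨-r, ?_, ?_⟩ <;> push_cast at * <;> linarith
    · left; constructor
      · refine ⟨-r, ?_, ?_⟩ <;> push_cast at * <;> linarith
      · refine ⟨-r - 1, ?_, ?_⟩ <;> push_cast at * <;> linarith
  have hnotint : ∀ {u : ℝ}, (∀ s : ℕ, 0 < s → s < m → ∀ N : ℤ, 2 ^ s * u ≠ u + N) →
      ∀ N : ℤ, u ≠ N := by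
    rintro u hu N rfl
    exact hu 1 one_pos hm N (by ring)
  refine ⟨α - ⌊α⌋, γ - ⌊α⌋, ?_, ?_⟩
  · rw [coe_sub_int, coe_sub_int]
    exact hS
  have hfl := Int.floor_le α
  have hfl' := Int.lt_floor_add_one α
  refine ⟨hm, ?_, by linarith, by linarith, ?_, ?_, ?_, ?_, ?_, ?_⟩
  · have := hnotint eα ⌊α⌋
    have := lt_of_le_of_ne hfl this.symm
    linarith
  · by_contra! h
    rcases h.eq_or_lt with h | h
    · exact hnotint eγ (⌊α⌋ + 1) (by push_cast; linarith)
    · exact hint (⌊α⌋ + 1) (by push_cast; constructor <;> linarith)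
  · obtain ⟨N, hN⟩ := pα
    exact ⟨N - (2 ^ m - 1) * ⌊α⌋, by push_cast; linear_combination hN⟩
  · obtain ⟨N, hN⟩ := pγ
    exact ⟨N - (2 ^ m - 1) * ⌊α⌋, by push_cast; linear_combination hN⟩
  · intro s h0 h1 N hN
    exact eα s h0 h1 (N + (2 ^ s - 1) * ⌊α⌋) (by push_cast; linear_combination hN)
  · intro s h0 h1 N hN
    exact eγ s h0 h1 (N + (2 ^ s - 1) * ⌊α⌋) (by push_cast; linear_combination hN)
  · intro l
    obtain ⟨i, h1, h2⟩ := hsame l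
    have e : ∀ u : ℝ, ((2 ^ l * (u - ⌊α⌋) : ℝ) : Angle) = ((2 ^ l * u : ℝ) : Angle) := fun u =>
      coe_eq_coe_iff.2 ⟨-(2 ^ l * ⌊α⌋), by push_cast; ring⟩
    have h1 := (quarter_add_int (n := -⌊α⌋)).2 h1
    have h2 := (quarter_add_int (n := -⌊α⌋)).2 h2
    rw [Int.cast_neg, ← sub_eq_add_neg, ← sub_eq_add_neg, ← e] at h1 h2
    exact ⟨_, h1, h2⟩

/-! ### The Cantor set of the critical value gap -/

/-- The two inverse branches of the return map of the critical value gap, in the coordinate in which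
the arc behind the leaf is the unit interval. Their inverses expand by the factor `M`, which is
`2 ^ m` for a leaf of period `m`. -/
def branch (M : ℝ) (b : Bool) (y : ℝ) : ℝ := if b then 1 - (1 - y) / M else y / M

/-- The composition of inverse branches given by a word. -/
def word (M : ℝ) (w : List Bool) (y : ℝ) : ℝ := w.foldr (branch M) y

/-- The invariant Cantor set of the two branches: the unit interval without the images of the middle
gap under all words. -/
def cantor (M : ℝ) : Set ℝ :=
  {y | 0 ≤ y ∧ y ≤ 1 ∧ ∀ w, ¬ (word M w (1 / M) < y ∧ y < word M w (1 - 1 / M))}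

@[simp] theorem branch_false (M y : ℝ) : branch M false y = y / M := rfl

@[simp] theorem branch_true (M y : ℝ) : branch M true y = 1 - (1 - y) / M := rfl

@[simp] theorem word_nil (M y : ℝ) : word M [] y = y := rfl

@[simp] theorem word_cons (M : ℝ) (b : Bool) (w : List Bool) (y : ℝ) :
    word M (b :: w) y = branch M b (word M w y) := rfl

theorem word_append (M : ℝ) (w v : List Bool) (y : ℝ) :
    word M (w ++ v) y = word M w (word M v y) := by
  simp [word, List.foldr_append]

section cantor

variable {M : ℝ}

theorem branch_lt_branch (hM : 0 < M) (b : Bool) {x y : ℝ} : branch M b x < branch M b y ↔ x < y := by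
  cases b
  · exact div_lt_div_iff_of_pos_right hM
  · simp only [branch_true, sub_lt_sub_iff_left]
    rw [div_lt_div_iff_of_pos_right hM]
    constructor <;> intro h <;> linarith

theorem branch_zero_one (hM : 2 < M) : branch M false 1 = 1 / M ∧ branch M true 0 = 1 - 1 / M ∧
    branch M false 0 = 0 ∧ branch M true 1 = 1 ∧ 0 < 1 / M ∧ 1 / M < 1 - 1 / M ∧ 1 - 1 / M < 1 := by
  have h1 : 0 < 1 / M := by positivity
  have h2 : 1 / M < 1 / 2 := one_div_lt_one_div_of_lt (by norm_num) hM
  refine ⟨rfl, by simp, by simp, by simp, h1, by linarith, by linarith⟩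

theorem branch_le_branch (hM : 0 < M) (b : Bool) {x y : ℝ} :
    branch M b x ≤ branch M b y ↔ x ≤ y := by
  rw [← not_lt, ← not_lt, branch_lt_branch hM]

theorem branch_mem (hM : 2 < M) (b : Bool) {y : ℝ} (h0 : 0 ≤ y) (h1 : y ≤ 1) :
    0 ≤ branch M b y ∧ branch M b y ≤ 1 := by
  obtain ⟨e1, e2, e3, e4, h2, h3, h4⟩ := branch_zero_one hM
  have a := (branch_le_branch (M := M) (by linarith) b).2 h0
  have b' := (branch_le_branch (M := M) (by linarith) b).2 h1
  cases b
  · rw [e3] at a; rw [e1] at b'; exact ⟨a, by linarith⟩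
  · rw [e2] at a; rw [e4] at b'; exact ⟨by linarith, b'⟩

theorem branch_mem_Ioo (hM : 2 < M) (b : Bool) {y : ℝ} (h0 : 0 < y) (h1 : y < 1) :
    0 < branch M b y ∧ branch M b y < 1 := by
  obtain ⟨e1, e2, e3, e4, h2, h3, h4⟩ := branch_zero_one hM
  have a := (branch_lt_branch (M := M) (by linarith) b).2 h0
  have b' := (branch_lt_branch (M := M) (by linarith) b).2 h1
  cases b
  · rw [e3] at a; rw [e1] at b'; exact ⟨a, by linarith⟩
  · rw [e2] at a; rw [e4] at b'; exact ⟨by linarith, b'⟩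

theorem word_lt_word (hM : 0 < M) (w : List Bool) {x y : ℝ} : word M w x < word M w y ↔ x < y := by
  induction w with
  | nil => rfl
  | cons b w ih => rw [word_cons, word_cons, branch_lt_branch hM, ih]

theorem word_mem (hM : 2 < M) (w : List Bool) {y : ℝ} (h0 : 0 ≤ y) (h1 : y ≤ 1) :
    0 ≤ word M w y ∧ word M w y ≤ 1 := by
  induction w with
  | nil => exact ⟨h0, h1⟩
  | cons b w ih => exact branch_mem hM b ih.1 ih.2

theorem word_mem_Ioo (hM : 2 < M) (w : List Bool) {y : ℝ} (h0 : 0 < y) (h1 : y < 1) :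
    0 < word M w y ∧ word M w y < 1 := by
  induction w with
  | nil => exact ⟨h0, h1⟩
  | cons b w ih => exact branch_mem_Ioo hM b ih.1 ih.2

theorem gap_subset (hM : 2 < M) (w : List Bool) :
    0 < word M w (1 / M) ∧ word M w (1 / M) < word M w (1 - 1 / M) ∧ word M w (1 - 1 / M) < 1 := by
  obtain ⟨-, -, -, -, h2, h3, h4⟩ := branch_zero_one hM
  exact ⟨(word_mem_Ioo hM w h2 (by linarith)).1, (word_lt_word (by linarith) w).2 h3,
    (word_mem_Ioo hM w (by linarith) h4).2⟩

theorem zero_mem_cantor (hM : 2 < M) : (0 : ℝ) ∈ cantor M :=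
  ⟨le_rfl, zero_le_one, fun w h => by linarith [(gap_subset hM w).1]⟩

theorem one_mem_cantor (hM : 2 < M) : (1 : ℝ) ∈ cantor M :=
  ⟨zero_le_one, le_rfl, fun w h => by linarith [(gap_subset hM w).2.2]⟩

theorem branch_false_lt_branch_true (hM : 2 < M) {x y : ℝ} (hx : x ≤ 1) (hy : 0 ≤ y) :
    branch M false x < branch M true y := by
  obtain ⟨e1, e2, e3, e4, h2, h3, h4⟩ := branch_zero_one hM
  have h5 := (branch_le_branch (M := M) (by linarith) false).2 hx
  have h6 := (branch_le_branch (M := M) (by linarith) true).2 hy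
  linarith

theorem branch_mem_cantor (hM : 2 < M) (b : Bool) {y : ℝ} (hy : y ∈ cantor M) :
    branch M b y ∈ cantor M := by
  obtain ⟨e1, e2, e3, e4, h2, h3, h4⟩ := branch_zero_one hM
  refine ⟨(branch_mem hM b hy.1 hy.2.1).1, (branch_mem hM b hy.1 hy.2.1).2, ?_⟩
  rintro (_ | ⟨c, w⟩) ⟨h5, h6⟩
  · rw [word_nil] at h5 h6
    cases b
    · have := (branch_le_branch (M := M) (by linarith) false).2 hy.2.1
      linarith
    · have := (branch_le_branch (M := M) (by linarith) true).2 hy.1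
      linarith
  · rw [word_cons] at h5 h6
    have hg := gap_subset hM w
    cases b <;> cases c
    · rw [branch_lt_branch (by linarith)] at h5 h6
      exact hy.2.2 w ⟨h5, h6⟩
    · exact absurd h5 (branch_false_lt_branch_true hM hy.2.1 hg.1.le).not_gt
    · exact absurd h6 (branch_false_lt_branch_true hM hg.2.2.le hy.1).not_gt
    · rw [branch_lt_branch (by linarith)] at h5 h6
      exact hy.2.2 w ⟨h5, h6⟩

theorem exists_branch_of_mem_Icc (hM : 2 < M) {y : ℝ} (h0 : 0 ≤ y) (h1 : y ≤ 1)
    (h : ¬ (1 / M < y ∧ y < 1 - 1 / M)) : ∃ b y', 0 ≤ y' ∧ y' ≤ 1 ∧ y = branch M b y' := by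
  have hM0 : 0 < M := by linarith
  by_cases hy : y ≤ 1 / M
  · refine ⟨false, M * y, by positivity, ?_, by simp; field_simp⟩
    rw [le_div_iff₀ hM0] at hy; linarith
  · have hy2 : 1 - 1 / M ≤ y := by by_contra! h2; exact h ⟨not_le.1 hy, h2⟩
    refine ⟨true, 1 - M * (1 - y), ?_, by nlinarith, by simp; field_simp; ring⟩
    have : 1 - y ≤ 1 / M := by linarith
    rw [le_div_iff₀ hM0] at this; linarith

theorem exists_branch_of_mem_cantor (hM : 2 < M) {y : ℝ} (hy : y ∈ cantor M) :
    ∃ b, ∃ y' ∈ cantor M, y = branch M b y' := by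
  obtain ⟨b, y', h0, h1, rfl⟩ := exists_branch_of_mem_Icc hM hy.1 hy.2.1 (hy.2.2 [])
  refine ⟨b, y', ⟨h0, h1, fun w hw => hy.2.2 (b :: w) ?_⟩, rfl⟩
  rw [word_cons, word_cons, branch_lt_branch (by linarith), branch_lt_branch (by linarith)]
  exact hw

theorem word_mem_cantor (hM : 2 < M) (w : List Bool) {y : ℝ} (hy : y ∈ cantor M) :
    word M w y ∈ cantor M := by
  induction w with
  | nil => exact hy
  | cons b w ih => exact branch_mem_cantor hM b ih

theorem gap_left_mem_cantor (hM : 2 < M) (w : List Bool) : word M w (1 / M) ∈ cantor M :=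
  word_mem_cantor hM w ((branch_zero_one hM).1 ▸ branch_mem_cantor hM false (one_mem_cantor hM))

theorem gap_right_mem_cantor (hM : 2 < M) (w : List Bool) : word M w (1 - 1 / M) ∈ cantor M :=
  word_mem_cantor hM w ((branch_zero_one hM).2.1 ▸ branch_mem_cantor hM true (zero_mem_cantor hM))

end cantor

/-! ### Images of the arc behind a leaf -/

/-- The lift of an angle in the arc behind the leaf with ends `α < γ`, in terms of the coordinate in
which this arc is the unit interval. -/
def arcPt (α γ y : ℝ) : ℝ := α + (γ - α) * y

theorem four_le_two_pow {m : ℕ} (hm : 1 < m) : (4 : ℝ) ≤ 2 ^ m := by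
  calc (4 : ℝ) = 2 ^ 2 := by norm_num
    _ ≤ 2 ^ m := pow_le_pow_right₀ (by norm_num) hm

namespace LeafData

variable {m : ℕ} {α γ : ℝ}

theorem four_le (h : LeafData m α γ) : (4 : ℝ) ≤ 2 ^ m := four_le_two_pow h.one_lt

theorem two_lt (h : LeafData m α γ) : (2 : ℝ) < 2 ^ m := by linarith [h.four_le]

theorem dot (h : LeafData m α γ) : ∃ ε : ℤ, (ε = 0 ∨ ε = 1) ∧ (∃ K : ℤ, 2 ^ (m - 1) * α = (α + ε) / 2 + K) ∧
      ∃ K : ℤ, 2 ^ (m - 1) * γ = (γ + (1 - ε)) / 2 + K :=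
  exists_dot (by linarith [h.one_lt]) h.lt h.per_left h.per_right (h.same (m - 1))

/-- The orbit of the ends of a parameter leaf does not enter the arc behind the leaf. -/
theorem avoid (h : LeafData m α γ) (l : ℕ) : ¬ OpArc α γ ((2 ^ l * α : ℝ) : Angle) ∧
    ¬ OpArc α γ ((2 ^ l * γ : ℝ) : Angle) := by
  have hlt := h.lt
  have hsh := h.short
  cases l with
  | zero =>
    simp only [pow_zero, one_mul]
    exact ⟨fun h' => h'.ne_left (by linarith) rfl, fun h' => h'.ne_right (by linarith) rfl⟩
  | succ l =>
    obtain ⟨i, h1, h2⟩ := h.same l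
    have key : ∀ u : ℝ, Quarter α γ i ((2 ^ l * u : ℝ) : Angle) →
        ¬ OpArc α γ ((2 ^ (l + 1) * u : ℝ) : Angle) := by
      intro u hu hu'
      rw [quarter_coe_iff] at hu
      rw [opArc_coe_iff] at hu'
      obtain ⟨n, a1, a2⟩ := hu
      obtain ⟨k, b1, b2⟩ := hu'
      have e : (2 : ℝ) ^ (l + 1) * u = 2 * (2 ^ l * u) := by ring
      rw [e] at b1 b2
      have c1 : ((i + 2 * n - 1 : ℤ) : ℝ) < k := by push_cast; linarith
      have c2 : (k : ℝ) < ((i + 2 * n : ℤ) : ℝ) := by push_cast; linarith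
      have c1 := Int.cast_lt.1 c1
      have c2 := Int.cast_lt.1 c2
      omega
    exact ⟨key α h1, key γ h2⟩

/-- After `m` steps, the arcs at the two ends of the arc behind the leaf are expanded onto the whole
arc, by the inverses of the two branches. -/
theorem return_branch (h : LeafData m α γ) (b : Bool) (y : ℝ) :
    ∃ N : ℤ, 2 ^ m * arcPt α γ (branch (2 ^ m) b y) = arcPt α γ y + N := by
  have hM := h.two_lt
  cases b
  · obtain ⟨N, hN⟩ := h.per_left
    refine ⟨N, ?_⟩
    simp only [arcPt, branch_false]
    field_simp
    linear_combination hN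
  · obtain ⟨N, hN⟩ := h.per_right
    refine ⟨N, ?_⟩
    simp only [arcPt, branch_true]
    field_simp
    linear_combination hN

theorem return_word (h : LeafData m α γ) (w : List Bool) (y : ℝ) :
    ∃ N : ℤ, 2 ^ (w.length * m) * arcPt α γ (word (2 ^ m) w y) = arcPt α γ y + N := by
  induction w with
  | nil => exact ⟨0, by simp⟩
  | cons b w ih =>
    obtain ⟨N, hN⟩ := h.return_branch b (word (2 ^ m) w y)
    obtain ⟨K, hK⟩ := ih
    refine ⟨K + 2 ^ (w.length * m) * N, ?_⟩
    rw [List.length_cons, add_mul, one_mul, pow_add, word_cons, mul_assoc, hN, mul_add, hK]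
    push_cast
    ring

/-- Before the first return, the images of the arcs at the two ends of the arc behind the leaf do
not meet this arc: otherwise an end of the leaf would be mapped into the arc. -/
theorem image_avoid (h : LeafData m α γ) {s : ℕ} (h0 : 0 < s) (hs : s < m) (b : Bool) {y : ℝ} (hy0 : 0 ≤ y)
    (hy1 : y ≤ 1) : ¬ OpArc α γ ((2 ^ s * arcPt α γ (branch (2 ^ m) b y) : ℝ) : Angle) := by
  have hlt := h.lt
  have hsh := h.short
  have e : (2 : ℝ) ^ m = 2 ^ (m - s) * 2 ^ s := by rw [← pow_add, Nat.sub_add_cancel hs.le]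
  have p1 : (0 : ℝ) < 2 ^ s := by positivity
  have p2 : (0 : ℝ) < 2 ^ (m - s) := by positivity
  intro hop
  rw [opArc_coe_iff] at hop
  obtain ⟨n, h1, h2⟩ := hop
  cases b
  · have e1 : 2 ^ s * arcPt α γ (branch (2 ^ m) false y) =
        2 ^ s * α + (γ - α) * y / 2 ^ (m - s) := by
      simp only [arcPt, branch_false]; rw [e]; field_simp
    rw [e1] at h1 h2
    have e2 : 0 ≤ (γ - α) * y / 2 ^ (m - s) := by
      have : 0 ≤ γ - α := by linarith
      positivity
    have e3 : 2 ^ s * α - n ≤ α := by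
      by_contra! h3
      exact (h.avoid s).1 (opArc_coe_iff.2 ⟨n, h3, by linarith⟩)
    have e4 : 2 ^ s * α - n ≠ α := fun h3 => h.exact_left s h0 hs n (by linarith)
    have e5 : 2 ^ s * α - n < α := lt_of_le_of_ne e3 e4
    obtain ⟨N, hN⟩ := h.per_left
    have e6 : 2 ^ (m - s) * (α + n - 2 ^ s * α) < γ - α := by
      have : α + n - 2 ^ s * α < (γ - α) * y / 2 ^ (m - s) := by linarith
      rw [lt_div_iff₀ p2] at this
      nlinarith
    refine (h.avoid (m - s)).1 (opArc_coe_iff.2 ⟨N - 2 ^ (m - s) * n, ?_, ?_⟩)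
    · push_cast
      have : 0 < 2 ^ (m - s) * (α + n - 2 ^ s * α) := mul_pos p2 (by linarith)
      rw [e] at hN
      linarith
    · push_cast
      rw [e] at hN
      linarith
  · have e1 : 2 ^ s * arcPt α γ (branch (2 ^ m) true y) =
        2 ^ s * γ - (γ - α) * (1 - y) / 2 ^ (m - s) := by
      simp only [arcPt, branch_true]; rw [e]; field_simp; ring
    rw [e1] at h1 h2
    have e2 : 0 ≤ (γ - α) * (1 - y) / 2 ^ (m - s) := by
      have : 0 ≤ γ - α := by linarith
      have : 0 ≤ 1 - y := by linarith
      positivity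
    have e3 : γ ≤ 2 ^ s * γ - n := by
      by_contra! h3
      exact (h.avoid s).2 (opArc_coe_iff.2 ⟨n, by linarith, h3⟩)
    have e4 : 2 ^ s * γ - n ≠ γ := fun h3 => h.exact_right s h0 hs n (by linarith)
    have e5 : γ < 2 ^ s * γ - n := lt_of_le_of_ne e3 e4.symm
    obtain ⟨N, hN⟩ := h.per_right
    have e6 : 2 ^ (m - s) * (2 ^ s * γ - n - γ) < γ - α := by
      have : 2 ^ s * γ - n - γ < (γ - α) * (1 - y) / 2 ^ (m - s) := by linarith
      rw [lt_div_iff₀ p2] at this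
      nlinarith
    refine (h.avoid (m - s)).2 (opArc_coe_iff.2 ⟨N - 2 ^ (m - s) * n, ?_, ?_⟩)
    · push_cast
      rw [e] at hN
      linarith
    · push_cast
      have : 0 < 2 ^ (m - s) * (2 ^ s * γ - n - γ) := mul_pos p2 (by linarith)
      rw [e] at hN
      linarith

/-- Before the last step, the images of the arcs at the two ends of the arc behind the leaf lie in
one quarter. -/
theorem image_quarter (h : LeafData m α γ) {s : ℕ} (hs : s + 1 < m) {i : ℤ}
    (h1 : Quarter α γ i ((2 ^ s * α : ℝ) : Angle)) (h2 : Quarter α γ i ((2 ^ s * γ : ℝ) : Angle))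
    (b : Bool) {y : ℝ} (hy0 : 0 ≤ y) (hy1 : y ≤ 1) :
    Quarter α γ i ((2 ^ s * arcPt α γ (branch (2 ^ m) b y) : ℝ) : Angle) := by
  have hlt := h.lt
  have hsh := h.short
  have hav := h.image_avoid (s := s + 1) (by omega) hs b hy0 hy1
  obtain ⟨r, hr⟩ : ∃ r, m = s + 2 + r := ⟨m - (s + 2), by omega⟩
  have p1 : (0 : ℝ) < 2 ^ s := by positivity
  have p2 : (1 : ℝ) ≤ 2 ^ r := one_le_pow₀ (by norm_num)
  have e : (2 : ℝ) ^ m = 2 ^ s * (4 * 2 ^ r) := by rw [hr, pow_add, pow_add]; ring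
  rw [quarter_coe_iff] at h1 h2 ⊢
  rw [opArc_coe_iff] at hav
  push Not at hav
  have e0 : (2 : ℝ) ^ (s + 1) = 2 * 2 ^ s := by ring
  rw [e0] at hav
  cases b
  · obtain ⟨n, a1, a2⟩ := h1
    have e1 : 2 ^ s * arcPt α γ (branch (2 ^ m) false y) =
        2 ^ s * α + (γ - α) * y / (4 * 2 ^ r) := by
      simp only [arcPt, branch_false]; rw [e]; field_simp
    have e2 : 0 ≤ (γ - α) * y / (4 * 2 ^ r) := by
      have : 0 ≤ γ - α := by linarith
      positivity
    have e3 : (γ - α) * y / (4 * 2 ^ r) ≤ (γ - α) / 4 := by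
      rw [div_le_div_iff₀ (by positivity) (by norm_num)]
      nlinarith [mul_nonneg (sub_nonneg.2 hlt.le) (sub_nonneg.2 p2),
        mul_nonneg (sub_nonneg.2 hlt.le) (sub_nonneg.2 hy1)]
    refine ⟨n, by linarith, ?_⟩
    by_contra! h3
    have := hav (i + 2 * n) (by push_cast; linarith)
    push_cast at this
    linarith
  · obtain ⟨n, a1, a2⟩ := h2
    have e1 : 2 ^ s * arcPt α γ (branch (2 ^ m) true y) =
        2 ^ s * γ - (γ - α) * (1 - y) / (4 * 2 ^ r) := by
      simp only [arcPt, branch_true]; rw [e]; field_simp; ring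
    have e2 : 0 ≤ (γ - α) * (1 - y) / (4 * 2 ^ r) := by
      have : 0 ≤ γ - α := by linarith
      have : 0 ≤ 1 - y := by linarith
      positivity
    have e3 : (γ - α) * (1 - y) / (4 * 2 ^ r) ≤ (γ - α) / 4 := by
      rw [div_le_div_iff₀ (by positivity) (by norm_num)]
      nlinarith [mul_nonneg (sub_nonneg.2 hlt.le) (sub_nonneg.2 p2),
        mul_nonneg (sub_nonneg.2 hlt.le) hy0]
    refine ⟨n, ?_, by linarith⟩
    by_contra! h3
    have := hav (i + 2 * n - 1) (by push_cast; linarith)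
    push_cast at this
    linarith

/-- The half turn that distinguishes the images of the two branches before the first return. -/
theorem image_last (h : LeafData m α γ) {ε : ℤ} (hα : ∃ K : ℤ, 2 ^ (m - 1) * α = (α + ε) / 2 + K)
    (hγ : ∃ K : ℤ, 2 ^ (m - 1) * γ = (γ + (1 - ε)) / 2 + K) (b : Bool) (y : ℝ) :
    ∃ K : ℤ, 2 ^ (m - 1) * arcPt α γ (branch (2 ^ m) b y) =
      (arcPt α γ y + ((if b then 1 - ε else ε : ℤ) : ℝ)) / 2 + K := by
  have e : (2 : ℝ) ^ m = 2 * 2 ^ (m - 1) := by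
    rw [← pow_succ', Nat.sub_add_cancel (by linarith [h.one_lt])]
  cases b
  · obtain ⟨K, hK⟩ := hα
    refine ⟨K, ?_⟩
    simp only [arcPt, branch_false, e]
    simp only [Bool.false_eq_true, if_false]
    field_simp
    linear_combination 2 * hK
  · obtain ⟨K, hK⟩ := hγ
    refine ⟨K, ?_⟩
    simp only [arcPt, branch_true, e]
    simp only [if_true]
    push_cast
    field_simp
    linear_combination 2 * hK

end LeafData

/-! ### The generating dynamic lamination -/

theorem mk_coe_congr {x x' y y' : ℝ} (hx : ∃ n : ℤ, x = x' + n) (hy : ∃ n : ℤ, y = y' + n) :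
    (s((x : Angle), (y : Angle)) : Chord) = s((x' : Angle), (y' : Angle)) := by
  rw [coe_eq_coe_iff.2 hx, coe_eq_coe_iff.2 hy]

/-- The chord joining the ends of a quarter. For `i = 0, 1` these are the two preimages `Ṡ` and `S̈`
of the parameter leaf `S` with the ends `α` and `γ`, in an order depending on `S`. -/
def quarterChord (α γ : ℝ) (i : ℤ) : Chord :=
  s((((γ - 1 + i) / 2 : ℝ) : Angle), (((α + i) / 2 : ℝ) : Angle))

theorem quarterChord_add_two (α γ : ℝ) (i r : ℤ) :
    quarterChord α γ (i + 2 * r) = quarterChord α γ i :=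
  mk_coe_congr ⟨r, by push_cast; ring⟩ ⟨r, by push_cast; ring⟩

theorem quarterChord_eq_or (α γ : ℝ) (ε i : ℤ) :
    quarterChord α γ i = quarterChord α γ ε ∨ quarterChord α γ i = quarterChord α γ (ε + 1) := by
  rcases Int.emod_two_eq_zero_or_one (i - ε) with h | h
  · left
    rw [← quarterChord_add_two α γ ε ((i - ε) / 2)]; congr 1; omega
  · right
    rw [← quarterChord_add_two α γ (ε + 1) ((i - ε) / 2)]; congr 1; omega

theorem dbl_mem_of_mem_quarterChord {α γ : ℝ} {i : ℤ} {t : Angle} (ht : t ∈ quarterChord α γ i) :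
    dbl t = (γ : Angle) ∨ dbl t = (α : Angle) := by
  rcases Sym2.mem_iff.1 ht with rfl | rfl
  · left; rw [dbl_coe, coe_eq_coe_iff]; exact ⟨i - 1, by push_cast; ring⟩
  · right; rw [dbl_coe, coe_eq_coe_iff]; exact ⟨i, by ring⟩

theorem opArc_dbl {p q : ℝ} {t : Angle} (h : OpArc p q t) : OpArc (2 * p) (2 * q) (dbl t) := by
  obtain ⟨r, h1, h2, rfl⟩ := h
  exact ⟨2 * r, by linarith, by linarith, (dbl_coe r).symm⟩

theorem clArc_dbl {p q : ℝ} {t : Angle} (h : ClArc p q t) : ClArc (2 * p) (2 * q) (dbl t) := by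
  obtain ⟨r, h1, h2, rfl⟩ := h
  exact ⟨2 * r, by linarith, by linarith, (dbl_coe r).symm⟩

theorem clArc_add_int {x y : ℝ} {t : Angle} (n : ℤ) : ClArc (x + n) (y + n) t ↔ ClArc x y t := by
  constructor
  · rintro ⟨r, h1, h2, h3⟩
    exact ⟨r - n, by linarith, by linarith, by rw [coe_sub_int, h3]⟩
  · rintro ⟨r, h1, h2, h3⟩
    exact ⟨r + n, by linarith, by linarith, by rw [coe_add_int, h3]⟩

/-- The interior of a quarter is mapped to the complement of the arc from `α` to `γ`. -/
theorem opArc_dbl_of_quarter {α γ : ℝ} {i : ℤ} {t : Angle}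
    (h : OpArc ((γ - 1 + i) / 2) ((α + i) / 2) t) : OpArc γ (α + 1) (dbl t) := by
  have := opArc_dbl h
  rw [← opArc_add_int (i - 1)]
  push_cast
  convert this using 1 <;> ring

theorem opArc_dbl_of_central {α γ : ℝ} {i : ℤ} {t : Angle}
    (h : OpArc ((α + i) / 2) ((γ + i) / 2) t) : OpArc α γ (dbl t) := by
  have := opArc_dbl h
  rw [← opArc_add_int i]
  convert this using 1 <;> ring

theorem clArc_dbl_of_central {α γ : ℝ} {i : ℤ} {t : Angle}
    (h : ClArc ((α + i) / 2) ((γ + i) / 2) t) : ClArc α γ (dbl t) := by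
  have := clArc_dbl h
  rw [← clArc_add_int i]
  convert this using 1 <;> ring

/-- Each angle lies inside a quarter or in one of the closed preimages of the arc from `α` to
`γ`. -/
theorem quarter_or_central (α γ : ℝ) (t : Angle) :
    (∃ i : ℤ, OpArc ((γ - 1 + i) / 2) ((α + i) / 2) t) ∨
      ∃ i : ℤ, ClArc ((α + i) / 2) ((γ + i) / 2) t := by
  obtain ⟨x, -, -, rfl⟩ := exists_lift t 0
  have h1 := Int.floor_le (2 * x - α)
  have h2 := Int.lt_floor_add_one (2 * x - α)
  by_cases h3 : 2 * x ≤ γ + ⌊2 * x - α⌋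
  · exact Or.inr ⟨⌊2 * x - α⌋, x, by linarith, by linarith, rfl⟩
  · exact Or.inl ⟨⌊2 * x - α⌋ + 1, x, by push_cast; linarith, by push_cast; linarith, rfl⟩

/-- The conditions on the iterates of the leaves of the generating dynamic lamination, in terms of
angles. -/
def Admissible (α γ : ℝ) (R : Chord) : Prop :=
  R.length ≤ (1 - (γ - α)) / 2 ∧ (∀ i, ¬ Linked R (quarterChord α γ i)) ∧
    ∀ c d : ℤ, c = d + 1 ∨ d = c + 1 → Between R (quarterChord α γ c) (quarterChord α γ d) →
      ∀ x ∈ R, ∀ i, x ∉ quarterChord α γ i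

theorem length_quarterChord {α γ : ℝ} (hlt : α < γ) (hsh : γ < α + 1 / 2) (i : ℤ) :
    (quarterChord α γ i).length = (1 - (γ - α)) / 2 := by
  rw [quarterChord, length_mk, dist_comm, dist_eq_norm, ← AddCircle.coe_sub,
    (AddCircle.norm_coe_eq_abs_iff (1 : ℝ) one_ne_zero).2]
  · rw [abs_of_nonneg] <;> linarith
  · rw [abs_le]; constructor <;> norm_num <;> linarith

theorem quarterChord_not_opArc {α γ : ℝ} (hlt : α < γ) {i j : ℤ} {t : Angle}
    (hsh : γ < α + 1 / 2) (ht : t ∈ quarterChord α γ i) :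
    ¬ OpArc ((γ - 1 + j) / 2) ((α + j) / 2) t ∧ ¬ OpArc ((α + j) / 2) ((γ + j) / 2) t := by
  refine ⟨fun h => ?_, fun h => ?_⟩
  · have := opArc_dbl_of_quarter h
    rcases dbl_mem_of_mem_quarterChord ht with h1 | h1 <;> rw [h1] at this
    · exact this.ne_left (by linarith) rfl
    · exact this.ne_right (by linarith) (coe_add_one α).symm
  · have := opArc_dbl_of_central h
    rcases dbl_mem_of_mem_quarterChord ht with h1 | h1 <;> rw [h1] at this
    · exact this.ne_right (by linarith) rfl
    · exact this.ne_left (by linarith) rfl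

theorem seg_quarterChord_subset {α γ : ℝ} (hlt : α < γ) (hsh : γ < α + 1 / 2) (i : ℤ) :
    (quarterChord α γ (i + 1)).seg ⊆ {z | side ((γ - 1 + i) / 2) ((α + i) / 2) z < 0} := by
  refine seg_subset (convex_side_neg _ _) fun t ht => side_pt_neg (by linarith) ?_
  rcases Sym2.mem_iff.1 ht with rfl | rfl
  · exact ⟨_, by push_cast; linarith, by push_cast; linarith, rfl⟩
  · exact ⟨_, by push_cast; linarith, by push_cast; linarith, rfl⟩

theorem disjoint_seg_quarterChord {α γ : ℝ} (hlt : α < γ) (hsh : γ < α + 1 / 2) (i : ℤ) :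
    Disjoint (quarterChord α γ i).seg (quarterChord α γ (i + 1)).seg := by
  rw [Set.disjoint_left]
  intro z h1 h2
  have h3 := seg_quarterChord_subset hlt hsh i h2
  have h4 := side_eq_zero_of_mem_seg h1
  exact h3.ne h4

/-- A chord with both ends in a quarter does not lie between `Ṡ` and `S̈`. -/
theorem not_between_of_quarter {α γ : ℝ} (hlt : α < γ) (hsh : γ < α + 1 / 2) {U V : Angle} {i : ℤ}
    (hU : Quarter α γ i U) (hV : Quarter α γ i V) (hne : U ≠ V) {c d : ℤ}
    (hcd : c = d + 1 ∨ d = c + 1) :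
    ¬ Between s(U, V) (quarterChord α γ c) (quarterChord α γ d) := by
  rintro ⟨-, hstrip, z, hz, hzc, hzd⟩
  have hpar : (quarterChord α γ i = quarterChord α γ c ∧
      quarterChord α γ (i + 1) = quarterChord α γ d) ∨
      (quarterChord α γ i = quarterChord α γ d ∧
      quarterChord α γ (i + 1) = quarterChord α γ c) := by
    rcases Int.emod_two_eq_zero_or_one (i - c) with h | h
    · left
      rw [← quarterChord_add_two α γ c ((i - c) / 2),
        ← quarterChord_add_two α γ d ((i + 1 - d) / 2)]
      constructor <;> congr 1 <;> omega
    · right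
      rw [← quarterChord_add_two α γ d ((i - d) / 2),
        ← quarterChord_add_two α γ c ((i + 1 - c) / 2)]
      constructor <;> congr 1 <;> omega
  have hno : ∀ T ∈ s(U, V), ¬ OpArc ((γ - 1 + i) / 2) ((α + i) / 2) T := by
    intro T hT hop
    have hsm : pt T ∈ (quarterChord α γ i).smallPart :=
      (mem_smallPart (by linarith) (by linarith)).2
        ⟨(norm_pt T).le, side_pt_pos (by linarith) hop⟩
    have hbig : (quarterChord α γ (i + 1)).seg ⊆ (quarterChord α γ i).bigPart := fun w hw =>
      (mem_bigPart (by linarith) (by linarith)).2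
        ⟨norm_le_one_of_mem_seg hw, seg_quarterChord_subset hlt hsh i hw⟩
    obtain ⟨-, h1, h2⟩ := hstrip (pt_mem_seg hT)
    rcases hpar with ⟨e1, e2⟩ | ⟨e1, e2⟩
    · rw [← e1, ← e2] at h1
      exact h1 (Or.inl ⟨hsm, hbig⟩)
    · rw [← e1, ← e2] at h2
      exact h2 (Or.inl ⟨hsm, hbig⟩)
  have hend : ∀ {T : Angle}, T ∈ s(U, V) → Quarter α γ i T →
      T = (((γ - 1 + i) / 2 : ℝ) : Angle) ∨ T = (((α + i) / 2 : ℝ) : Angle) := by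
    intro T hT hq
    by_contra! hne
    exact hno T hT (ClArc.opArc hq hne.1 hne.2)
  have heq : s(U, V) = quarterChord α γ i := by
    rcases hend (by simp) hU with h1 | h1 <;> rcases hend (by simp) hV with h2 | h2
    · exact absurd (h1.trans h2.symm) hne
    · rw [h1, h2]; rfl
    · rw [h1, h2, Sym2.eq_swap]; rfl
    · exact absurd (h1.trans h2.symm) hne
  rw [heq] at hz
  rcases hpar with ⟨e1, -⟩ | ⟨e1, -⟩
  · exact hzc (e1 ▸ hz)
  · exact hzd (e1 ▸ hz)

theorem length_le_of_clArc {p q : ℝ} {U V : Angle} (hU : ClArc p q U) (hV : ClArc p q V) :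
    length s(U, V) ≤ q - p := by
  obtain ⟨u, h1, h2, rfl⟩ := hU
  obtain ⟨v, h3, h4, rfl⟩ := hV
  rw [length_mk, dist_coe_le_iff]
  exact ⟨0, by rw [abs_le]; constructor <;> push_cast <;> linarith⟩

theorem admissible_of_quarter {α γ : ℝ} (hlt : α < γ) (hsh : γ < α + 1 / 2) {U V : Angle} {i : ℤ}
    (hU : Quarter α γ i U) (hV : Quarter α γ i V) (hne : U ≠ V) : Admissible α γ s(U, V) := by
  refine ⟨?_, ?_, ?_⟩
  · have := length_le_of_clArc hU hV
    linarith
  · intro j hj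
    obtain ⟨u, h1, h2, rfl⟩ := hU
    obtain ⟨v, h3, h4, rfl⟩ := hV
    rcases hj.symm.exists_opArc (by linarith) h1 h2 h3 h4 with h | h
    · exact (quarterChord_not_opArc (j := i) hlt hsh (Sym2.mem_mk_left _ _)).1 h
    · exact (quarterChord_not_opArc (j := i) hlt hsh (Sym2.mem_mk_right _ _)).1 h
  · intro c d hcd hb
    exact absurd hb (not_between_of_quarter hlt hsh hU hV hne hcd)

/-- A chord inside an open preimage of the arc from `α` to `γ` cannot violate any of the conditions:
it lies between `Ṡ` and `S̈`, but has no end in common with them. -/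
theorem admissible_of_central {α γ : ℝ} (hlt : α < γ) (hsh : γ < α + 1 / 2) {U V : Angle} {i : ℤ}
    (hU : OpArc ((α + i) / 2) ((γ + i) / 2) U) (hV : OpArc ((α + i) / 2) ((γ + i) / 2) V) :
    Admissible α γ s(U, V) := by
  refine ⟨?_, ?_, ?_⟩
  · have := length_le_of_clArc hU.clArc hV.clArc
    linarith
  · intro j hj
    obtain ⟨u, h1, h2, rfl⟩ := hU
    obtain ⟨v, h3, h4, rfl⟩ := hV
    rcases hj.symm.exists_opArc (by linarith) h1.le h2.le h3.le h4.le with h | h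
    · exact (quarterChord_not_opArc (j := i) hlt hsh (Sym2.mem_mk_left _ _)).2 h
    · exact (quarterChord_not_opArc (j := i) hlt hsh (Sym2.mem_mk_right _ _)).2 h
  · intro c d _ _ x hx j hxj
    have := (quarterChord_not_opArc (j := i) hlt hsh hxj).2
    rcases Sym2.mem_iff.1 hx with rfl | rfl
    · exact this hU
    · exact this hV

theorem not_isDiag_of_iter {c : Chord} (n : ℕ) (h : ¬ (iter n c).IsDiag) : ¬ c.IsDiag := by
  induction c using Sym2.ind with
  | _ x y =>
    intro h1
    apply h
    rw [Sym2.mk_isDiag_iff] at h1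
    simp [iter, h1]

/-- The leaf over the gap of the Cantor set given by a word. -/
def gapLeaf (m : ℕ) (α γ : ℝ) (w : List Bool) : Chord :=
  s(((arcPt α γ (word (2 ^ m) w (1 / 2 ^ m)) : ℝ) : Angle),
    ((arcPt α γ (word (2 ^ m) w (1 - 1 / 2 ^ m)) : ℝ) : Angle))

namespace LeafData

variable {m : ℕ} {α γ : ℝ}

theorem dotLeaf_eq (h : LeafData m α γ) : ∃ ε : ℤ, (ε = 0 ∨ ε = 1) ∧
    (∃ K : ℤ, 2 ^ (m - 1) * α = (α + ε) / 2 + K) ∧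
    (∃ K : ℤ, 2 ^ (m - 1) * γ = (γ + (1 - ε)) / 2 + K) ∧
    dotLeaf m s((α : Angle), (γ : Angle)) = quarterChord α γ ε ∧
    ddotLeaf m s((α : Angle), (γ : Angle)) = quarterChord α γ (ε + 1) := by
  obtain ⟨ε, hε, hK, hK'⟩ := h.dot
  have h1 : dotLeaf m s((α : Angle), (γ : Angle)) = quarterChord α γ ε := by
    obtain ⟨K, hK⟩ := hK
    obtain ⟨K', hK'⟩ := hK'
    rw [dotLeaf, iter_mk, hK, hK', coe_add_int, coe_add_int, Sym2.eq_swap]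
    refine mk_coe_congr ?_ ⟨0, by simp⟩
    rcases hε with rfl | rfl
    · exact ⟨1, by push_cast; ring⟩
    · exact ⟨0, by push_cast; ring⟩
  refine ⟨ε, hε, hK, hK', h1, ?_⟩
  rw [ddotLeaf, h1, quarterChord, Sym2.map_mk, halfTurn_add_coe, halfTurn_add_coe, quarterChord]
  congr 3
  · push_cast; ring
  · push_cast; ring

theorem not_isDiag (h : LeafData m α γ) : ¬ (s((α : Angle), (γ : Angle)) : Chord).IsDiag := by
  rw [Sym2.mk_isDiag_iff]
  intro h1
  have := eq_of_coe_eq h1 (by linarith [h.lt, h.short]) (by linarith [h.lt, h.short])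
  linarith [h.lt]

theorem iter_period (h : LeafData m α γ) (j : ℕ) :
    iter (j * m) s((α : Angle), (γ : Angle)) = s((α : Angle), (γ : Angle)) := by
  induction j with
  | zero => simp [iter]
  | succ j ih =>
    obtain ⟨N, hN⟩ := h.per_left
    obtain ⟨N', hN'⟩ := h.per_right
    rw [add_mul, one_mul, iter_add, iter_mk m, hN, hN', coe_add_int, coe_add_int, ih]

theorem iter_leaf_not_isDiag (h : LeafData m α γ) (l : ℕ) :
    ¬ (iter l s((α : Angle), (γ : Angle))).IsDiag := by
  apply not_isDiag_of_iter (l * m - l)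
  rw [← iter_add, Nat.sub_add_cancel (Nat.le_mul_of_pos_right l (by linarith [h.one_lt])),
    h.iter_period]
  exact h.not_isDiag

theorem admissible_iter_leaf (h : LeafData m α γ) (l : ℕ) :
    Admissible α γ (iter l s((α : Angle), (γ : Angle))) := by
  have hd := h.iter_leaf_not_isDiag l
  obtain ⟨i, h1, h2⟩ := h.same l
  rw [iter_mk] at hd ⊢
  exact admissible_of_quarter h.lt h.short h1 h2 (by simpa using hd)

/-- Membership in the generating dynamic lamination in terms of angles. -/
theorem mem_genLam_iff (h : LeafData m α γ) {R : Chord} :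
    R ∈ genLam m s((α : Angle), (γ : Angle)) ↔
      (∃ n, iter n R = s((α : Angle), (γ : Angle))) ∧ ∀ n, Admissible α γ (iter n R) := by
  obtain ⟨ε, hε, -, -, h1, h2⟩ := h.dotLeaf_eq
  unfold genLam Admissible
  rw [h1, h2, Set.mem_ofPred_eq, length_quarterChord h.lt h.short, length_quarterChord h.lt h.short]
  refine and_congr_right fun _ => forall_congr' fun n => ?_
  simp only [cross_iff_linked]
  constructor
  · rintro ⟨a1, -, a3, a4, a5⟩
    refine ⟨a1, fun i => ?_, fun c d hcd hb x hx i => ?_⟩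
    · rcases quarterChord_eq_or α γ ε i with e | e <;> rw [e] <;> assumption
    · have hb' : Between (iter n R) (quarterChord α γ ε) (quarterChord α γ (ε + 1)) := by
        have hsymm : ∀ {c d : Chord}, Between (iter n R) c d → Between (iter n R) d c := by
          rintro c d ⟨b1, b2, z, b3, b4, b5⟩
          exact ⟨b1.symm, fun w hw => ⟨(b2 hw).1, (b2 hw).2.2, (b2 hw).2.1⟩, z, b3, b5, b4⟩
        have hne : quarterChord α γ c ≠ quarterChord α γ d := by
          intro e
          obtain ⟨b1, b2, z, b3, b4, b5⟩ := hb
          rw [e] at b1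
          have : (pt ((((γ - 1 + d) / 2 : ℝ)) : Angle)) ∈ (quarterChord α γ d).seg :=
            pt_mem_seg (Sym2.mem_mk_left _ _)
          exact Set.disjoint_left.1 b1 this this
        rcases quarterChord_eq_or α γ ε c with e1 | e1 <;>
        rcases quarterChord_eq_or α γ ε d with e2 | e2
        · exact absurd (e1.trans e2.symm) hne
        · rw [← e1, ← e2]; exact hb
        · rw [← e1, ← e2]; exact hsymm hb
        · exact absurd (e1.trans e2.symm) hne
      obtain ⟨b1, b2⟩ := a5 hb' x hx
      rcases quarterChord_eq_or α γ ε i with e | e <;> rw [e] <;> assumption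
  · rintro ⟨a1, a2, a3⟩
    exact ⟨a1, a1, a2 _, a2 _, fun hb x hx => ⟨a3 _ _ (Or.inr rfl) hb x hx _,
      a3 _ _ (Or.inr rfl) hb x hx _⟩⟩

theorem leaf_mem_genLam (h : LeafData m α γ) :
    s((α : Angle), (γ : Angle)) ∈ genLam m s((α : Angle), (γ : Angle)) :=
  h.mem_genLam_iff.2 ⟨⟨0, by simp [iter]⟩, h.admissible_iter_leaf⟩

theorem iter_gapLeaf_append (h : LeafData m α γ) (w v : List Bool) :
    iter (w.length * m) (gapLeaf m α γ (w ++ v)) = gapLeaf m α γ v := by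
  unfold gapLeaf
  rw [iter_mk, word_append, word_append]
  obtain ⟨N, hN⟩ := h.return_word w (word (2 ^ m) v (1 / 2 ^ m))
  obtain ⟨N', hN'⟩ := h.return_word w (word (2 ^ m) v (1 - 1 / 2 ^ m))
  rw [hN, hN', coe_add_int, coe_add_int]

theorem iter_gapLeaf_nil (h : LeafData m α γ) :
    iter m (gapLeaf m α γ []) = s((α : Angle), (γ : Angle)) := by
  obtain ⟨e1, e2, -⟩ := branch_zero_one h.two_lt
  unfold gapLeaf
  rw [word_nil, word_nil, iter_mk, ← e2, ← e1]
  obtain ⟨N, hN⟩ := h.return_branch false 1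
  obtain ⟨N', hN'⟩ := h.return_branch true 0
  rw [hN, hN', coe_add_int, coe_add_int, Sym2.eq_swap]
  simp [arcPt]

theorem iter_gapLeaf (h : LeafData m α γ) (w : List Bool) :
    iter ((w.length + 1) * m) (gapLeaf m α γ w) = s((α : Angle), (γ : Angle)) := by
  have := h.iter_gapLeaf_append w []
  rw [List.append_nil] at this
  rw [add_mul, one_mul, add_comm, iter_add, this, h.iter_gapLeaf_nil]

/-- The largest gap leaf reaches `S` through the preimage `S̈` of `S` with preperiodic ends. -/
theorem iter_gapLeaf_nil_last (h : LeafData m α γ) :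
    ∃ ε, dotLeaf m s((α : Angle), (γ : Angle)) = quarterChord α γ ε ∧
      iter (m - 1) (gapLeaf m α γ []) = quarterChord α γ (ε + 1) := by
  obtain ⟨ε, hε, hK, hK', hd, -⟩ := h.dotLeaf_eq
  obtain ⟨e1, e2, -⟩ := branch_zero_one h.two_lt
  obtain ⟨K, hK1⟩ := h.image_last hK hK' false 1
  obtain ⟨K', hK1'⟩ := h.image_last hK hK' true 0
  refine ⟨ε, hd, ?_⟩
  unfold gapLeaf quarterChord
  rw [word_nil, word_nil, iter_mk, ← e2, ← e1, hK1, hK1', coe_add_int, coe_add_int]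
  exact mk_coe_congr ⟨0, by simp [arcPt]⟩ ⟨-ε, by simp [arcPt]; ring⟩

theorem gap_end_eq_branch (h : LeafData m α γ) (w : List Bool) :
    (∃ b y, 0 ≤ y ∧ y ≤ 1 ∧ word (2 ^ m) w (1 / 2 ^ m) = branch (2 ^ m) b y) ∧
      ∃ b y, 0 ≤ y ∧ y ≤ 1 ∧ word (2 ^ m) w (1 - 1 / 2 ^ m) = branch (2 ^ m) b y := by
  obtain ⟨b, y, hy, e⟩ := exists_branch_of_mem_cantor h.two_lt (gap_left_mem_cantor h.two_lt w)
  obtain ⟨b', y', hy', e'⟩ :=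
    exists_branch_of_mem_cantor h.two_lt (gap_right_mem_cantor h.two_lt w)
  exact ⟨⟨b, y, hy.1, hy.2.1, e⟩, ⟨b', y', hy'.1, hy'.2.1, e'⟩⟩

theorem iter_gapLeaf_not_isDiag (h : LeafData m α γ) (w : List Bool) (n : ℕ) :
    ¬ (iter n (gapLeaf m α γ w)).IsDiag := by
  have hm := h.one_lt
  apply not_isDiag_of_iter ((w.length + 1 + n) * m - n)
  have : n ≤ (w.length + 1 + n) * m := by nlinarith
  rw [← iter_add, Nat.sub_add_cancel this, add_mul, add_comm, iter_add, h.iter_gapLeaf,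
    h.iter_period]
  exact h.not_isDiag

/-- The leaves over the gaps of the Cantor set belong to the generating dynamic lamination. -/
theorem gapLeaf_mem_genLam (h : LeafData m α γ) (w : List Bool) :
    gapLeaf m α γ w ∈ genLam m s((α : Angle), (γ : Angle)) := by
  have hm := h.one_lt
  have hM := h.two_lt
  refine h.mem_genLam_iff.2 ⟨⟨_, h.iter_gapLeaf w⟩, fun n => ?_⟩
  induction w generalizing n with
  | nil =>
    rcases lt_trichotomy (n + 1) m with hn | hn | hn
    · obtain ⟨i, h1, h2⟩ := h.same n
      have hd := h.iter_gapLeaf_not_isDiag [] n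
      obtain ⟨⟨b, y, hy0, hy1, e⟩, ⟨b', y', hy0', hy1', e'⟩⟩ := h.gap_end_eq_branch []
      unfold gapLeaf at hd ⊢
      rw [iter_mk, e, e'] at hd ⊢
      exact admissible_of_quarter h.lt h.short (h.image_quarter hn h1 h2 b hy0 hy1)
        (h.image_quarter hn h1 h2 b' hy0' hy1') (by simpa using hd)
    · obtain ⟨ε, -, hi⟩ := h.iter_gapLeaf_nil_last
      have hd := h.iter_gapLeaf_not_isDiag [] (m - 1)
      obtain rfl : n = m - 1 := by omega
      rw [hi] at hd ⊢
      exact admissible_of_quarter h.lt h.short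
        ⟨_, le_rfl, by linarith [h.lt, h.short], rfl⟩
        ⟨_, by linarith [h.lt, h.short], le_rfl, rfl⟩ (by simpa [quarterChord] using hd)
    · obtain ⟨k, rfl⟩ : ∃ k, n = k + m := ⟨n - m, by omega⟩
      rw [iter_add, h.iter_gapLeaf_nil]
      exact h.admissible_iter_leaf k
  | cons b w ih =>
    rcases lt_trichotomy (n + 1) m with hn | hn | hn
    · obtain ⟨i, h1, h2⟩ := h.same n
      have hd := h.iter_gapLeaf_not_isDiag (b :: w) n
      obtain ⟨⟨b', y, hy0, hy1, e⟩, ⟨b'', y', hy0', hy1', e'⟩⟩ := h.gap_end_eq_branch (b :: w)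
      unfold gapLeaf at hd ⊢
      rw [iter_mk, e, e'] at hd ⊢
      exact admissible_of_quarter h.lt h.short (h.image_quarter hn h1 h2 b' hy0 hy1)
        (h.image_quarter hn h1 h2 b'' hy0' hy1') (by simpa using hd)
    · obtain rfl : n = m - 1 := by omega
      obtain ⟨ε, hε, hK, hK', -⟩ := h.dotLeaf_eq
      obtain ⟨g1, g2, g3⟩ := gap_subset hM w
      obtain ⟨K, e⟩ := h.image_last hK hK' b (word (2 ^ m) w (1 / 2 ^ m))
      obtain ⟨K', e'⟩ := h.image_last hK hK' b (word (2 ^ m) w (1 - 1 / 2 ^ m))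
      have hlt := h.lt
      unfold gapLeaf
      rw [iter_mk, word_cons, word_cons, e, e', coe_add_int, coe_add_int]
      refine admissible_of_central (i := if b then 1 - ε else ε) h.lt h.short
        ⟨_, ?_, ?_, rfl⟩ ⟨_, ?_, ?_, rfl⟩ <;> unfold arcPt <;> nlinarith
    · obtain ⟨k, rfl⟩ : ∃ k, n = k + m := ⟨n - m, by omega⟩
      have := h.iter_gapLeaf_append [b] w
      simp only [List.length_singleton, one_mul, List.singleton_append] at this
      rw [iter_add, this]
      exact ih k

end LeafData

/-- The chord over a closed preimage of the arc from `α` to `γ` lies between `Ṡ` and `S̈`. -/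
theorem between_central {α γ : ℝ} (hlt : α < γ) (hsh : γ < α + 1 / 2) (i : ℤ) :
    Between s((((α + i) / 2 : ℝ) : Angle), (((γ + i) / 2 : ℝ) : Angle)) (quarterChord α γ i)
      (quarterChord α γ (i + 1)) := by
  have e1 : ∀ j : ℤ, j = i ∨ j = i + 1 →
      seg s((((α + i) / 2 : ℝ) : Angle), (((γ + i) / 2 : ℝ) : Angle)) ⊆
      {z | side ((γ - 1 + j) / 2) ((α + j) / 2) z ≤ 0} := by
    intro j hj
    refine seg_subset (convex_side_nonpos _ _) fun t ht => side_pt_nonpos (by linarith) ?_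
    rcases hj with rfl | rfl
    · rcases Sym2.mem_iff.1 ht with rfl | rfl
      · exact ⟨_, le_rfl, by linarith, rfl⟩
      · exact ⟨_, by linarith, by linarith, rfl⟩
    · rcases Sym2.mem_iff.1 ht with rfl | rfl
      · exact ⟨(α + i) / 2 + 1, by push_cast; linarith, by push_cast; linarith, coe_add_one _⟩
      · exact ⟨(γ + i) / 2 + 1, by push_cast; linarith, by push_cast; linarith, coe_add_one _⟩
  have hneg : ∀ j : ℤ, ∀ z ∈ (quarterChord α γ (j + 1)).seg,
      z ∉ (quarterChord α γ j).smallPart := by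
    intro j z hz hz'
    have h1 := seg_quarterChord_subset hlt hsh j hz
    have h2 := ((mem_smallPart (by linarith) (by linarith)).1 hz').2
    exact absurd h2 (not_lt.2 (le_of_lt h1))
  have hopp : ∀ j : ℤ, (j = i ∨ j = i + 1) →
      ∀ z ∈ seg s((((α + i) / 2 : ℝ) : Angle), (((γ + i) / 2 : ℝ) : Angle)),
      ¬ (quarterChord α γ j).Opposite z (quarterChord α γ (j + 1)).seg := by
    rintro j hj z hz (⟨h1, -⟩ | ⟨-, h1⟩)
    · have h2 := ((mem_smallPart (by linarith) (by linarith)).1 h1).2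
      exact absurd h2 (not_lt.2 (e1 j hj hz))
    · have := pt_mem_seg (c := quarterChord α γ (j + 1)) (Sym2.mem_mk_left _ _)
      exact hneg j _ this (h1 this)
  have e2 : quarterChord α γ (i + 1 + 1) = quarterChord α γ i := by
    rw [← quarterChord_add_two α γ i 1]; congr 1; ring
  refine ⟨disjoint_seg_quarterChord hlt hsh i, fun z hz => ⟨norm_le_one_of_mem_seg hz,
    hopp i (Or.inl rfl) z hz, ?_⟩, ?_⟩
  · have := hopp (i + 1) (Or.inr rfl) z hz
    rwa [e2] at this
  · set p : ℝ := (α + i) / 2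
    set q : ℝ := (γ + i) / 2
    refine ⟨(1 / 2 : ℝ) • pt (p : Angle) + (1 / 2 : ℝ) • pt (q : Angle), ?_, fun hz => ?_,
      fun hz => ?_⟩
    · rw [seg_mk]
      exact ⟨1 / 2, 1 / 2, by norm_num, by norm_num, by norm_num, rfl⟩
    · have h1 := side_eq_zero_of_mem_seg hz
      rw [side_combo _ _ _ _ (by norm_num), side_pt_right] at h1
      have h2 := side_pt_neg (x := (γ - 1 + i) / 2) (y := (α + i) / 2) (t := (q : Angle))
        (by linarith) ⟨q, by simp only [q]; linarith, by simp only [q]; linarith, rfl⟩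
      linarith
    · have h1 := side_eq_zero_of_mem_seg hz
      have e3 : (q : Angle) = (((γ - 1 + ((i + 1 : ℤ) : ℝ)) / 2 : ℝ) : Angle) := by
        congr 1; push_cast; simp only [q]; ring
      rw [side_combo _ _ _ _ (by norm_num), e3, side_pt_left] at h1
      have h2 := side_pt_neg (x := (γ - 1 + ((i + 1 : ℤ) : ℝ)) / 2) (y := (α + ((i + 1 : ℤ) : ℝ)) / 2)
        (t := (p : Angle)) (by linarith) ⟨p + 1, by simp only [p]; push_cast; linarith,
          by simp only [p]; push_cast; linarith, coe_add_one p⟩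
      linarith

/-! ### Leaves do not enter the critical value gap -/

theorem iter_one_mk (U V : Angle) : iter 1 s(U, V) = s(dbl U, dbl V) := by simp [iter]

/-- Linkedness with a chord in a quarter persists under doubling, provided that the chord bounding
the quarter is not crossed. -/
theorem Linked.push {α γ : ℝ} (hlt : α < γ) (hsh : γ < α + 1 / 2) {R : Chord} {Z W : Angle} {i : ℤ}
    (hZ : Quarter α γ i Z) (hW : Quarter α γ i W) (hR : ¬ Linked R (quarterChord α γ i))
    (hl : Linked R s(Z, W)) : Linked (iter 1 R) s(dbl Z, dbl W) := by
  induction R using Sym2.ind with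
  | _ U V =>
    have key : ClArc ((γ - 1 + i) / 2) ((α + i) / 2) U ∧ ClArc ((γ - 1 + i) / 2) ((α + i) / 2) V := by
      obtain ⟨z, z1, z2, rfl⟩ := hZ
      obtain ⟨w, w1, w2, rfl⟩ := hW
      exact hl.trapped (by linarith) (by linarith) z1 z2 w1 w2 hR
    rw [iter_one_mk]
    exact hl.double (by linarith) key.1 key.2 hZ hW

/-- An admissible chord with an end inside a quarter does not leave this quarter. -/
theorem Admissible.clArc_of_opArc {α γ : ℝ} {U V : Angle} (hsh : γ < α + 1 / 2) (hlt : α < γ)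
    (hR : Admissible α γ s(U, V)) {i : ℤ} (hU : OpArc ((γ - 1 + i) / 2) ((α + i) / 2) U) :
    ClArc ((γ - 1 + i) / 2) ((α + i) / 2) V := by
  rcases clArc_or_opArc ((γ - 1 + i) / 2) ((α + i) / 2) V with h | h
  · exact h
  · exact absurd (linked_of_opArc (by linarith) (by linarith) hU h).symm (hR.2.1 i)

theorem clArc_central_of_eq {α γ : ℝ} (hlt : α < γ) {x y K : ℝ} {η : ℤ} (hy0 : 0 ≤ y) (hy1 : y ≤ 1)
    (hK : ∃ n : ℤ, K = n) (hx : x = (arcPt α γ y + η) / 2 + K) :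
    ClArc ((α + η) / 2) ((γ + η) / 2) (x : Angle) := by
  obtain ⟨n, rfl⟩ := hK
  refine ⟨(arcPt α γ y + η) / 2, ?_, ?_, by rw [hx, coe_add_int]⟩ <;> unfold arcPt <;> nlinarith

/-- A chord that joins the two closed preimages of the arc behind the leaf and is not longer than
`Ṡ` and `S̈` is one of these two. -/
theorem eq_quarterChord_of_length_le {α γ u v : ℝ} {i j : ℤ} (hij : ∃ r : ℤ, j = i + 1 + 2 * r)
    (hu : (α + i) / 2 ≤ u) (hu' : u ≤ (γ + i) / 2) (hv : (α + j) / 2 ≤ v) (hv' : v ≤ (γ + j) / 2)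
    (hlen : dist (u : Angle) (v : Angle) ≤ (1 - (γ - α)) / 2) :
    ∃ k, (s((u : Angle), (v : Angle)) : Chord) = quarterChord α γ k := by
  obtain ⟨r, rfl⟩ := hij
  push_cast at hv hv'
  rw [dist_coe_le_iff] at hlen
  obtain ⟨n, hn⟩ := hlen
  rw [abs_le] at hn
  have h1 : ((n + r : ℤ) : ℝ) < 1 := by push_cast; linarith
  have h2 : ((-2 : ℤ) : ℝ) < ((n + r : ℤ) : ℝ) := by push_cast; linarith
  have h1 : n + r < 1 := by exact_mod_cast h1
  have h2 := Int.cast_lt.1 h2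
  obtain h3 | h3 : n + r = 0 ∨ n + r = -1 := by omega
  · have h3' : (n : ℝ) = -r := by
      have : n = -r := by omega
      rw [this]; push_cast; ring
    rw [h3'] at hn
    have e1 : v = (α + i + 1) / 2 + r := by linarith [hn.1, hn.2]
    have e2 : u = (γ + i) / 2 := by linarith [hn.1, hn.2]
    exact ⟨i + 1, mk_coe_congr ⟨0, by rw [e2]; push_cast; ring⟩ ⟨r, by rw [e1]; push_cast; ring⟩⟩
  · have h3' : (n : ℝ) = -r - 1 := by
      have : n = -r - 1 := by omega
      rw [this]; push_cast; ring
    rw [h3'] at hn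
    have e1 : u = (α + i) / 2 := by linarith [hn.1, hn.2]
    have e2 : v = (γ + i + 1) / 2 + r := by linarith [hn.1, hn.2]
    refine ⟨i, ?_⟩
    rw [Sym2.eq_swap]
    exact mk_coe_congr ⟨r + 1, by rw [e2]; push_cast; ring⟩ ⟨0, by rw [e1]; push_cast; ring⟩

namespace LeafData

variable {m : ℕ} {α γ : ℝ}

/-- The step of the critical gap onto the critical value gap: if an admissible chord is linked with
a chord of the critical gap, then its image is linked with a chord of the critical value gap. -/
theorem linked_last (h : LeafData m α γ) {U V : Angle} (hR : Admissible α γ s(U, V))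
    {z w : Angle} {y₁ y₂ : ℝ} {η₁ η₂ : ℤ} (hy₁ : y₁ ∈ cantor (2 ^ m)) (hy₂ : y₂ ∈ cantor (2 ^ m))
    (hz : ClArc ((α + η₁) / 2) ((γ + η₁) / 2) z) (hw : ClArc ((α + η₂) / 2) ((γ + η₂) / 2) w)
    (hz' : dbl z = (arcPt α γ y₁ : Angle)) (hw' : dbl w = (arcPt α γ y₂ : Angle))
    (hl : Linked s(U, V) s(z, w)) :
    ∃ y₁ ∈ cantor (2 ^ m), ∃ y₂ ∈ cantor (2 ^ m),
      Linked (iter 1 s(U, V)) s((arcPt α γ y₁ : Angle), (arcPt α γ y₂ : Angle)) := by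
  have hlt := h.lt
  have hsh := h.short
  -- the ends of the chord do not lie inside a quarter
  have hno : ∀ {X Y : Angle}, Admissible α γ s(X, Y) → Linked s(X, Y) s(z, w) → ∀ i : ℤ,
      ¬ OpArc ((γ - 1 + i) / 2) ((α + i) / 2) X := by
    intro X Y hA hL i hX
    have hY := hA.clArc_of_opArc hsh hlt hX
    obtain ⟨x, x1, x2, rfl⟩ := hX
    obtain ⟨y, y1, y2, rfl⟩ := hY
    have hcl : ∀ {t : Angle} {η : ℤ}, ClArc ((α + η) / 2) ((γ + η) / 2) t →
        ¬ OpArc ((γ - 1 + i) / 2) ((α + i) / 2) t := fun {t η} h1 h2 =>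
      (opArc_dbl_of_quarter h2).not_clArc (by push_cast; linarith) (by push_cast; linarith)
        ((clArc_add_int 1).2 (clArc_dbl_of_central h1))
    rcases hL.symm.exists_opArc (by linarith) x1.le x2.le y1 y2 with h1 | h1
    · exact hcl hz h1
    · exact hcl hw h1
  have hswapA : Admissible α γ s(V, U) := by rwa [Sym2.eq_swap]
  have hswapL : Linked s(V, U) s(z, w) := by rwa [Sym2.eq_swap]
  obtain ⟨i, hU⟩ := (quarter_or_central α γ U).resolve_left
    fun ⟨i, hi⟩ => hno hR hl i hi
  obtain ⟨j, hV⟩ := (quarter_or_central α γ V).resolve_left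
    fun ⟨i, hi⟩ => hno hswapA hswapL i hi
  obtain ⟨u, hu, hu', rfl⟩ := hU
  obtain ⟨v, hv, hv', rfl⟩ := hV
  rcases Int.emod_two_eq_zero_or_one (j - i) with hij | hij
  · -- both ends lie in the same preimage of the arc
    obtain ⟨r, rfl⟩ : ∃ r, j = i + 2 * r := ⟨(j - i) / 2, by omega⟩
    have key : ∀ u v : ℝ, u < v → (α + i) / 2 ≤ u → v ≤ (γ + i) / 2 →
        Admissible α γ s((u : Angle), (v : Angle)) →
        Linked s((u : Angle), (v : Angle)) s(z, w) →
        ∃ y₁ ∈ cantor (2 ^ m), ∃ y₂ ∈ cantor (2 ^ m),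
        Linked (iter 1 s((u : Angle), (v : Angle)))
          s((arcPt α γ y₁ : Angle), (arcPt α γ y₂ : Angle)) := by
      intro u v huv hu hv hA hL
      obtain ⟨y, hy, hop⟩ : ∃ y ∈ cantor (2 ^ m), OpArc (2 * u) (2 * v) (arcPt α γ y : Angle) := by
        rcases (linked_iff huv (by linarith) z w).1 hL with ⟨h1, -⟩ | ⟨h1, -⟩
        · exact ⟨y₁, hy₁, hz' ▸ opArc_dbl h1⟩
        · exact ⟨y₂, hy₂, hw' ▸ opArc_dbl h1⟩
      rw [iter_one_mk, dbl_coe, dbl_coe]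
      rcases hu.eq_or_lt with hu | hu
      · rcases hv.eq_or_lt with hv | hv
        · exfalso
          subst hu hv
          exact hA.2.2 i (i + 1) (Or.inr rfl) (between_central hlt hsh i) _ (Sym2.mem_mk_left _ _)
            i (Sym2.mem_mk_right _ _)
        · refine ⟨y, hy, 1, one_mem_cantor h.two_lt,
            linked_of_opArc (by linarith) (by linarith) hop ⟨γ + i, by linarith, by linarith, ?_⟩⟩
          rw [coe_add_int]; simp [arcPt]
      · refine ⟨y, hy, 0, zero_mem_cantor h.two_lt,
          linked_of_opArc (by linarith) (by linarith) hop
            ⟨α + i + 1, by linarith, by linarith, ?_⟩⟩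
        rw [coe_add_one, coe_add_int]; simp [arcPt]
    have e : ((v : ℝ) : Angle) = ((v - r : ℝ) : Angle) := (coe_sub_int v r).symm
    push_cast at hv hv'
    rw [e] at hl hR ⊢
    rcases lt_trichotomy u (v - r) with huv | huv | huv
    · exact key u (v - r) huv hu (by linarith) hR hl
    · rw [huv] at hl
      exact absurd rfl hl.symm.not_isDiag_right
    · rw [Sym2.eq_swap] at hl hR ⊢
      exact key (v - r) u huv (by linarith) hu' hR hl
  · exfalso
    obtain ⟨k, hk⟩ := eq_quarterChord_of_length_le (i := i) (j := j) ⟨(j - i) / 2, by omega⟩ hu hu' hv hv' hR.1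
    rw [hk] at hl
    have hcl : ∀ {t : Angle} {η : ℤ}, ClArc ((α + η) / 2) ((γ + η) / 2) t →
        ¬ OpArc ((γ - 1 + k) / 2) ((α + k) / 2) t := fun {t η} h1 h2 =>
      (opArc_dbl_of_quarter h2).not_clArc (by push_cast; linarith) (by push_cast; linarith)
        ((clArc_add_int 1).2 (clArc_dbl_of_central h1))
    rcases (linked_iff (by linarith) (by linarith) z w).1 hl with ⟨h1, -⟩ | ⟨h1, -⟩
    · exact hcl hz h1
    · exact hcl hw h1

/-- No leaf of the generating dynamic lamination is linked with a chord joining two points of an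
iterate of the Cantor set. -/
theorem not_linked_cantor_aux (h : LeafData m α γ) (k : ℕ) : ∀ R : Chord,
    iter k R = s((α : Angle), (γ : Angle)) → (∀ n, Admissible α γ (iter n R)) →
    ∀ s < m, ∀ y₁ ∈ cantor (2 ^ m), ∀ y₂ ∈ cantor (2 ^ m),
    ¬ Linked R s(((2 ^ s * arcPt α γ y₁ : ℝ) : Angle), ((2 ^ s * arcPt α γ y₂ : ℝ) : Angle)) := by
  have hlt := h.lt
  have hsh := h.short
  induction k with
  | zero =>
    intro R hR _ s hs y₁ hy₁ y₂ hy₂ hl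
    have : R = s((α : Angle), (γ : Angle)) := by
      rw [← hR]
      induction R using Sym2.ind with
      | _ x y => simp [iter]
    subst this
    have key : ∀ y ∈ cantor (2 ^ m), OpArc α γ ((2 ^ s * arcPt α γ y : ℝ) : Angle) → s = 0 := by
      intro y hy hop
      by_contra hs0
      obtain ⟨b, y', hy', rfl⟩ := exists_branch_of_mem_cantor h.two_lt hy
      exact h.image_avoid (by omega) hs b hy'.1 hy'.2.1 hop
    have key2 : ∀ y ∈ cantor (2 ^ m), ¬ OpArc γ (α + 1) ((2 ^ 0 * arcPt α γ y : ℝ) : Angle) := by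
      intro y hy hop
      have hc : ClArc α γ (arcPt α γ y : Angle) :=
        ⟨arcPt α γ y, by unfold arcPt; nlinarith [hy.1], by unfold arcPt; nlinarith [hy.2.1], rfl⟩
      rw [pow_zero, one_mul] at hop
      exact hop.not_clArc (by push_cast; linarith) (by push_cast; linarith) ((clArc_add_int 1).2 hc)
    rcases (linked_iff hlt (by linarith) _ _).1 hl with ⟨h1, h2⟩ | ⟨h1, h2⟩
    · have := key _ hy₁ h1
      subst this
      exact key2 _ hy₂ h2
    · have := key _ hy₂ h1
      subst this
      exact key2 _ hy₁ h2
  | succ k ih =>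
    intro R hR hA s hs y₁ hy₁ y₂ hy₂ hl
    have hR' : iter k (iter 1 R) = s((α : Angle), (γ : Angle)) := by rw [← iter_add, hR]
    have hA' : ∀ n, Admissible α γ (iter n (iter 1 R)) := fun n => by
      rw [← iter_add]; exact hA _
    obtain ⟨b₁, y₁', hy₁', rfl⟩ := exists_branch_of_mem_cantor h.two_lt hy₁
    obtain ⟨b₂, y₂', hy₂', rfl⟩ := exists_branch_of_mem_cantor h.two_lt hy₂
    have hA0 : Admissible α γ R := by
      have := hA 0
      induction R using Sym2.ind with
      | _ x y => simpa [iter] using this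
    by_cases hs1 : s + 1 < m
    · obtain ⟨i, h1, h2⟩ := h.same s
      have := hl.push hlt hsh (h.image_quarter hs1 h1 h2 b₁ hy₁'.1 hy₁'.2.1)
        (h.image_quarter hs1 h1 h2 b₂ hy₂'.1 hy₂'.2.1) (hA0.2.1 i)
      rw [dbl_coe, dbl_coe, ← mul_assoc, ← mul_assoc, ← pow_succ'] at this
      exact ih _ hR' hA' (s + 1) hs1 _ hy₁ _ hy₂ this
    · obtain rfl : s = m - 1 := by omega
      obtain ⟨ε, hε, hK, hK', -⟩ := h.dotLeaf_eq
      obtain ⟨K₁, e₁⟩ := h.image_last hK hK' b₁ y₁'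
      obtain ⟨K₂, e₂⟩ := h.image_last hK hK' b₂ y₂'
      have hm : m - 1 + 1 = m := by have := h.one_lt; omega
      have d : ∀ b y, dbl ((2 ^ (m - 1) * arcPt α γ (branch (2 ^ m) b y) : ℝ) : Angle) =
          (arcPt α γ y : Angle) := by
        intro b y
        obtain ⟨N, hN⟩ := h.return_branch b y
        rw [dbl_coe, ← mul_assoc, ← pow_succ', hm, hN, coe_add_int]
      induction R using Sym2.ind with
      | _ U V =>
        obtain ⟨z₁, hz₁, z₂, hz₂, hl'⟩ := h.linked_last hA0 hy₁' hy₂'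
          (clArc_central_of_eq hlt hy₁'.1 hy₁'.2.1 ⟨K₁, rfl⟩ e₁)
          (clArc_central_of_eq hlt hy₂'.1 hy₂'.2.1 ⟨K₂, rfl⟩ e₂) (d b₁ y₁') (d b₂ y₂') hl
        refine ih _ hR' hA' 0 (by omega) _ hz₁ _ hz₂ ?_
        simpa using hl'

theorem not_linked_cantor (h : LeafData m α γ) {R : Chord}
    (hR : R ∈ genLam m s((α : Angle), (γ : Angle))) {y₁ y₂ : ℝ} (hy₁ : y₁ ∈ cantor (2 ^ m))
    (hy₂ : y₂ ∈ cantor (2 ^ m)) :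
    ¬ Linked R s((arcPt α γ y₁ : Angle), (arcPt α γ y₂ : Angle)) := by
  obtain ⟨⟨k, hk⟩, hA⟩ := h.mem_genLam_iff.1 hR
  have := h.not_linked_cantor_aux k R hk hA 0 (by linarith [h.one_lt]) y₁ hy₁ y₂ hy₂
  simpa using this

end LeafData

/-! ### The critical value gap -/

theorem linked_iff_side {x y : ℝ} (hxy : x < y) (hyx : y < x + 1) (Z W : Angle) :
    Linked s((x : Angle), (y : Angle)) s(Z, W) ↔ side x y (pt Z) * side x y (pt W) < 0 := by
  rw [linked_iff hxy hyx, mul_neg_iff]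
  constructor
  · rintro (⟨h1, h2⟩ | ⟨h1, h2⟩)
    · exact Or.inl ⟨side_pt_pos hyx.le h1, side_pt_neg hxy.le h2⟩
    · exact Or.inr ⟨side_pt_neg hxy.le h2, side_pt_pos hyx.le h1⟩
  · rintro (⟨h1, h2⟩ | ⟨h1, h2⟩)
    · exact Or.inl ⟨opArc_of_side_pos hxy.le h1, opArc_of_side_neg hyx.le h2⟩
    · exact Or.inr ⟨opArc_of_side_pos hxy.le h2, opArc_of_side_neg hyx.le h1⟩

/-- The left end of the gap of the Cantor set given by a word, as an angle behind the leaf. -/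
def gapL (m : ℕ) (α γ : ℝ) (w : List Bool) : ℝ := arcPt α γ (word (2 ^ m) w (1 / 2 ^ m))

/-- The right end of the gap of the Cantor set given by a word, as an angle behind the leaf. -/
def gapR (m : ℕ) (α γ : ℝ) (w : List Bool) : ℝ := arcPt α γ (word (2 ^ m) w (1 - 1 / 2 ^ m))

theorem gapLeaf_eq (m : ℕ) (α γ : ℝ) (w : List Bool) :
    gapLeaf m α γ w = s((gapL m α γ w : Angle), (gapR m α γ w : Angle)) := rfl

/-- The interior of the critical value gap: the part of the disk behind the leaf and in front of all
the gap leaves. -/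
def valueGap (m : ℕ) (α γ : ℝ) : Set ℂ :=
  {z | ‖z‖ < 1 ∧ 0 < side α γ z ∧ ∀ w, side (gapL m α γ w) (gapR m α γ w) z < 0}

theorem arcPt_lt_arcPt {α γ : ℝ} (h : α < γ) {x y : ℝ} : arcPt α γ x < arcPt α γ y ↔ x < y := by
  unfold arcPt
  rw [add_lt_add_iff_left, mul_lt_mul_iff_right₀ (by linarith)]

theorem arcPt_le_arcPt {α γ : ℝ} (h : α < γ) {x y : ℝ} : arcPt α γ x ≤ arcPt α γ y ↔ x ≤ y := by
  rw [← not_lt, arcPt_lt_arcPt h, not_lt]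

@[simp] theorem arcPt_zero (α γ : ℝ) : arcPt α γ 0 = α := by simp [arcPt]

@[simp] theorem arcPt_one (α γ : ℝ) : arcPt α γ 1 = γ := by simp [arcPt]

/-- A line through two points does not separate a connected set that misses the chord between
them. -/
theorem side_neg_of_isPreconnected {x y : ℝ} (hxy : x < y) (hyx : y < x + 1) {A : Set ℂ}
    (hA : IsPreconnected A) (hn : ∀ z ∈ A, ‖z‖ ≤ 1)
    (hd : ∀ z ∈ A, z ∉ seg s((x : Angle), (y : Angle))) {z₀ : ℂ} (h0 : z₀ ∈ A)
    (hs : side x y z₀ < 0) : ∀ z ∈ A, side x y z < 0 := by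
  refine hA.subset_left_of_subset_union (u := {z | side x y z < 0}) (v := {z | 0 < side x y z})
    (isOpen_lt (continuous_side x y) continuous_const)
    (isOpen_lt continuous_const (continuous_side x y)) ?_ ?_ ⟨z₀, h0, hs⟩
  · exact Set.disjoint_left.2 fun z (h1 : side x y z < 0) (h2 : 0 < side x y z) => lt_asymm h1 h2
  · intro z hz
    rcases lt_trichotomy (side x y z) 0 with h | h | h
    · exact Or.inl h
    · exact absurd (mem_seg_of_side_eq_zero hxy hyx h (hn z hz)) (hd z hz)
    · exact Or.inr h

theorem side_pos_of_isPreconnected {x y : ℝ} (hxy : x < y) (hyx : y < x + 1) {A : Set ℂ}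
    (hA : IsPreconnected A) (hn : ∀ z ∈ A, ‖z‖ ≤ 1)
    (hd : ∀ z ∈ A, z ∉ seg s((x : Angle), (y : Angle))) {z₀ : ℂ} (h0 : z₀ ∈ A)
    (hs : 0 < side x y z₀) : ∀ z ∈ A, 0 < side x y z := by
  intro z hz
  by_contra h
  rcases (not_lt.1 h).eq_or_lt with h | h
  · exact hd z hz (mem_seg_of_side_eq_zero hxy hyx h (hn z hz))
  · exact absurd (side_neg_of_isPreconnected hxy hyx hA hn hd hz h z₀ h0) (not_lt.2 hs.le)

/-- A point of a line is not interior to a set that has points on one side of it only. -/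
theorem notMem_interior_of_side {x y : ℝ} {G : Set ℂ} {s c : ℂ} (hs : side x y s = 0)
    (hG : ∀ z ∈ G, 0 ≤ side x y c * side x y z) (hc : side x y c ≠ 0) : s ∉ interior G := by
  intro hi
  have hcont : Filter.Tendsto (fun t : ℝ => (1 + t) • s + (-t) • c) (nhdsWithin 0 (Set.Ioi 0))
      (nhds s) := by
    have : Continuous (fun t : ℝ => (1 + t) • s + (-t) • c) := by fun_prop
    have h0 := this.tendsto 0
    simp only [add_zero, one_smul, neg_zero, zero_smul] at h0
    exact h0.mono_left nhdsWithin_le_nhds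
  obtain ⟨t, ht, ht'⟩ := ((hcont.eventually (isOpen_interior.mem_nhds hi)).and
    self_mem_nhdsWithin).exists
  have h1 := hG _ (interior_subset ht)
  rw [side_combo x y s c (by ring), hs] at h1
  have h2 : 0 < side x y c * side x y c := mul_self_pos.2 hc
  have h3 : (0 : ℝ) < t := ht'
  nlinarith

namespace LeafData

variable {m : ℕ} {α γ : ℝ}

theorem gap_bounds (h : LeafData m α γ) (w : List Bool) : α < gapL m α γ w ∧
    gapL m α γ w < gapR m α γ w ∧ gapR m α γ w < γ ∧ gapR m α γ w < gapL m α γ w + 1 / 2 := by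
  obtain ⟨h1, h2, h3⟩ := gap_subset h.two_lt w
  have e1 := (arcPt_lt_arcPt h.lt).2 h1
  have e2 := (arcPt_lt_arcPt h.lt).2 h2
  have e3 := (arcPt_lt_arcPt h.lt).2 h3
  rw [arcPt_zero] at e1
  rw [arcPt_one] at e3
  have := h.short
  exact ⟨e1, e2, e3, by unfold gapL gapR; linarith⟩

theorem clArc_gap (h : LeafData m α γ) {y : ℝ} (hy : y ∈ cantor (2 ^ m)) (w : List Bool) :
    ClArc (gapR m α γ w) (gapL m α γ w + 1) (arcPt α γ y : Angle) := by
  have hlt := h.lt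
  have hsh := h.short
  have hb := h.gap_bounds w
  have h0 := (arcPt_le_arcPt hlt).2 hy.1
  have h1 := (arcPt_le_arcPt hlt).2 hy.2.1
  rw [arcPt_zero] at h0
  rw [arcPt_one] at h1
  have := hy.2.2 w
  rw [not_and_or, not_lt, not_lt] at this
  rcases this with h2 | h2
  · have h3 : arcPt α γ y ≤ gapL m α γ w := (arcPt_le_arcPt hlt).2 h2
    exact ⟨arcPt α γ y + 1, by linarith, by linarith, coe_add_one _⟩
  · have h3 : gapR m α γ w ≤ arcPt α γ y := (arcPt_le_arcPt hlt).2 h2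
    exact ⟨arcPt α γ y, h3, by linarith, rfl⟩

theorem clArc_leaf (h : LeafData m α γ) {y : ℝ} (hy : y ∈ cantor (2 ^ m)) :
    ClArc α γ (arcPt α γ y : Angle) := by
  have h0 := (arcPt_le_arcPt h.lt).2 hy.1
  have h1 := (arcPt_le_arcPt h.lt).2 hy.2.1
  rw [arcPt_zero] at h0
  rw [arcPt_one] at h1
  exact ⟨arcPt α γ y, h0, h1, rfl⟩

/-- The complement of the Cantor set consists of the arc in front of the leaf and the gaps. -/
theorem cases_angle (h : LeafData m α γ) (t : Angle) : OpArc γ (α + 1) t ∨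
    (∃ w, OpArc (gapL m α γ w) (gapR m α γ w) t) ∨
    ∃ y ∈ cantor (2 ^ m), t = (arcPt α γ y : Angle) := by
  have hlt := h.lt
  rcases clArc_or_opArc α γ t with ⟨r, h1, h2, rfl⟩ | h1
  · right
    have hr : r = arcPt α γ ((r - α) / (γ - α)) := by
      unfold arcPt; field_simp [(by linarith : γ - α ≠ 0)]; ring
    by_cases hc : (r - α) / (γ - α) ∈ cantor (2 ^ m)
    · exact Or.inr ⟨_, hc, by rw [← hr]⟩
    · left
      by_contra! hw
      refine hc ⟨div_nonneg (by linarith) (by linarith), (div_le_one (by linarith)).2 (by linarith),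
        fun w ⟨h3, h4⟩ => hw w ⟨r, ?_, ?_, rfl⟩⟩
      · rw [hr]; exact (arcPt_lt_arcPt hlt).2 h3
      · rw [hr]; exact (arcPt_lt_arcPt hlt).2 h4
  · exact Or.inl h1

/-- A chord joining two points of the Cantor set that is not linked with any other such chord is
degenerate, the leaf itself or a gap leaf. -/
theorem eq_of_not_linked (h : LeafData m α γ) {y₁ y₂ : ℝ} (hy₁ : y₁ ∈ cantor (2 ^ m))
    (hy₂ : y₂ ∈ cantor (2 ^ m))
    (hl : ∀ z₁ ∈ cantor (2 ^ m), ∀ z₂ ∈ cantor (2 ^ m),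
      ¬ Linked s((arcPt α γ y₁ : Angle), (arcPt α γ y₂ : Angle))
        s((arcPt α γ z₁ : Angle), (arcPt α γ z₂ : Angle))) :
    y₁ = y₂ ∨ (s((arcPt α γ y₁ : Angle), (arcPt α γ y₂ : Angle)) : Chord) = s((α : Angle), (γ : Angle)) ∨
      ∃ w, s((arcPt α γ y₁ : Angle), (arcPt α γ y₂ : Angle)) = gapLeaf m α γ w := by
  wlog hlt : y₁ < y₂ generalizing y₁ y₂
  · rcases (not_lt.1 hlt).eq_or_lt with h1 | h1
    · exact Or.inl h1.symm
    · have := this hy₂ hy₁ (fun z₁ h1 z₂ h2 => by rw [Sym2.eq_swap]; exact hl z₁ h1 z₂ h2) h1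
      rw [Sym2.eq_swap]
      exact this.imp_left Eq.symm
  right
  have hM := h.two_lt
  have hαγ := h.lt
  have hsh := h.short
  have hb : ∀ y ∈ cantor (2 ^ m), α ≤ arcPt α γ y ∧ arcPt α γ y ≤ γ := fun y hy => by
    have h0 := (arcPt_le_arcPt h.lt).2 hy.1
    have h1 := (arcPt_le_arcPt h.lt).2 hy.2.1
    rw [arcPt_zero] at h0
    rw [arcPt_one] at h1
    exact ⟨h0, h1⟩
  have hP := (arcPt_lt_arcPt hαγ).2 hlt
  by_cases hmid : ∃ c ∈ cantor (2 ^ m), y₁ < c ∧ c < y₂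
  · left
    obtain ⟨c, hc, h1, h2⟩ := hmid
    have h1' := (arcPt_lt_arcPt hαγ).2 h1
    have h2' := (arcPt_lt_arcPt hαγ).2 h2
    have hbc := hb c hc
    have hb1 := hb y₁ hy₁
    have hb2 := hb y₂ hy₂
    have e0 : y₁ = 0 := by
      by_contra hne
      have := (arcPt_lt_arcPt hαγ).2 (lt_of_le_of_ne hy₁.1 (Ne.symm hne))
      refine hl c hc 0 (zero_mem_cantor hM) ((linked_iff hP (by linarith) _ _).2 (Or.inl
        ⟨⟨_, h1', h2', rfl⟩, ⟨arcPt α γ 0 + 1, ?_, by linarith, coe_add_one _⟩⟩))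
      rw [arcPt_zero]; linarith
    have e1 : y₂ = 1 := by
      by_contra hne
      have := (arcPt_lt_arcPt hαγ).2 (lt_of_le_of_ne hy₂.2.1 hne)
      refine hl c hc 1 (one_mem_cantor hM) ((linked_iff hP (by linarith) _ _).2 (Or.inl
        ⟨⟨_, h1', h2', rfl⟩, ⟨arcPt α γ 1, by linarith, ?_, rfl⟩⟩))
      rw [arcPt_one]; linarith
    rw [e0, e1, arcPt_zero, arcPt_one]
  · right
    push Not at hmid
    have : ¬ ((y₁ + y₂) / 2 ∈ cantor (2 ^ m)) := fun hc => by
      have := hmid _ hc (by linarith)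
      linarith
    have h3 : ∃ w, word (2 ^ m) w (1 / 2 ^ m) < (y₁ + y₂) / 2 ∧
        (y₁ + y₂) / 2 < word (2 ^ m) w (1 - 1 / 2 ^ m) := by
      by_contra! h4
      exact this ⟨by linarith [hy₁.1], by linarith [hy₂.2.1], fun w hw => by linarith [h4 w hw.1]⟩
    obtain ⟨w, h4, h5⟩ := h3
    refine ⟨w, ?_⟩
    have f1 : word (2 ^ m) w (1 / 2 ^ m) = y₁ := by
      apply le_antisymm
      · by_contra! h6
        linarith [hmid _ (gap_left_mem_cantor hM w) h6]
      · by_contra! h6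
        exact hy₁.2.2 w ⟨h6, by linarith⟩
    have f2 : word (2 ^ m) w (1 - 1 / 2 ^ m) = y₂ := by
      apply le_antisymm
      · by_contra! h6
        exact hy₂.2.2 w ⟨by linarith, h6⟩
      · by_contra! h6
        linarith [hmid _ (gap_right_mem_cantor hM w) (by linarith)]
    unfold gapLeaf
    rw [f1, f2]

/-- Limits of leaves are not linked with chords joining points of the Cantor set either. -/
theorem not_linked_cantor_of_mem_dynLam (h : LeafData m α γ) {R : Chord}
    (hR : R ∈ dynLam m s((α : Angle), (γ : Angle))) {y₁ y₂ : ℝ} (hy₁ : y₁ ∈ cantor (2 ^ m))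
    (hy₂ : y₂ ∈ cantor (2 ^ m)) :
    ¬ Linked R s((arcPt α γ y₁ : Angle), (arcPt α γ y₂ : Angle)) := by
  rcases hR with hR | ⟨-, hR⟩
  · exact h.not_linked_cantor hR hy₁ hy₂
  intro hl
  wlog hlt : y₁ < y₂ generalizing y₁ y₂
  · rcases (not_lt.1 hlt).eq_or_lt with h1 | h1
    · rw [h1] at hl
      exact hl.not_isDiag_right rfl
    · rw [Sym2.eq_swap] at hl
      exact this hy₂ hy₁ hl h1
  obtain ⟨a, b, x, y, hab, -, ha, hb, rfl⟩ := hR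
  have h0 := (arcPt_le_arcPt h.lt).2 hy₁.1
  have h1 := (arcPt_le_arcPt h.lt).2 hy₂.2.1
  rw [arcPt_zero] at h0
  rw [arcPt_one] at h1
  have hlt' := (arcPt_lt_arcPt h.lt).2 hlt
  have hsh := h.short
  have hiff := fun Z W => linked_iff_side hlt' (show arcPt α γ y₂ < arcPt α γ y₁ + 1 by linarith) Z W
  have hside := (continuous_side (arcPt α γ y₁) (arcPt α γ y₂)).comp continuous_pt
  have hlim := ((hside.tendsto x).comp ha).mul ((hside.tendsto y).comp hb)
  obtain ⟨n, hn⟩ := (hlim.eventually (gt_mem_nhds ((hiff x y).1 hl.symm))).exists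
  exact h.not_linked_cantor (hab n) hy₁ hy₂ ((hiff _ _).2 hn).symm

/-- Every leaf of the dynamic lamination lies in front of the leaf, behind a gap leaf, or is one of
these. -/
theorem dynLam_cases (h : LeafData m α γ) {R : Chord}
    (hR : R ∈ dynLam m s((α : Angle), (γ : Angle))) :
    (∀ z ∈ R.seg, side α γ z ≤ 0) ∧ (∃ t ∈ R, OpArc γ (α + 1) t) ∨
    (∃ w, (∀ z ∈ R.seg, 0 ≤ side (gapL m α γ w) (gapR m α γ w) z) ∧
      ∃ t ∈ R, OpArc (gapL m α γ w) (gapR m α γ w) t) ∨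
    R.IsDiag ∨ R = s((α : Angle), (γ : Angle)) ∨ ∃ w, R = gapLeaf m α γ w := by
  have hlt := h.lt
  have hsh := h.short
  have hM := h.two_lt
  have hno := fun y₁ (hy₁ : y₁ ∈ cantor (2 ^ m)) y₂ (hy₂ : y₂ ∈ cantor (2 ^ m)) =>
    h.not_linked_cantor_of_mem_dynLam hR hy₁ hy₂
  have hS : ¬ Linked s((α : Angle), (γ : Angle)) R := fun hl => by
    have := hno 0 (zero_mem_cantor hM) 1 (one_mem_cantor hM)
    rw [arcPt_zero, arcPt_one] at this
    exact this hl.symm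
  have hW : ∀ w, ¬ Linked s((gapL m α γ w : Angle), (gapR m α γ w : Angle)) R := fun w hl =>
    hno _ (gap_left_mem_cantor hM w) _ (gap_right_mem_cantor hM w) hl.symm
  by_cases h1 : ∃ t ∈ R, OpArc γ (α + 1) t
  · left
    refine ⟨?_, h1⟩
    obtain ⟨t, ht, ht'⟩ := h1
    obtain ⟨u, rfl⟩ := ht
    refine seg_subset (convex_side_nonpos α γ) fun v hv => ?_
    rcases Sym2.mem_iff.1 hv with rfl | rfl
    · exact (side_pt_neg hlt.le ht').le
    · change side α γ (pt v) ≤ 0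
      by_contra! h2
      exact hS ((linked_iff hlt (by linarith) _ _).2 (Or.inr ⟨opArc_of_side_pos hlt.le h2, ht'⟩))
  · right
    by_cases h2 : ∃ w, ∃ t ∈ R, OpArc (gapL m α γ w) (gapR m α γ w) t
    · left
      obtain ⟨w, t, ht, ht'⟩ := h2
      refine ⟨w, ?_, t, ht, ht'⟩
      obtain ⟨u, rfl⟩ := ht
      have hb := h.gap_bounds w
      refine seg_subset (convex_side_nonneg _ _) fun v hv => ?_
      rcases Sym2.mem_iff.1 hv with rfl | rfl
      · exact (side_pt_pos (by linarith) ht').le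
      · change 0 ≤ side (gapL m α γ w) (gapR m α γ w) (pt v)
        by_contra! h2
        exact hW w ((linked_iff hb.2.1 (by linarith) _ _).2
          (Or.inl ⟨ht', opArc_of_side_neg (by linarith) h2⟩))
    · right
      push Not at h1 h2
      induction R using Sym2.ind with
      | _ U V =>
        obtain ⟨y₁, hy₁, rfl⟩ := ((h.cases_angle U).resolve_left
          (h1 _ (Sym2.mem_mk_left _ _))).resolve_left fun ⟨w, hw⟩ => h2 w _ (Sym2.mem_mk_left _ _) hw
        obtain ⟨y₂, hy₂, rfl⟩ := ((h.cases_angle V).resolve_left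
          (h1 _ (Sym2.mem_mk_right _ _))).resolve_left fun ⟨w, hw⟩ => h2 w _ (Sym2.mem_mk_right _ _) hw
        rcases h.eq_of_not_linked hy₁ hy₂ fun z₁ h3 z₂ h4 => hno z₁ h3 z₂ h4 with rfl | h3 | h3
        · exact Or.inl rfl
        · exact Or.inr (Or.inl h3)
        · exact Or.inr (Or.inr h3)

theorem not_isDiag_of_mem_dynLam (h : LeafData m α γ) {R : Chord}
    (hR : R ∈ dynLam m s((α : Angle), (γ : Angle))) : ¬ R.IsDiag := by
  rcases hR with hR | hR
  · obtain ⟨⟨n, hn⟩, -⟩ := h.mem_genLam_iff.1 hR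
    exact not_isDiag_of_iter n (by rw [hn]; exact h.not_isDiag)
  · exact hR.1

theorem valueGap_subset (h : LeafData m α γ) :
    valueGap m α γ ⊆ leafComplement m s((α : Angle), (γ : Angle)) := by
  rintro z ⟨h1, h2, h3⟩
  refine ⟨h1, fun R hR hz => ?_⟩
  rcases h.dynLam_cases hR with ⟨h4, -⟩ | ⟨w, h4, -⟩ | h4 | rfl | ⟨w, rfl⟩
  · exact absurd (h4 z hz) (not_le.2 h2)
  · exact absurd (h4 z hz) (not_le.2 (h3 w))
  · exact h.not_isDiag_of_mem_dynLam hR h4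
  · exact h2.ne' (side_eq_zero_of_mem_seg hz)
  · exact (h3 w).ne (side_eq_zero_of_mem_seg hz)

theorem convex_valueGap : Convex ℝ (valueGap m α γ) := by
  have : valueGap m α γ = Metric.ball 0 1 ∩ {z | 0 < side α γ z} ∩
      ⋂ w, {z | side (gapL m α γ w) (gapR m α γ w) z < 0} := by
    ext z
    simp [valueGap, and_assoc]
  rw [this]
  exact ((convex_ball _ _).inter (convex_side_pos _ _)).inter
    (convex_iInter fun w => convex_side_neg _ _)

theorem valueGap_nonempty (h : LeafData m α γ) : (valueGap m α γ).Nonempty := by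
  have hM := h.two_lt
  have hlt := h.lt
  have hsh := h.short
  obtain ⟨e1, e2, e3, e4, h2, h3, h4⟩ := branch_zero_one hM
  have hc := gap_left_mem_cantor hM []
  rw [word_nil] at hc
  have hb0 := (arcPt_lt_arcPt hlt).2 h2
  have hb1 := (arcPt_lt_arcPt hlt).2 (h3.trans h4)
  rw [arcPt_zero] at hb0
  rw [arcPt_one] at hb1
  set β := arcPt α γ (1 / 2 ^ m) with hβ
  have hne : pt (α : Angle) ≠ pt (γ : Angle) := fun he => by
    have := eq_of_coe_eq (pt_injective he) (by linarith) (by linarith)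
    linarith
  have hz := zero_mem_cantor hM
  have ho := one_mem_cantor hM
  refine ⟨(1 / 2 : ℝ) • ((1 / 2 : ℝ) • pt (α : Angle) + (1 / 2 : ℝ) • pt (γ : Angle)) +
    (1 / 2 : ℝ) • pt (β : Angle), ?_, ?_, fun w => ?_⟩
  · have h5 : ‖(1 / 2 : ℝ) • pt (α : Angle) + (1 / 2 : ℝ) • pt (γ : Angle)‖ < 1 :=
      norm_combo_lt_of_ne (norm_pt _).le (norm_pt _).le hne (by norm_num) (by norm_num) (by norm_num)
    refine (norm_add_le _ _).trans_lt ?_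
    rw [norm_smul, norm_smul, norm_pt, Real.norm_of_nonneg (by norm_num)]
    linarith
  · rw [side_combo _ _ _ _ (by norm_num), side_combo _ _ _ _ (by norm_num), side_pt_left,
      side_pt_right]
    have := side_pt_pos (x := α) (y := γ) (by linarith) ⟨β, hb0, hb1, rfl⟩
    linarith
  · rw [side_combo _ _ _ _ (by norm_num), side_combo _ _ _ _ (by norm_num)]
    have hb := h.gap_bounds w
    have h6 := side_pt_nonpos hb.2.1.le (h.clArc_gap hc w)
    have h7 := side_pt_neg (t := (α : Angle)) hb.2.1.le ⟨α + 1, by linarith, by linarith, coe_add_one α⟩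
    have h8 := side_pt_neg (t := (γ : Angle)) hb.2.1.le ⟨γ, by linarith, by linarith, rfl⟩
    linarith

/-- The critical value gap is a component of the complement of the leaves. -/
theorem connectedComponentIn_eq (h : LeafData m α γ) {z : ℂ} (hz : z ∈ valueGap m α γ) :
    connectedComponentIn (leafComplement m s((α : Angle), (γ : Angle))) z = valueGap m α γ := by
  have hlt := h.lt
  have hsh := h.short
  apply Set.Subset.antisymm
  · intro u hu
    have hsub := connectedComponentIn_subset (leafComplement m s((α : Angle), (γ : Angle))) z
    have hpre := isPreconnected_connectedComponentIn
      (F := leafComplement m s((α : Angle), (γ : Angle))) (x := z)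
    have hmem := mem_connectedComponentIn (h.valueGap_subset hz)
    refine ⟨(hsub hu).1, ?_, fun w => ?_⟩
    · exact side_pos_of_isPreconnected hlt (by linarith) hpre (fun v hv => (hsub hv).1.le)
        (fun v hv => (hsub hv).2 _ (Or.inl h.leaf_mem_genLam)) hmem hz.2.1 u hu
    · have hb := h.gap_bounds w
      exact side_neg_of_isPreconnected hb.2.1 (by linarith) hpre (fun v hv => (hsub hv).1.le)
        (fun v hv => (hsub hv).2 _ (Or.inl (h.gapLeaf_mem_genLam w))) hmem (hz.2.2 w) u hu
  · exact convex_valueGap.isPreconnected.subset_connectedComponentIn hz h.valueGap_subset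

theorem closure_valueGap {z : ℂ} (hz : z ∈ closure (valueGap m α γ)) :
    0 ≤ side α γ z ∧ ∀ w, side (gapL m α γ w) (gapR m α γ w) z ≤ 0 := by
  constructor
  · exact closure_minimal (fun z hz => hz.2.1.le)
      (isClosed_le continuous_const (continuous_side α γ)) hz
  · intro w
    exact closure_minimal (fun z hz => (hz.2.2 w).le)
      (isClosed_le (continuous_side _ _) continuous_const) hz

/-- Points on chords of the Cantor set become points of the open gap when they are moved towards one
of its points, provided that they do not leave the leaf or the gap leaves behind. -/
theorem combo_mem_valueGap {s c : ℂ} (hc : c ∈ valueGap m α γ) (hs : ‖s‖ ≤ 1)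
    (hs0 : 0 ≤ side α γ s) (hsw : ∀ w, side (gapL m α γ w) (gapR m α γ w) s ≤ 0) {t : ℝ}
    (ht0 : 0 < t) (ht1 : t ≤ 1) : (1 - t) • s + t • c ∈ valueGap m α γ := by
  obtain ⟨h1, h2, h3⟩ := hc
  refine ⟨(norm_add_le _ _).trans_lt ?_, ?_, fun w => ?_⟩
  · rw [norm_smul, norm_smul, Real.norm_of_nonneg (by linarith), Real.norm_of_nonneg ht0.le]
    nlinarith
  · rw [side_combo _ _ _ _ (by ring)]
    nlinarith
  · rw [side_combo _ _ _ _ (by ring)]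
    have := h3 w
    nlinarith [hsw w]

theorem mem_closure_valueGap (h : LeafData m α γ) {s : ℂ} (hs : ‖s‖ ≤ 1)
    (hs0 : 0 ≤ side α γ s) (hsw : ∀ w, side (gapL m α γ w) (gapR m α γ w) s ≤ 0) :
    s ∈ closure (valueGap m α γ) := by
  obtain ⟨c, hc⟩ := h.valueGap_nonempty
  have hcont : Filter.Tendsto (fun t : ℝ => (1 - t) • s + t • c) (nhdsWithin 0 (Set.Ioi 0))
      (nhds s) := by
    have : Continuous (fun t : ℝ => (1 - t) • s + t • c) := by fun_prop
    have h0 := this.tendsto 0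
    simp only [sub_zero, one_smul, zero_smul, add_zero] at h0
    exact h0.mono_left nhdsWithin_le_nhds
  refine mem_closure_of_tendsto hcont ?_
  filter_upwards [Ioc_mem_nhdsGT (zero_lt_one' ℝ)] with t ht
  exact combo_mem_valueGap hc hs hs0 hsw ht.1 ht.2

theorem seg_cantor_subset (h : LeafData m α γ) {y₁ y₂ : ℝ} (hy₁ : y₁ ∈ cantor (2 ^ m))
    (hy₂ : y₂ ∈ cantor (2 ^ m)) :
    seg s((arcPt α γ y₁ : Angle), (arcPt α γ y₂ : Angle)) ⊆ closure (valueGap m α γ) := by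
  have hlt := h.lt
  have hsh := h.short
  have hy : ∀ t ∈ (s((arcPt α γ y₁ : Angle), (arcPt α γ y₂ : Angle)) : Chord),
      ∃ y ∈ cantor (2 ^ m), t = (arcPt α γ y : Angle) := fun t ht => by
    rcases Sym2.mem_iff.1 ht with rfl | rfl
    exacts [⟨_, hy₁, rfl⟩, ⟨_, hy₂, rfl⟩]
  intro s hs
  refine h.mem_closure_valueGap (norm_le_one_of_mem_seg hs) ?_ fun w => ?_
  · refine seg_subset (convex_side_nonneg α γ) (fun t ht => ?_) hs
    obtain ⟨y, hy, rfl⟩ := hy t ht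
    exact side_pt_nonneg (by linarith) (h.clArc_leaf hy)
  · refine seg_subset (convex_side_nonpos _ _) (fun t ht => ?_) hs
    obtain ⟨y, hy, rfl⟩ := hy t ht
    exact side_pt_nonpos (h.gap_bounds w).2.1.le (h.clArc_gap hy w)

theorem leaf_isBoundaryLeaf (h : LeafData m α γ) : IsBoundaryLeaf m s((α : Angle), (γ : Angle))
    (closure (valueGap m α γ)) s((α : Angle), (γ : Angle)) := by
  have hM := h.two_lt
  obtain ⟨c, hc⟩ := h.valueGap_nonempty
  refine ⟨Or.inl h.leaf_mem_genLam, fun s hs => ⟨?_, ?_⟩⟩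
  · have := h.seg_cantor_subset (zero_mem_cantor hM) (one_mem_cantor hM)
    rw [arcPt_zero, arcPt_one] at this
    exact subset_closure (this hs)
  · exact notMem_interior_of_side (c := c) (side_eq_zero_of_mem_seg hs)
      (fun z hz => mul_nonneg hc.2.1.le (closure_valueGap hz).1) hc.2.1.ne'

theorem gapLeaf_isBoundaryLeaf (h : LeafData m α γ) (w : List Bool) :
    IsBoundaryLeaf m s((α : Angle), (γ : Angle)) (closure (valueGap m α γ)) (gapLeaf m α γ w) := by
  have hM := h.two_lt
  obtain ⟨c, hc⟩ := h.valueGap_nonempty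
  refine ⟨Or.inl (h.gapLeaf_mem_genLam w), fun s hs => ⟨?_, ?_⟩⟩
  · exact subset_closure
      (h.seg_cantor_subset (gap_left_mem_cantor hM w) (gap_right_mem_cantor hM w) hs)
  · exact notMem_interior_of_side (c := c) (side_eq_zero_of_mem_seg hs)
      (fun z hz => mul_nonneg_of_nonpos_of_nonpos (hc.2.2 w).le ((closure_valueGap hz).2 w))
      (hc.2.2 w).ne

/-- The boundary leaves of the critical value gap are the leaf and the gap leaves. -/
theorem eq_of_isBoundaryLeaf (h : LeafData m α γ) {R : Chord}
    (hR : IsBoundaryLeaf m s((α : Angle), (γ : Angle)) (closure (valueGap m α γ)) R) :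
    R = s((α : Angle), (γ : Angle)) ∨ ∃ w, R = gapLeaf m α γ w := by
  have hlt := h.lt
  have hsh := h.short
  have hin : ∀ t ∈ R, pt t ∈ closure (valueGap m α γ) := fun t ht => by
    have := frontier_subset_closure (hR.2 (pt_mem_seg ht))
    rwa [closure_closure] at this
  rcases h.dynLam_cases hR.1 with ⟨-, t, ht, h1⟩ | ⟨w, -, t, ht, h1⟩ | h4 | h4
  · exact absurd (closure_valueGap (hin t ht)).1 (not_le.2 (side_pt_neg hlt.le h1))
  · exact absurd ((closure_valueGap (hin t ht)).2 w)
      (not_le.2 (side_pt_pos (by linarith [h.gap_bounds w]) h1))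
  · exact absurd h4 (h.not_isDiag_of_mem_dynLam hR.1)
  · exact h4

theorem gapLeaf_inj (h : LeafData m α γ) {v w : List Bool} (he : gapLeaf m α γ v = gapLeaf m α γ w) :
    word (2 ^ m) v (1 / 2 ^ m) = word (2 ^ m) w (1 / 2 ^ m) ∧
      word (2 ^ m) v (1 - 1 / 2 ^ m) = word (2 ^ m) w (1 - 1 / 2 ^ m) := by
  have hv := h.gap_bounds v
  have hw := h.gap_bounds w
  have hlt := h.lt
  have hsh := h.short
  have hinj : ∀ {x y : ℝ}, arcPt α γ x = arcPt α γ y → x = y := fun {x y} e => by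
    apply le_antisymm
    · exact (arcPt_le_arcPt hlt).1 e.le
    · exact (arcPt_le_arcPt hlt).1 e.ge
  rw [gapLeaf_eq, gapLeaf_eq, Sym2.eq_iff] at he
  rcases he with ⟨h1, h2⟩ | ⟨h1, h2⟩
  · exact ⟨hinj (eq_of_coe_eq h1 (by unfold gapL gapR at *; linarith) (by unfold gapL gapR at *; linarith)),
      hinj (eq_of_coe_eq h2 (by unfold gapL gapR at *; linarith) (by unfold gapL gapR at *; linarith))⟩
  · have e1 := eq_of_coe_eq h1 (by linarith) (by linarith)
    have e2 := eq_of_coe_eq h2 (by linarith) (by linarith)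
    linarith

theorem infinite_boundaryLeaves (h : LeafData m α γ) :
    {R | IsBoundaryLeaf m s((α : Angle), (γ : Angle)) (closure (valueGap m α γ)) R}.Infinite := by
  refine Set.infinite_of_injective_forall_mem (f := fun n : ℕ => gapLeaf m α γ (List.replicate n false))
    (fun i j hij => ?_) fun n => h.gapLeaf_isBoundaryLeaf _
  have hM := h.two_lt
  have e : ∀ n : ℕ, word (2 ^ m) (List.replicate n false) (1 / 2 ^ m) = (1 / 2 ^ m) ^ (n + 1) := by
    intro n
    induction n with
    | zero => simp
    | succ n ih => rw [List.replicate_succ, word_cons, ih, branch_false]; ring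
  have h1 := (h.gapLeaf_inj hij).1
  rw [e, e] at h1
  have := pow_right_injective₀ (a := (1 : ℝ) / 2 ^ m) (by positivity)
    (by rw [Ne, div_eq_iff (by positivity)]; linarith) h1
  omega

theorem isCriticalValueGap (h : LeafData m α γ) :
    IsCriticalValueGap m s((α : Angle), (γ : Angle)) (closure (valueGap m α γ)) := by
  have hlt := h.lt
  have hsh := h.short
  obtain ⟨c, hc⟩ := h.valueGap_nonempty
  refine ⟨⟨⟨c, h.valueGap_subset hc, by rw [h.connectedComponentIn_eq hc]⟩,
    h.infinite_boundaryLeaves⟩, h.leaf_isBoundaryLeaf, ⟨c, subset_closure hc, ?_⟩, fun z hz => ?_⟩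
  · exact (mem_smallPart hlt hsh).2 ⟨hc.1.le, hc.2.1⟩
  · rw [mem_bigPart hlt hsh]
    exact fun h1 => absurd (closure_valueGap hz).1 (not_le.2 h1.2)

/-- Close to the middle of the leaf there are no other leaves behind it. -/
theorem eventually_mem_valueGap (h : LeafData m α γ) :
    ∃ s ∈ seg s((α : Angle), (γ : Angle)), ∀ᶠ z in nhds s, 0 < side α γ z → z ∈ valueGap m α γ := by
  have hlt := h.lt
  have hsh := h.short
  have hM := h.two_lt
  have hne : pt (α : Angle) ≠ pt (γ : Angle) := fun he => by
    have := eq_of_coe_eq (pt_injective he) (by linarith) (by linarith)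
    linarith
  obtain ⟨c, hc⟩ := h.valueGap_nonempty
  have hc0 := hc.2.1
  set s : ℂ := (1 / 2 : ℝ) • pt (α : Angle) + (1 / 2 : ℝ) • pt (γ : Angle) with hs_def
  have hs1 : ‖s‖ < 1 :=
    norm_combo_lt_of_ne (norm_pt _).le (norm_pt _).le hne (by norm_num) (by norm_num) (by norm_num)
  have hs : s ∈ seg s((α : Angle), (γ : Angle)) := by
    rw [seg_mk]
    exact ⟨1 / 2, 1 / 2, by norm_num, by norm_num, by norm_num, rfl⟩
  have hs0 : side α γ s = 0 := side_eq_zero_of_mem_seg hs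
  refine ⟨s, hs, ?_⟩
  -- `z` is projected from `c` to the leaf
  set l : ℂ → ℝ := fun z => side α γ z / side α γ c with hl
  have hlc : Continuous l := (continuous_side α γ).div_const _
  have hl0 : l s = 0 := by simp [hl, hs0]
  have h1 : ∀ᶠ z in nhds s, l z < 1 := hlc.continuousAt.eventually (gt_mem_nhds (by rw [hl0]; norm_num))
  have h2 : ∀ᶠ z in nhds s, ‖(1 - l z)⁻¹ • (z - l z • c)‖ < 1 := by
    have hcont : ContinuousAt (fun z => ‖(1 - l z)⁻¹ • (z - l z • c)‖) s := by
      have : 1 - l s ≠ 0 := by rw [hl0]; norm_num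
      have := hlc.continuousAt (x := s)
      fun_prop (disch := assumption)
    exact hcont.eventually (gt_mem_nhds (by simpa [hl0] using hs1))
  filter_upwards [h1, h2] with z h1 h2 h3
  set p := (1 - l z)⁻¹ • (z - l z • c) with hp
  have hne : 1 - l z ≠ 0 := by linarith
  have hz : z = (1 - l z) • p + l z • c := by
    rw [hp, smul_smul, mul_inv_cancel₀ hne, one_smul, sub_add_cancel]
  have hps : side α γ p = 0 := by
    have e1 : side α γ z = (1 - l z) * side α γ p + l z * side α γ c := by
      conv_lhs => rw [hz]
      exact side_combo _ _ _ _ (by ring)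
    have e2 : l z * side α γ c = side α γ z := div_mul_cancel₀ _ hc0.ne'
    have e3 : (1 - l z) * side α γ p = 0 := by linarith
    exact (mul_eq_zero.1 e3).resolve_left hne
  have hpS := mem_seg_of_side_eq_zero hlt (by linarith) hps h2.le
  have := h.seg_cantor_subset (zero_mem_cantor hM) (one_mem_cantor hM)
  rw [arcPt_zero, arcPt_one] at this
  rw [hz]
  exact combo_mem_valueGap hc h2.le hps.ge (closure_valueGap (this hpS)).2 (div_pos h3 hc0) h1.le

/-- There is only one critical value gap: it lies behind the leaf and has points close to the middle of
the leaf, and these belong to the gap just described. -/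
theorem eq_of_isCriticalValueGap (h : LeafData m α γ) {G : Set ℂ}
    (hG : IsCriticalValueGap m s((α : Angle), (γ : Angle)) G) : G = closure (valueGap m α γ) := by
  have hlt := h.lt
  have hsh := h.short
  obtain ⟨⟨⟨z₀, hz₀, rfl⟩, -⟩, hS, -, hbig⟩ := hG
  set V := connectedComponentIn (leafComplement m s((α : Angle), (γ : Angle))) z₀ with hV
  have hsub : V ⊆ leafComplement m s((α : Angle), (γ : Angle)) := connectedComponentIn_subset _ _
  have hpos : ∀ z ∈ V, 0 < side α γ z := by
    intro z hz
    have h1 := hbig z (subset_closure hz)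
    rw [mem_bigPart hlt hsh, not_and, not_lt] at h1
    have h2 := h1 (hsub hz).1.le
    refine lt_of_le_of_ne h2 fun h3 => (hsub hz).2 _ (Or.inl h.leaf_mem_genLam)
      (mem_seg_of_side_eq_zero hlt (by linarith) h3.symm (hsub hz).1.le)
  obtain ⟨s, hs, hev⟩ := h.eventually_mem_valueGap
  have hcl : s ∈ closure V := by
    have := frontier_subset_closure (hS.2 hs)
    rwa [closure_closure] at this
  obtain ⟨z, hz, hzV⟩ := (mem_closure_iff_frequently.1 hcl).and_eventually hev |>.exists
  have hz' := hzV (hpos z hz)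
  rw [hV, _root_.connectedComponentIn_eq hz, h.connectedComponentIn_eq hz']

end LeafData

/-! ### Rotation sets of the two branches -/

/-- The offset between `M` times a point of the rotation set and the next point of its orbit. -/
def rotShift (M : ℝ) (p : ℤ) (k : ℕ) (j : ℤ) : ℝ :=
  (M - 2) * (((j + p) / k : ℤ) : ℝ) + ((j / k : ℤ) : ℝ)

/-- The lift to the line of the rotation set with rotation number `p / k`: the points with the
indices `0, …, k - 1` lie in the unit interval, in this order, and the expanding branches map the
point with the index `j` to the point with the index `j + p` modulo `k`. The points with the indices
`p - 1` and `p`, the images of the last and of the first point, are the critical values of the rotation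
set. -/
def rotPt (M : ℝ) (p : ℤ) (k : ℕ) (j : ℤ) : ℝ :=
  (p + ∑ i ∈ Finset.range k, M ^ (k - 1 - i) * rotShift M p k (j + i * p)) / (M ^ k - 1)

section

variable {M : ℝ} {p : ℤ} {k : ℕ}

theorem rotShift_add (hk : 0 < k) (j n : ℤ) :
    rotShift M p k (j + n * k) = rotShift M p k j + n * (M - 1) := by
  have hk' : (k : ℤ) ≠ 0 := by positivity
  unfold rotShift
  rw [show j + n * k + p = j + p + n * k by ring, Int.add_mul_ediv_right _ _ hk',
    Int.add_mul_ediv_right _ _ hk']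
  push_cast
  ring

theorem rotShift_mono (hM : 2 < M) (hk : 0 < k) {i j : ℤ} (hij : i ≤ j) :
    rotShift M p k i ≤ rotShift M p k j := by
  have hk' : (0 : ℤ) < k := by positivity
  have h1 : (((i + p) / k : ℤ) : ℝ) ≤ (((j + p) / k : ℤ) : ℝ) := by
    exact_mod_cast Int.ediv_le_ediv hk' (by omega)
  have h2 : ((i / k : ℤ) : ℝ) ≤ ((j / k : ℤ) : ℝ) := by
    exact_mod_cast Int.ediv_le_ediv hk' hij
  unfold rotShift
  nlinarith

theorem rotShift_succ_of_dvd (hM : 2 < M) (hk : 0 < k) {j : ℤ} (hj : (k : ℤ) ∣ j + 1) :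
    rotShift M p k j < rotShift M p k (j + 1) := by
  have hk' : (0 : ℤ) < k := by positivity
  have h1 : (((j + p) / k : ℤ) : ℝ) ≤ (((j + 1 + p) / k : ℤ) : ℝ) := by
    exact_mod_cast Int.ediv_le_ediv hk' (by omega)
  have h2 : ((j / k : ℤ) : ℝ) < (((j + 1) / k : ℤ) : ℝ) := by
    obtain ⟨c, hc⟩ := hj
    rw [hc, Int.mul_ediv_cancel_left _ hk'.ne']
    have : j / k < c := Int.ediv_lt_of_lt_mul hk' (by linarith)
    exact_mod_cast this
  unfold rotShift
  nlinarith

/-- The offset changes only at indices whose orbit passes the middle gap or the ends of the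
interval. -/
theorem rotShift_pred (hk : 0 < k) {j : ℤ} (h1 : ¬ (k : ℤ) ∣ j) (h2 : ¬ (k : ℤ) ∣ j + p) :
    rotShift M p k (j - 1) = rotShift M p k j := by
  have hk' : (0 : ℤ) < k := by positivity
  have key : ∀ j : ℤ, ¬ (k : ℤ) ∣ j → (j - 1) / k = j / k := by
    intro j hj
    have h3 := Int.emod_add_mul_ediv j k
    have h4 := Int.emod_nonneg j hk'.ne'
    have h5 := Int.emod_lt_of_pos j hk'
    have h6 : j % k ≠ 0 := fun h => hj (Int.dvd_of_emod_eq_zero h)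
    rw [Int.ediv_eq_iff_of_pos hk']
    have h7 : 0 < j % k := lt_of_le_of_ne h4 (Ne.symm h6)
    constructor <;> linarith
  unfold rotShift
  rw [show j - 1 + p = j + p - 1 by ring, key _ h2, key _ h1]

theorem pow_sub_one_pos (hM : 2 < M) (hk : 0 < k) : 0 < M ^ k - 1 := by
  have := one_lt_pow₀ (by linarith : 1 < M) hk.ne'
  linarith

theorem rotPt_mul (hM : 2 < M) (hk : 0 < k) (j : ℤ) :
    M * rotPt M p k j = rotPt M p k (j + p) + rotShift M p k j := by
  have hD := pow_sub_one_pos hM hk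
  unfold rotPt
  rw [← mul_div_assoc, div_add' _ _ _ hD.ne']
  congr 1
  obtain ⟨k, rfl⟩ : ∃ l, k = l + 1 := ⟨k - 1, by omega⟩
  rw [Finset.sum_range_succ', Finset.sum_range_succ]
  have h1 := rotShift_add (M := M) (p := p) (k := k + 1) (by omega) j p
  have h2 : ∀ i ∈ Finset.range k, M * (M ^ (k + 1 - 1 - (i + 1)) *
      rotShift M p (k + 1) (j + ((i + 1 : ℕ) : ℤ) * p)) =
      M ^ (k + 1 - 1 - i) * rotShift M p (k + 1) (j + p + i * p) := by
    intro i hi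
    rw [Finset.mem_range] at hi
    rw [← mul_assoc, ← pow_succ', show k + 1 - 1 - (i + 1) + 1 = k + 1 - 1 - i by omega]
    congr 2
    push_cast; ring
  rw [mul_add, mul_add, Finset.mul_sum, Finset.sum_congr rfl h2,
    show j + p + (k : ℤ) * p = j + p * ((k + 1 : ℕ) : ℤ) by push_cast; ring, h1]
  simp
  ring

theorem rotPt_add (hM : 2 < M) (hk : 0 < k) (j n : ℤ) :
    rotPt M p k (j + n * k) = rotPt M p k j + n := by
  have hD := pow_sub_one_pos hM hk
  unfold rotPt
  rw [div_add' _ _ _ hD.ne']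
  congr 1
  have h1 : ∀ i ∈ Finset.range k, M ^ (k - 1 - i) * rotShift M p k (j + n * k + i * p) =
      M ^ (k - 1 - i) * rotShift M p k (j + i * p) + n * ((M - 1) * M ^ (k - 1 - i)) := by
    intro i _
    rw [show j + n * k + i * p = j + i * p + n * k by ring, rotShift_add hk]
    ring
  rw [Finset.sum_congr rfl h1, Finset.sum_add_distrib, ← Finset.mul_sum, ← Finset.mul_sum,
    Finset.sum_range_reflect (fun i => M ^ i) k, mul_geom_sum]
  ring

theorem rotPt_strictMono (hM : 2 < M) (hk : 0 < k) (hpk : IsCoprime p k) :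
    StrictMono (rotPt M p k) := by
  have hD := pow_sub_one_pos hM hk
  refine strictMono_int_of_lt_succ fun j => ?_
  unfold rotPt
  rw [div_lt_div_iff_of_pos_right hD]
  have hk' : (0 : ℤ) < k := by positivity
  -- one of the indices of the orbit is divisible by `k`
  obtain ⟨i, hi, hdvd⟩ : ∃ i < k, (k : ℤ) ∣ j + i * p + 1 := by
    obtain ⟨a, b, hab⟩ := hpk
    have h0 := Int.emod_nonneg (-(j + 1) * a) hk'.ne'
    refine ⟨((-(j + 1) * a) % k).toNat, ?_, ?_⟩
    · have := Int.emod_lt_of_pos (-(j + 1) * a) hk'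
      omega
    · rw [Int.toNat_of_nonneg h0, Int.emod_def]
      refine ⟨(j + 1) * b - ((-(j + 1) * a) / k) * p, ?_⟩
      linear_combination (-(j + 1)) * hab
  refine add_lt_add_right (Finset.sum_lt_sum (fun i _ => ?_) ⟨i, Finset.mem_range.2 hi, ?_⟩) _
  · refine mul_le_mul_of_nonneg_left ?_ (by positivity)
    exact rotShift_mono hM hk (by omega)
  · refine mul_lt_mul_of_pos_left ?_ (by positivity)
    have := rotShift_succ_of_dvd (p := p) hM hk hdvd
    rwa [show j + i * p + 1 = j + 1 + i * p by ring] at this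

/-- The conditions on a rotation number `p / k` in lowest terms, strictly between `0` and `1`, and on
the expansion factor. -/
structure RotData (M : ℝ) (p : ℤ) (k : ℕ) : Prop where
  four_le : 4 ≤ M
  pos : 0 < p
  lt : p < k
  coprime : IsCoprime p k

namespace RotData

theorem two_lt (h : RotData M p k) : 2 < M := by linarith [h.four_le]

theorem two_le (h : RotData M p k) : 2 ≤ k := by have := h.pos; have := h.lt; omega

theorem strictMono (h : RotData M p k) : StrictMono (rotPt M p k) :=
  rotPt_strictMono h.two_lt (by linarith [h.two_le]) h.coprime

theorem mul_eq (h : RotData M p k) (j : ℤ) :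
    M * rotPt M p k j = rotPt M p k (j + p) + rotShift M p k j :=
  rotPt_mul h.two_lt (by linarith [h.two_le]) j

theorem add_eq (h : RotData M p k) (j n : ℤ) : rotPt M p k (j + n * k) = rotPt M p k j + n :=
  rotPt_add h.two_lt (by linarith [h.two_le]) j n

/-- The points with the indices `0, …, k - 1` lie in the unit interval. -/
theorem mem_Ioo (h : RotData M p k) {r : ℤ} (h0 : 0 ≤ r) (hr : r < k) :
    0 < rotPt M p k r ∧ rotPt M p k r < 1 := by
  have hM := h.two_lt
  have hp := h.pos
  have hpk := h.lt
  have hmono := h.strictMono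
  have hk' : (0 : ℤ) < k := by omega
  have z : 0 < rotPt M p k 0 := by
    have h1 := h.mul_eq 0
    have h2 := hmono (show (0 : ℤ) < 0 + p by omega)
    have h3 : rotShift M p k 0 = 0 := by
      unfold rotShift
      rw [zero_add, Int.ediv_eq_zero_of_lt hp.le hpk]
      simp
    rw [h3] at h1
    nlinarith
  have o : rotPt M p k (-1) < 0 := by
    have h1 := h.mul_eq (-1)
    have h2 := hmono (show -1 + p < -1 + 1 * k by omega)
    have h3 : rotShift M p k (-1) = -1 := by
      unfold rotShift
      rw [Int.ediv_eq_zero_of_lt (by omega) (by omega), show (-1 : ℤ) / k = -1 from (Int.ediv_eq_iff_of_pos hk').2 (by omega)]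
      simp
    rw [h3] at h1
    rw [h.add_eq] at h2
    push_cast at h2
    nlinarith
  constructor
  · exact z.trans_le (hmono.monotone h0)
  · refine (hmono.monotone (show r ≤ -1 + 1 * k by omega)).trans_lt ?_
    rw [h.add_eq]
    push_cast
    linarith

/-- The first branch produces the points of the rotation set with small index. -/
theorem eq_branch_false (h : RotData M p k) {r : ℤ} (h0 : 0 ≤ r) (hr : r + p < k) :
    rotPt M p k r = branch M false (rotPt M p k (r + p)) := by
  have hM := h.two_lt
  have hp := h.pos
  have h1 := h.mul_eq r
  have h3 : rotShift M p k r = 0 := by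
    unfold rotShift
    rw [Int.ediv_eq_zero_of_lt (by omega) hr, Int.ediv_eq_zero_of_lt h0 (by omega)]
    simp
  rw [branch_false, eq_div_iff (by linarith)]
  linarith

/-- The second branch produces the points of the rotation set with large index. -/
theorem eq_branch_true (h : RotData M p k) {r : ℤ} (h0 : k ≤ r + p) (hr : r < k) :
    rotPt M p k r = branch M true (rotPt M p k (r + p - k)) := by
  have hM := h.two_lt
  have hp := h.pos
  have hpk := h.lt
  have hk' : (0 : ℤ) < k := by omega
  have h1 := h.mul_eq r
  have h2 := h.add_eq (r + p - k) 1
  rw [show r + p - k + 1 * k = r + p by ring] at h2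
  push_cast at h2
  have h3 : rotShift M p k r = M - 2 := by
    unfold rotShift
    rw [(Int.ediv_eq_iff_of_pos hk').2 (show (1 : ℤ) * k ≤ _ ∧ _ by omega), Int.ediv_eq_zero_of_lt (by omega) hr]
    simp
  have : M ≠ 0 := by linarith
  rw [branch_true]
  field_simp
  linarith

end RotData

end

/-! ### Parameter leaves behind a parameter leaf -/

theorem Quarter.mono {α γ α' γ' : ℝ} {i : ℤ} {t : Angle} (h : Quarter α γ i t) (hα : α ≤ α')
    (hγ : γ' ≤ γ) : Quarter α' γ' i t :=
  ClArc.mono h (by linarith) (by linarith)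

/-- Doubling keeps chords linked if the ends of each chord lie in a common quarter. -/
theorem Linked.double_of_quarter {α γ : ℝ} (hlt : α < γ) (hsh : γ < α + 1 / 2) {U V Z W : Angle}
    {i j : ℤ} (hU : Quarter α γ i U) (hV : Quarter α γ i V) (hZ : Quarter α γ j Z)
    (hW : Quarter α γ j W) (hl : Linked s(U, V) s(Z, W)) :
    Linked s(dbl U, dbl V) s(dbl Z, dbl W) := by
  have hq : (α + i) / 2 < (γ - 1 + i) / 2 + 1 / 2 := by linarith
  obtain ⟨r, hr⟩ | ⟨r, hr⟩ : (∃ r, j = i + 2 * r) ∨ ∃ r, j = i + 1 + 2 * r := by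
    rcases Int.emod_two_eq_zero_or_one (j - i) with h | h
    · exact Or.inl ⟨(j - i) / 2, by omega⟩
    · exact Or.inr ⟨(j - i) / 2, by omega⟩
  · have e : ∀ {t}, Quarter α γ j t → Quarter α γ i t := fun {t} ht => by
      refine (clArc_add_int r).1 ?_
      unfold Quarter at ht
      convert ht using 1 <;> rw [hr] <;> push_cast <;> ring
    exact hl.double hq hU hV (e hZ) (e hW)
  · exfalso
    obtain ⟨u, u1, u2, rfl⟩ := hU
    obtain ⟨v, v1, v2, rfl⟩ := hV
    have e : ∀ {t}, Quarter α γ j t → ¬ OpArc ((γ - 1 + i) / 2) ((α + i) / 2) t := fun {t} ht ho => by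
      refine ho.not_clArc (z := (γ - 1 + (i + 1)) / 2) (w := (α + (i + 1)) / 2) (by linarith)
        (by linarith) ((clArc_add_int r).1 ?_)
      unfold Quarter at ht
      convert ht using 1 <;> rw [hr] <;> push_cast <;> ring
    rcases hl.symm.exists_opArc (by linarith) u1 u2 v1 v2 with h | h
    · exact e hZ h
    · exact e hW h

theorem minimalPeriod_coe {n : ℕ} {x : ℝ} (hn : 0 < n) (hper : ∃ N : ℤ, 2 ^ n * x = x + N)
    (hex : ∀ s : ℕ, 0 < s → s < n → ∀ N : ℤ, 2 ^ s * x ≠ x + N) :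
    Function.minimalPeriod dbl (x : Angle) = n := by
  have h1 : Function.IsPeriodicPt dbl n (x : Angle) := by
    rw [Function.IsPeriodicPt, Function.IsFixedPt, dbl_iterate_coe, coe_eq_coe_iff]
    exact hper
  refine le_antisymm (h1.minimalPeriod_le hn) (not_lt.1 fun hlt => ?_)
  obtain ⟨N, hN⟩ : ∃ N : ℤ, 2 ^ (Function.minimalPeriod dbl (x : Angle)) * x = x + N := by
    rw [← coe_eq_coe_iff, ← dbl_iterate_coe]
    exact Function.iterate_minimalPeriod
  exact hex _ (h1.minimalPeriod_pos hn) hlt N hN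

namespace LeafData

variable {m : ℕ} {α γ : ℝ}

/-- Linkedness persists along the orbits of two chords, as long as each iterate of either chord has its
ends in a common quarter. -/
theorem linked_iter {n : ℕ} {β₁ β₂ : ℝ} (h : LeafData n β₁ β₂) {l r : ℕ} {c₁ c₂ : ℝ}
    (hc : ∀ r, ∃ i, Quarter β₁ β₂ i ((2 ^ r * c₁ : ℝ) : Angle) ∧
      Quarter β₁ β₂ i ((2 ^ r * c₂ : ℝ) : Angle))
    (hl : Linked (iter l s((β₁ : Angle), (β₂ : Angle))) (iter r s((c₁ : Angle), (c₂ : Angle))))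
    (d : ℕ) :
    Linked (iter (d + l) s((β₁ : Angle), (β₂ : Angle)))
      (iter (d + r) s((c₁ : Angle), (c₂ : Angle))) := by
  induction d with
  | zero => simpa using hl
  | succ d ih =>
    rw [iter_mk, iter_mk] at ih ⊢
    obtain ⟨i, h1, h2⟩ := h.same (d + l)
    obtain ⟨j, h3, h4⟩ := hc (d + r)
    have := ih.double_of_quarter h.lt h.short h1 h2 h3 h4
    simp only [dbl_coe, ← mul_assoc, ← pow_succ'] at this
    rwa [show d + 1 + l = d + l + 1 by ring, show d + 1 + r = d + r + 1 by ring]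

/-- Chords whose iterates stay in the quarters of a parameter leaf and whose orbit does not enter the
arc behind it are not linked with iterates of the parameter leaf. -/
theorem not_linked_iter {n : ℕ} {β₁ β₂ : ℝ} (h : LeafData n β₁ β₂) {c₁ c₂ : ℝ}
    (hc : ∀ r, ∃ i, Quarter β₁ β₂ i ((2 ^ r * c₁ : ℝ) : Angle) ∧
      Quarter β₁ β₂ i ((2 ^ r * c₂ : ℝ) : Angle))
    (hav : ∀ r : ℕ, ¬ OpArc β₁ β₂ ((2 ^ r * c₁ : ℝ) : Angle) ∧
      ¬ OpArc β₁ β₂ ((2 ^ r * c₂ : ℝ) : Angle)) (l r : ℕ) :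
    ¬ Linked (iter l s((β₁ : Angle), (β₂ : Angle))) (iter r s((c₁ : Angle), (c₂ : Angle))) := by
  intro hl
  have := h.linked_iter hc hl (l * n - l)
  rw [Nat.sub_add_cancel (Nat.le_mul_of_pos_right l (by linarith [h.one_lt])), h.iter_period,
    iter_mk] at this
  rcases (linked_iff h.lt (by linarith [h.short]) _ _).1 this with ⟨h1, -⟩ | ⟨h1, -⟩
  · exact (hav _).1 h1
  · exact (hav _).2 h1

/-- The arithmetic description of parameter leaves is sufficient. -/
theorem isParamLeaf (h : LeafData m α γ) : IsParamLeaf m s((α : Angle), (γ : Angle)) := by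
  have hlt := h.lt
  have hsh := h.short
  have hm : 0 < m := by linarith [h.one_lt]
  refine ⟨h.one_lt, h.not_isDiag, fun x hx => ?_, fun i j => ?_, fun i y hy => ?_⟩
  · rcases Sym2.mem_iff.1 hx with rfl | rfl
    · exact minimalPeriod_coe hm h.per_left h.exact_left
    · exact minimalPeriod_coe hm h.per_right h.exact_right
  · rw [cross_iff_linked]
    exact h.not_linked_iter h.same h.avoid i j
  · rw [cross_iff_linked]
    intro hl
    obtain ⟨j, ⟨u, u1, u2, hu⟩, v, v1, v2, hv⟩ := h.same i
    rw [iter_mk, ← hu, ← hv] at hl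
    have hno : ∀ t, dbl t = dbl y → ¬ OpArc ((γ - 1 + j) / 2) ((α + j) / 2) t := by
      intro t ht ho
      have h1 := opArc_dbl_of_quarter ho
      rw [ht] at h1
      rcases Sym2.mem_iff.1 hy with e | e <;> rw [e] at h1
      · exact h1.ne_right (by linarith) (coe_add_one α).symm
      · exact h1.ne_left (by linarith) rfl
    have e2 : dbl (y + halfTurn) = dbl y := by
      obtain ⟨r, -, -, rfl⟩ := exists_lift y 0
      rw [halfTurn, ← AddCircle.coe_add, dbl_coe, dbl_coe, coe_eq_coe_iff]
      exact ⟨1, by push_cast; ring⟩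
    rcases hl.symm.exists_opArc (by linarith) u1 u2 v1 v2 with h1 | h1
    · exact hno _ rfl h1
    · exact hno _ e2 h1

/-- The iterates of a parameter leaf behind the leaf `S` are not linked with the preimages of `S`. -/
theorem not_linked_quarterChord (h : LeafData m α γ) {n : ℕ} {β₁ β₂ : ℝ} (hB : LeafData n β₁ β₂)
    (h1 : α ≤ β₁) (h2 : β₂ ≤ γ) (l : ℕ) (i : ℤ) :
    ¬ Linked (iter l s((β₁ : Angle), (β₂ : Angle))) (quarterChord α γ i) := by
  have hlt := h.lt
  have hlt' := hB.lt
  have hsh := h.short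
  intro hl
  obtain ⟨j, h3, h4⟩ := hB.same l
  rw [iter_mk] at hl
  have h5 := hl.double_of_quarter (j := i) hlt' hB.short h3 h4
    (Quarter.mono (α := α) (γ := γ) ⟨_, le_rfl, by linarith, rfl⟩ h1 h2)
    (Quarter.mono (α := α) (γ := γ) ⟨_, by linarith, le_rfl, rfl⟩ h1 h2)
  refine hB.not_linked_iter (c₁ := γ) (c₂ := α) (fun r => ?_) (fun r => ?_) (l + 1) 0 ?_
  · obtain ⟨j, h6, h7⟩ := h.same r
    exact ⟨j, h7.mono h1 h2, h6.mono h1 h2⟩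
  · exact ⟨fun ho => (h.avoid r).2 (ho.mono h1 h2), fun ho => (h.avoid r).1 (ho.mono h1 h2)⟩
  · have e1 : dbl (((γ - 1 + i) / 2 : ℝ) : Angle) = (γ : Angle) := by
      rw [dbl_coe, coe_eq_coe_iff]; exact ⟨i - 1, by push_cast; ring⟩
    have e2 : dbl (((α + i) / 2 : ℝ) : Angle) = (α : Angle) := by
      rw [dbl_coe, coe_eq_coe_iff]; exact ⟨i, by ring⟩
    rw [e1, e2, dbl_coe, dbl_coe, ← mul_assoc, ← mul_assoc, ← pow_succ', ← iter_mk] at h5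
    simpa [iter] using h5

/-- The iterates of a parameter leaf behind the leaf `S` are not linked with the largest gap leaf. -/
theorem not_linked_gapLeaf_nil (h : LeafData m α γ) {n : ℕ} {β₁ β₂ : ℝ} (hB : LeafData n β₁ β₂)
    (h1 : α ≤ β₁) (h2 : β₂ ≤ γ) (l : ℕ) :
    ¬ Linked (iter l s((β₁ : Angle), (β₂ : Angle))) (gapLeaf m α γ []) := by
  intro hl
  have hm := h.one_lt
  obtain ⟨e1, e2, -⟩ := branch_zero_one h.two_lt
  have key : ∀ s, s < m → Linked (iter (s + l) s((β₁ : Angle), (β₂ : Angle)))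
      (iter s (gapLeaf m α γ [])) := by
    intro s
    induction s with
    | zero =>
      intro _
      rw [zero_add]
      unfold gapLeaf at hl ⊢
      rw [iter_mk 0, pow_zero, one_mul, one_mul]
      exact hl
    | succ s ih =>
      intro hs
      have h3 := ih (by omega)
      obtain ⟨i, h4, h5⟩ := h.same s
      unfold gapLeaf at h3 ⊢
      rw [word_nil, word_nil, ← e2, ← e1] at h3 ⊢
      rw [iter_mk s] at h3
      have h6 := h3.push h.lt h.short (h.image_quarter hs h4 h5 false zero_le_one le_rfl)
        (h.image_quarter hs h4 h5 true le_rfl zero_le_one) (h.not_linked_quarterChord hB h1 h2 _ i)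
      rw [iter_mk (s + 1), pow_succ', mul_assoc, mul_assoc, ← dbl_coe, ← dbl_coe,
        show s + 1 + l = 1 + (s + l) by ring, iter_add]
      exact h6
  obtain ⟨ε, -, hi⟩ := h.iter_gapLeaf_nil_last
  have := key (m - 1) (by omega)
  rw [hi] at this
  exact h.not_linked_quarterChord hB h1 h2 _ _ this

theorem arcPt_mem (h : LeafData m α γ) {y : ℝ} (h0 : 0 ≤ y) (h1 : y ≤ 1) :
    α ≤ arcPt α γ y ∧ arcPt α γ y ≤ γ := by
  have a := (arcPt_le_arcPt h.lt).2 h0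
  have b := (arcPt_le_arcPt h.lt).2 h1
  rw [arcPt_zero] at a
  rw [arcPt_one] at b
  exact ⟨a, b⟩

theorem arcPt_mem_Ioo (h : LeafData m α γ) {y : ℝ} (h0 : 0 < y) (h1 : y < 1) :
    α < arcPt α γ y ∧ arcPt α γ y < γ := by
  have a := (arcPt_lt_arcPt h.lt).2 h0
  have b := (arcPt_lt_arcPt h.lt).2 h1
  rw [arcPt_zero] at a
  rw [arcPt_one] at b
  exact ⟨a, b⟩

theorem eq_of_coe_arcPt_eq (h : LeafData m α γ) {x y : ℝ} (hx0 : 0 ≤ x) (hx1 : x ≤ 1) (hy0 : 0 ≤ y)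
    (hy1 : y ≤ 1) (he : (arcPt α γ x : Angle) = (arcPt α γ y : Angle)) : x = y := by
  have a := h.arcPt_mem hx0 hx1
  have b := h.arcPt_mem hy0 hy1
  have hsh := h.short
  have := eq_of_coe_eq he (by linarith) (by linarith)
  exact le_antisymm ((arcPt_le_arcPt h.lt).1 this.le) ((arcPt_le_arcPt h.lt).1 this.ge)

/-- The angles of an orbit of the expanding branches are visited at the multiples of the period. -/
theorem track (h : LeafData m α γ) {k : ℕ} {y : ℕ → ℝ}
    (hb : ∀ i < k, ∃ b, y i = branch (2 ^ m) b (y (i + 1))) :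
    ∀ i ≤ k, ∃ N : ℤ, 2 ^ (i * m) * arcPt α γ (y 0) = arcPt α γ (y i) + N := by
  intro i
  induction i with
  | zero => exact fun _ => ⟨0, by simp⟩
  | succ i ih =>
    intro hi
    obtain ⟨N, hN⟩ := ih (by omega)
    obtain ⟨b, hb'⟩ := hb i (by omega)
    obtain ⟨N', hN'⟩ := h.return_branch b (y (i + 1))
    rw [← hb'] at hN'
    refine ⟨N' + 2 ^ m * N, ?_⟩
    push_cast
    rw [add_mul, one_mul, pow_add]
    linear_combination 2 ^ m * hN + hN'

/-- The period of an angle behind the leaf is visible in its orbit under the expanding branches, as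
the images at other times are not behind the leaf. -/
theorem not_periodic_of_track (h : LeafData m α γ) {k : ℕ} {y : ℕ → ℝ}
    (h01 : ∀ i ≤ k, 0 ≤ y i ∧ y i ≤ 1) (hb : ∀ i < k, ∃ b, y i = branch (2 ^ m) b (y (i + 1)))
    (h0 : 0 < y 0) (h1 : y 0 < 1) {n : ℕ} (hn : n ≤ k * m)
    (hne : ∀ i, n = i * m → y i ≠ y 0) (N : ℤ) : 2 ^ n * arcPt α γ (y 0) ≠ arcPt α γ (y 0) + N := by
  intro hN
  have hm : 0 < m := by linarith [h.one_lt]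
  have hdiv : n / m * m + n % m = n := Nat.div_add_mod' n m
  have hk : n / m ≤ k := (Nat.div_le_div_right hn).trans (Nat.mul_div_cancel _ hm).le
  obtain ⟨N', hN'⟩ := h.track hb _ hk
  rcases Nat.eq_zero_or_pos (n % m) with hs | hs
  · rw [hs, add_zero] at hdiv
    refine hne _ hdiv.symm (h.eq_of_coe_arcPt_eq (h01 _ hk).1 (h01 _ hk).2 h0.le h1.le ?_)
    rw [coe_eq_coe_iff]
    rw [hdiv] at hN'
    exact ⟨N - N', by push_cast; linarith⟩
  · have hk' : n / m < k := by
      by_contra hc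
      have : n / m = k := by omega
      rw [this] at hdiv
      omega
    obtain ⟨b, hb'⟩ := hb _ hk'
    refine h.image_avoid hs (Nat.mod_lt _ hm) b (h01 _ hk').1 (h01 _ hk').2 ?_
    rw [← hb']
    have e : (2 : ℝ) ^ (n % m) * arcPt α γ (y (n / m)) =
        arcPt α γ (y 0) + ((N - 2 ^ (n % m) * N' : ℤ) : ℝ) := by
      have e0 : (2 : ℝ) ^ n = 2 ^ (n % m) * 2 ^ (n / m * m) := by
        rw [← pow_add]; congr 1; omega
      rw [e0] at hN
      push_cast
      linear_combination (-(2 : ℝ) ^ (n % m)) * hN' + hN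
    rw [e, coe_add_int]
    exact ⟨_, (h.arcPt_mem_Ioo h0 h1).1, (h.arcPt_mem_Ioo h0 h1).2, rfl⟩

end LeafData

/-! ### Satellite leaves -/

namespace RotData

variable {M : ℝ} {p : ℤ} {k : ℕ}

/-- The branch leading from a point of the rotation set to its predecessor tells on which side of the
critical values `p - 1` and `p` the point lies. -/
theorem step (h : RotData M p k) (j : ℤ) : ∃ b, rotPt M p k (j % k) =
    branch M b (rotPt M p k ((j + p) % k)) ∧
    (b = false → rotPt M p k p ≤ rotPt M p k ((j + p) % k)) ∧
    (b = true → rotPt M p k ((j + p) % k) ≤ rotPt M p k (p - 1)) := by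
  have hp := h.pos
  have hpk := h.lt
  have hk' : (0 : ℤ) < k := by omega
  have h0 := Int.emod_nonneg j hk'.ne'
  have h1 := Int.emod_lt_of_pos j hk'
  have e : (j + p) % k = (j % k + p) % k := by rw [Int.emod_add_emod]
  by_cases hc : j % k + p < k
  · have e' : (j + p) % k = j % k + p := by rw [e, Int.emod_eq_of_lt (by omega) hc]
    rw [e']
    exact ⟨false, h.eq_branch_false h0 hc, fun _ => h.strictMono.monotone (by omega), by simp⟩
  · have e' : (j + p) % k = j % k + p - k := by
      rw [e, ← Int.sub_emod_right, Int.emod_eq_of_lt (by omega) (by omega)]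
    rw [e']
    exact ⟨true, h.eq_branch_true (by omega) h1, by simp, fun _ => h.strictMono.monotone (by omega)⟩

theorem emod_mem_Ioo (h : RotData M p k) (j : ℤ) :
    0 < rotPt M p k (j % k) ∧ rotPt M p k (j % k) < 1 := by
  have hk' : (0 : ℤ) < k := by have := h.two_le; omega
  exact h.mem_Ioo (Int.emod_nonneg j hk'.ne') (Int.emod_lt_of_pos j hk')

/-- The orbit of the point with the index `j` under the inverses of the branches. -/
def orbit (M : ℝ) (p : ℤ) (k : ℕ) (j : ℤ) (i : ℕ) : ℝ := rotPt M p k ((j + i * p) % k)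

theorem orbit_step (h : RotData M p k) (j : ℤ) (i : ℕ) : ∃ b, orbit M p k j i =
    branch M b (orbit M p k j (i + 1)) ∧
    (b = false → rotPt M p k p ≤ orbit M p k j (i + 1)) ∧
    (b = true → orbit M p k j (i + 1) ≤ rotPt M p k (p - 1)) := by
  have := h.step (j + i * p)
  rw [show j + i * p + p = j + ((i + 1 : ℕ) : ℤ) * p by push_cast; ring] at this
  exact this

theorem orbit_period (j : ℤ) : orbit M p k j k = orbit M p k j 0 := by
  unfold orbit
  simp

theorem orbit_zero {j : ℤ} (h0 : 0 ≤ j) (h1 : j < k) :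
    orbit M p k j 0 = rotPt M p k j := by
  unfold orbit
  simp [Int.emod_eq_of_lt h0 h1]

theorem orbit_ne (h : RotData M p k) (j : ℤ) {i : ℕ} (h0 : 0 < i) (hi : i < k) :
    orbit M p k j i ≠ orbit M p k j 0 := by
  intro he
  have h1 := h.strictMono.injective he
  have h2 : (k : ℤ) ∣ i * p := by
    have h3 := Int.ModEq.dvd (show (j + ((0 : ℕ) : ℤ) * p) ≡ j + i * p [ZMOD k] from h1.symm)
    simpa using h3
  have h3 : (k : ℤ) ∣ i := (IsCoprime.symm h.coprime).dvd_of_dvd_mul_right h2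
  have := Int.le_of_dvd (by omega) h3
  omega

end RotData

namespace LeafData

variable {m : ℕ} {α γ : ℝ} {p : ℤ} {k : ℕ}

/-- The points of the rotation set correspond to angles of exact period `k * m`. -/
theorem periodic_rotPt (h : LeafData m α γ) (hr : RotData (2 ^ m) p k) {j : ℤ} (h0 : 0 ≤ j)
    (h1 : j < k) :
    (∃ N : ℤ, 2 ^ (k * m) * arcPt α γ (rotPt (2 ^ m) p k j) =
      arcPt α γ (rotPt (2 ^ m) p k j) + N) ∧
    ∀ s : ℕ, 0 < s → s < k * m → ∀ N : ℤ, 2 ^ s * arcPt α γ (rotPt (2 ^ m) p k j) ≠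
      arcPt α γ (rotPt (2 ^ m) p k j) + N := by
  have hb : ∀ i < k, ∃ b, RotData.orbit (2 ^ m) p k j i =
      branch (2 ^ m) b (RotData.orbit (2 ^ m) p k j (i + 1)) := fun i _ => by
    obtain ⟨b, hb, -⟩ := hr.orbit_step j i
    exact ⟨b, hb⟩
  have hm : 0 < m := by linarith [h.one_lt]
  rw [← RotData.orbit_zero h0 h1]
  constructor
  · have := h.track hb k le_rfl
    rwa [RotData.orbit_period] at this
  · intro s hs hsk
    refine h.not_periodic_of_track (fun i _ => ⟨(hr.emod_mem_Ioo _).1.le, (hr.emod_mem_Ioo _).2.le⟩)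
      hb (hr.emod_mem_Ioo _).1 (hr.emod_mem_Ioo _).2 hsk.le ?_
    rintro i rfl
    exact hr.orbit_ne j (Nat.pos_of_mul_pos_right hs) (lt_of_mul_lt_mul_right hsk hm.le)

/-- The chord joining the critical values of a rotation set is a parameter leaf. -/
theorem satellite (h : LeafData m α γ) (hr : RotData (2 ^ m) p k) :
    LeafData (k * m) (arcPt α γ (rotPt (2 ^ m) p k (p - 1))) (arcPt α γ (rotPt (2 ^ m) p k p)) := by
  have hm := h.one_lt
  have hsh := h.short
  have hp := hr.pos
  have hpk := hr.lt
  have i1 := hr.mem_Ioo (r := p - 1) (by omega) (by omega)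
  have i2 := hr.mem_Ioo hp.le hpk
  have a1 := h.arcPt_mem_Ioo i1.1 i1.2
  have a2 := h.arcPt_mem_Ioo i2.1 i2.2
  have q1 := h.periodic_rotPt hr (j := p - 1) (by omega) (by omega)
  have q2 := h.periodic_rotPt hr hp.le hpk
  refine ⟨?_, by linarith [h.pos], (arcPt_lt_arcPt h.lt).2 (hr.strictMono (by omega)), by linarith,
    by linarith [h.lt_one], q1.1, q2.1, q1.2, q2.2, fun l => ?_⟩
  · nlinarith [hr.two_le]
  · obtain ⟨ε, hε, hK, hK', -⟩ := h.dotLeaf_eq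
    obtain ⟨i, hi1, hi2⟩ := h.same (l % m)
    -- before the return, a point of the rotation set lies in a quarter of `S`; at the last moment
    -- it lies in the quarter that does not depend on the point
    have key : ∀ j : ℤ, 0 ≤ j → j < k →
        Quarter (arcPt α γ (rotPt (2 ^ m) p k (p - 1))) (arcPt α γ (rotPt (2 ^ m) p k p))
        (if l % m + 1 < m then i else 1 + ε)
        ((2 ^ l * arcPt α γ (rotPt (2 ^ m) p k j) : ℝ) : Angle) := by
      intro j h0 h1
      obtain ⟨N, hN⟩ := h.track (k := l / m) (y := RotData.orbit (2 ^ m) p k j) (fun i _ => by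
        obtain ⟨b, hb, -⟩ := hr.orbit_step j i
        exact ⟨b, hb⟩) _ le_rfl
      rw [RotData.orbit_zero h0 h1] at hN
      obtain ⟨b, hb, hb1, hb2⟩ := hr.orbit_step j (l / m)
      set z := RotData.orbit (2 ^ m) p k j (l / m + 1) with hz
      have z01 : 0 < z ∧ z < 1 := hr.emod_mem_Ioo _
      have e0 : (2 : ℝ) ^ l = 2 ^ (l % m) * 2 ^ (l / m * m) := by
        rw [← pow_add]; congr 1; have := Nat.mod_add_div' l m; omega
      have e : (2 : ℝ) ^ l * arcPt α γ (rotPt (2 ^ m) p k j) =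
          2 ^ (l % m) * arcPt α γ (branch (2 ^ m) b z) + ((2 ^ (l % m) * N : ℤ) : ℝ) := by
        rw [← hb, e0]
        push_cast
        linear_combination (2 : ℝ) ^ (l % m) * hN
      rw [e, coe_add_int]
      split_ifs with hc
      · exact (h.image_quarter hc hi1 hi2 b z01.1.le z01.2.le).mono a1.1.le a2.2.le
      · have hl : l % m = m - 1 := by
          have := Nat.mod_lt l (by omega : 0 < m)
          omega
        obtain ⟨K, hK⟩ := h.image_last hK hK' b z
        rw [hl, hK, coe_add_int, quarter_coe_iff]
        have hz' := h.arcPt_mem z01.1.le z01.2.le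
        cases b
        · have := (arcPt_le_arcPt h.lt).2 (hb1 rfl)
          refine ⟨0, ?_, ?_⟩ <;> push_cast <;> simp <;> linarith
        · have := (arcPt_le_arcPt h.lt).2 (hb2 rfl)
          rcases hε with rfl | rfl
          · refine ⟨0, ?_, ?_⟩ <;> push_cast <;> simp <;> linarith
          · refine ⟨-1, ?_, ?_⟩ <;> push_cast <;> simp <;> linarith
    exact ⟨_, key _ (by omega) (by omega), key _ hp.le hpk⟩

end LeafData

/-! ### Circle maps with plateaus -/

/-- The inverse of the two branches on the unit interval, with the second branch shifted by one and
with the middle gap collapsed to `1`. -/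
def collapse (M s : ℝ) : ℝ := max (min (M * s) 1) (2 - M * (1 - s))

theorem collapse_mono {M : ℝ} (hM : 0 ≤ M) {s t : ℝ} (h : s ≤ t) : collapse M s ≤ collapse M t := by
  unfold collapse
  have : M * s ≤ M * t := by gcongr
  gcongr

/-- The monotone circle map of degree one that is obtained from the inverse branches by cutting off
at `θ`: its plateaus are the middle gap and an arc around `0`, where its value is `θ`. -/
def plateauMap (M : ℝ) (hM : 0 ≤ M) (θ : ℝ) : CircleDeg1Lift where
  toFun y := ⌊y⌋ + max θ (min (collapse M (Int.fract y)) (θ + 1))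
  monotone' := by
    intro y z hyz
    have hc : ∀ x : ℝ, θ ≤ max θ (min (collapse M x) (θ + 1)) ∧
        max θ (min (collapse M x) (θ + 1)) ≤ θ + 1 := fun x =>
      ⟨le_max_left _ _, max_le (by linarith) (min_le_right _ _)⟩
    rcases (Int.floor_mono hyz).eq_or_lt with h | h
    · have : Int.fract y ≤ Int.fract z := by
        unfold Int.fract
        rw [h]
        linarith
      have h2 := collapse_mono hM this
      simp only [h]
      gcongr
    · have h1 : (⌊y⌋ : ℝ) + 1 ≤ ⌊z⌋ := by exact_mod_cast h
      have := (hc (Int.fract y)).2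
      have := (hc (Int.fract z)).1
      linarith
  map_add_one' y := by
    rw [Int.floor_add_one, Int.fract_add_one]
    push_cast
    ring

section

variable {M θ : ℝ}

theorem collapse_branch_false (hM : 2 < M) {z : ℝ} (h1 : z ≤ 1) : collapse M (branch M false z) = z := by
  unfold collapse
  rw [branch_false, mul_div_cancel₀ z (by linarith : M ≠ 0), min_eq_left h1, max_eq_left]
  rw [mul_sub, mul_div_cancel₀ z (by linarith : M ≠ 0)]
  linarith

theorem collapse_branch_true (hM : 2 < M) {z : ℝ} (h0 : 0 ≤ z) :
    collapse M (branch M true z) = 1 + z := by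
  unfold collapse
  have e : M * (1 - branch M true z) = 1 - z := by
    rw [branch_true]
    field_simp [(by linarith : M ≠ 0)]
    ring
  rw [e, max_eq_right]
  · ring
  · exact (min_le_right _ _).trans (by linarith)

theorem collapse_gap (hM : 2 < M) {s : ℝ} (h0 : 1 / M ≤ s) (h1 : s ≤ 1 - 1 / M) : collapse M s = 1 := by
  have hM0 : 0 < M := by linarith
  have e : M * (1 / M) = 1 := by field_simp
  have h2 : M * (1 / M) ≤ M * s := by gcongr
  have h3 : M * (1 / M) ≤ M * (1 - s) := by
    have : 1 / M ≤ 1 - s := by linarith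
    gcongr
  unfold collapse
  rw [min_eq_right (by linarith), max_eq_left (by linarith)]

variable (hM : 0 ≤ M)

theorem plateauMap_apply (h2 : 2 < M) (h0 : 0 ≤ θ) (h1 : θ ≤ 1) (n : ℤ) {s : ℝ} (hs0 : 0 ≤ s)
    (hs1 : s ≤ 1) :
    plateauMap M hM θ (n + s) = n + max θ (min (collapse M s) (θ + 1)) := by
  change (⌊(n : ℝ) + s⌋ : ℝ) + max θ (min (collapse M (Int.fract ((n : ℝ) + s))) (θ + 1)) = _
  rcases hs1.lt_or_eq with hs | rfl
  · rw [Int.floor_intCast_add, Int.fract_intCast_add, Int.floor_eq_zero_iff.2 ⟨hs0, hs⟩,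
      Int.fract_eq_self.2 ⟨hs0, hs⟩]
    simp
  · have e1 : collapse M 1 = 2 := by
      rw [← (branch_zero_one h2).2.2.2.1, collapse_branch_true h2 zero_le_one]; norm_num
    have e0 : collapse M 0 = 0 := by
      conv_lhs => rw [← (branch_zero_one h2).2.2.1, collapse_branch_false h2 zero_le_one]
    rw [Int.floor_add_one, Int.fract_add_one, Int.fract_intCast, Int.floor_intCast, e0, e1,
      min_eq_left (by linarith), max_eq_left h0, min_eq_right (by linarith),
      max_eq_right (by linarith)]
    push_cast
    ring

theorem plateauMap_branch_false (h2 : 2 < M) (h0 : 0 ≤ θ) (h1 : θ ≤ 1) (n : ℤ) {z : ℝ} (hz0 : 0 ≤ z)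
    (hz1 : z ≤ 1) : plateauMap M hM θ (n + branch M false z) = n + max θ z := by
  obtain ⟨a, b⟩ := branch_mem h2 false hz0 hz1
  rw [plateauMap_apply hM h2 h0 h1 n a b, collapse_branch_false h2 hz1, min_eq_left (by linarith)]

theorem plateauMap_branch_true (h2 : 2 < M) (h0 : 0 ≤ θ) (h1 : θ ≤ 1) (n : ℤ) {z : ℝ} (hz0 : 0 ≤ z)
    (hz1 : z ≤ 1) : plateauMap M hM θ (n + branch M true z) = n + 1 + min z θ := by
  obtain ⟨a, b⟩ := branch_mem h2 true hz0 hz1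
  rw [plateauMap_apply hM h2 h0 h1 n a b, collapse_branch_true h2 hz0, max_eq_right,
    add_comm 1 z, min_add_add_right]
  · ring
  · exact le_min (by linarith) (by linarith)

theorem plateauMap_gap (h2 : 2 < M) (h0 : 0 ≤ θ) (h1 : θ ≤ 1) (n : ℤ) {s : ℝ} (hs0 : 1 / M ≤ s)
    (hs1 : s ≤ 1 - 1 / M) : plateauMap M hM θ (n + s) = n + 1 := by
  obtain ⟨-, -, -, -, a, b, c⟩ := branch_zero_one h2
  rw [plateauMap_apply hM h2 h0 h1 n (by linarith) (by linarith), collapse_gap h2 hs0 hs1,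
    min_eq_left (by linarith), max_eq_right h1]

theorem plateauMap_int (h2 : 2 < M) (h0 : 0 ≤ θ) (h1 : θ ≤ 1) (n : ℤ) :
    plateauMap M hM θ n = n + θ := by
  have := plateauMap_branch_false hM h2 h0 h1 n le_rfl zero_le_one
  rwa [(branch_zero_one h2).2.2.1, add_zero, max_eq_left h0] at this

end

section

variable {M t : ℝ}

theorem lt_collapse {s : ℝ} (hs1 : t < 1) (hts : t < M * s) : t < collapse M s :=
  (lt_min hts hs1).trans_le (le_max_left _ _)

theorem collapse_lt {s : ℝ} (ht : 0 < t) (hts : 1 - t < M * (1 - s)) :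
    collapse M s < 1 + t :=
  max_lt ((min_le_right _ _).trans_lt (by linarith)) (by linarith)

/-- The rotation number of a plateau map at a periodic value is compared with fractions by looking
at a single iterate. -/
theorem iterate_cmp (f : CircleDeg1Lift) {p : ℤ} {k : ℕ} (hk : 0 < k)
    (hf : f^[k] t = t + p) (i : ℕ) (n : ℤ) :
    (f^[i] t ≤ t + n → i * p ≤ k * n) ∧ (t + n ≤ f^[i] t → k * n ≤ i * p) := by
  have e : (f ^ i)^[k] t = t + i * p := by
    rw [CircleDeg1Lift.coe_pow, ← Function.iterate_mul, mul_comm, Function.iterate_mul,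
      ← CircleDeg1Lift.coe_pow]
    rw [← CircleDeg1Lift.coe_pow] at hf
    exact CircleDeg1Lift.iterate_eq_of_map_eq_add_int _ hf i
  constructor
  · intro h
    rw [← CircleDeg1Lift.coe_pow, ← CircleDeg1Lift.iterate_pos_le_iff _ hk, e] at h
    have : (i : ℝ) * p ≤ k * n := by linarith
    exact_mod_cast this
  · intro h
    rw [← CircleDeg1Lift.coe_pow, ← CircleDeg1Lift.le_iterate_pos_iff _ hk, e] at h
    have : (k : ℝ) * n ≤ i * p := by linarith
    exact_mod_cast this

namespace RotData

variable {p : ℤ} {k : ℕ}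

theorem not_dvd (h : RotData M p k) {i : ℕ} (h0 : 0 < i) (hi : i < k) : ¬ (k : ℤ) ∣ i * p := by
  intro h2
  have h3 : (k : ℤ) ∣ i := (IsCoprime.symm h.coprime).dvd_of_dvd_mul_right h2
  have := Int.le_of_dvd (by omega) h3
  omega

/-- The integer parts of an orbit of a plateau map are determined by its rotation number. -/
theorem floor_iterate (h : RotData M p k) (hM : 0 ≤ M) (h0 : 0 < t) (h1 : t < 1)
    (hf : (plateauMap M hM t)^[k] t = t + p) {i : ℕ} (hi : i + 1 < k) :
    ((((i + 1 : ℕ) : ℤ) * p / k : ℤ) : ℝ) < (plateauMap M hM t)^[i] t ∧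
      (plateauMap M hM t)^[i] t < ((((i + 1 : ℕ) : ℤ) * p / k : ℤ) : ℝ) + 1 := by
  have hk' : (0 : ℤ) < k := by omega
  have hM2 := h.two_lt
  have key1 : ∀ n : ℤ, (plateauMap M hM t)^[i] t ≤ n → ((i + 1 : ℕ) : ℤ) * p ≤ k * n := by
    intro n hn
    refine (iterate_cmp _ (by omega) hf (i + 1) n).1 ?_
    rw [Function.iterate_succ_apply']
    refine ((plateauMap M hM t).monotone hn).trans ?_
    rw [plateauMap_int hM hM2 h0.le h1.le, add_comm]
  have key2 : ∀ n : ℤ, n ≤ (plateauMap M hM t)^[i] t → k * n ≤ ((i + 1 : ℕ) : ℤ) * p := by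
    intro n hn
    refine (iterate_cmp _ (by omega) hf (i + 1) n).2 ?_
    rw [Function.iterate_succ_apply']
    refine le_trans ?_ ((plateauMap M hM t).monotone hn)
    rw [plateauMap_int hM hM2 h0.le h1.le, add_comm]
  have h3 := Int.emod_add_mul_ediv (((i + 1 : ℕ) : ℤ) * p) k
  have h4 := Int.emod_nonneg (((i + 1 : ℕ) : ℤ) * p) hk'.ne'
  have h5 := Int.emod_lt_of_pos (((i + 1 : ℕ) : ℤ) * p) hk'
  have h6 : (((i + 1 : ℕ) : ℤ) * p) % k ≠ 0 := fun h' =>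
    h.not_dvd (i := i + 1) (by omega) hi (Int.dvd_of_emod_eq_zero h')
  constructor
  · by_contra! hc
    have := key1 _ hc
    omega
  · by_contra! hc
    have := key2 ((((i + 1 : ℕ) : ℤ) * p / k) + 1) (by push_cast at hc ⊢; exact hc)
    rw [mul_add, mul_one] at this
    omega

/-- As long as it does not meet a plateau, the orbit satisfies the recursion of the rotation set. -/
theorem iterate_recursion (h : RotData M p k) (hM : 0 ≤ M) (h0 : 0 < t) (h1 : t < 1)
    (hf : (plateauMap M hM t)^[k] t = t + p) {i : ℕ} (hi : i + 2 < k) :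
    M * (plateauMap M hM t)^[i] t =
      (plateauMap M hM t)^[i + 1] t + rotShift M p k (((i + 1 : ℕ) : ℤ) * p) := by
  have hM2 := h.two_lt
  have a := h.floor_iterate hM h0 h1 hf (i := i) (by omega)
  have b := h.floor_iterate hM h0 h1 hf (i := i + 1) (by omega)
  have e : rotShift M p k (((i + 1 : ℕ) : ℤ) * p) =
      (M - 2) * ((((i + 1 + 1 : ℕ) : ℤ) * p / k : ℤ) : ℝ) +
        ((((i + 1 : ℕ) : ℤ) * p / k : ℤ) : ℝ) := by
    unfold rotShift
    rw [show ((i + 1 : ℕ) : ℤ) * p + p = ((i + 1 + 1 : ℕ) : ℤ) * p by push_cast; ring]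
  rw [e]
  set n : ℤ := ((i + 1 : ℕ) : ℤ) * p / k with hn
  set n' : ℤ := ((i + 1 + 1 : ℕ) : ℤ) * p / k with hn'
  obtain ⟨s, hs⟩ : ∃ s, (plateauMap M hM t)^[i] t = n + s := ⟨_, (add_sub_cancel _ _).symm⟩
  have hs0 : 0 ≤ s := by linarith
  have hs1 : s ≤ 1 := by linarith
  have hstep : (plateauMap M hM t)^[i + 1] t = n + max t (min (collapse M s) (t + 1)) := by
    rw [Function.iterate_succ_apply', hs, plateauMap_apply hM hM2 h0.le h1.le n hs0 hs1]
  -- the orbit does not return to `t` before the time `k`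
  have hne : ∀ l : ℤ, (plateauMap M hM t)^[i + 1] t ≠ t + l := by
    intro l hl
    have h3 := (iterate_cmp _ (by omega) hf (i + 1) l).1 hl.le
    have h4 := (iterate_cmp _ (by omega) hf (i + 1) l).2 hl.ge
    exact h.not_dvd (i := i + 1) (by omega) (by omega) ⟨l, le_antisymm h3 h4⟩
  have hc : max t (min (collapse M s) (t + 1)) = collapse M s := by
    rcases le_total (collapse M s) t with h3 | h3
    · rw [max_eq_left ((min_le_left _ _).trans h3)] at hstep
      exact absurd (hstep.trans (add_comm _ _)) (hne n)
    · rcases le_total (collapse M s) (t + 1) with h4 | h4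
      · rw [min_eq_left h4, max_eq_right h3]
      · rw [min_eq_right h4, max_eq_right (by linarith)] at hstep
        refine absurd hstep ?_
        have := hne (n + 1)
        push_cast at this
        rwa [show (n : ℝ) + (t + 1) = t + (n + 1) by ring]
  rw [hc] at hstep
  rw [hstep] at b ⊢
  rw [hs]
  by_cases hgap : 1 / M < s ∧ s < 1 - 1 / M
  · exfalso
    rw [collapse_gap hM2 hgap.1.le hgap.2.le] at b
    have b1 : n' < n + 1 := by exact_mod_cast b.1
    have b2 : n + 1 < n' + 1 := by exact_mod_cast b.2
    omega
  · obtain ⟨d, z, hz0, hz1, rfl⟩ := exists_branch_of_mem_Icc hM2 hs0 hs1 hgap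
    cases d
    · rw [collapse_branch_false hM2 hz1] at b ⊢
      have b1 : ((n' : ℤ) : ℝ) < ((n + 1 : ℤ) : ℝ) := by push_cast; linarith
      have b2 : ((n : ℤ) : ℝ) < ((n' + 1 : ℤ) : ℝ) := by push_cast; linarith
      have b1 := Int.cast_lt.1 b1
      have b2 := Int.cast_lt.1 b2
      have : n' = n := by omega
      rw [this, branch_false, mul_add, mul_div_cancel₀ z (by linarith : M ≠ 0)]
      ring
    · rw [collapse_branch_true hM2 hz0] at b ⊢
      have b1 : ((n' : ℤ) : ℝ) < ((n + 2 : ℤ) : ℝ) := by push_cast; linarith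
      have b2 : ((n + 1 : ℤ) : ℝ) < ((n' + 1 : ℤ) : ℝ) := by push_cast; linarith
      have b1 := Int.cast_lt.1 b1
      have b2 := Int.cast_lt.1 b2
      have : n' = n + 1 := by omega
      rw [this, branch_true]
      push_cast
      field_simp [(by linarith : M ≠ 0)]
      ring

/-- A point whose orbit under the plateau map cut off at this point has the rotation number `p / k`
lies between the two critical values of the rotation set. -/
theorem mem_Icc_of_iterate (h : RotData M p k) (hM : 0 ≤ M) (h0 : 0 < t) (h1 : t < 1)
    (hf : (plateauMap M hM t)^[k] t = t + p) : rotPt M p k (p - 1) ≤ t ∧ t ≤ rotPt M p k p := by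
  have hM2 := h.two_lt
  have hk := h.two_le
  have hp := h.pos
  have hpk := h.lt
  have hk' : (0 : ℤ) < k := by omega
  have hMk : (1 : ℝ) ≤ M ^ (k - 2) := one_le_pow₀ (by linarith)
  -- both critical values have the same digits as `t` before the middle gap is met
  have diff : ∀ j : ℤ, j = p ∨ j = p - 1 → ∀ i, i + 2 ≤ k →
      (plateauMap M hM t)^[i] t - rotPt M p k (j + i * p) = M ^ i * (t - rotPt M p k j) := by
    intro j hj i
    induction i with
    | zero => intro _; simp
    | succ i ih =>
      intro hi
      have e1 := h.iterate_recursion hM h0 h1 hf (i := i) (by omega)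
      have e2 := h.mul_eq (j + i * p)
      have e3 : rotShift M p k (j + i * p) = rotShift M p k (((i + 1 : ℕ) : ℤ) * p) := by
        rcases hj with rfl | rfl
        · congr 1; push_cast; ring
        · rw [← rotShift_pred (by omega) (h.not_dvd (i := i + 1) (by omega) (by omega))]
          · congr 1; push_cast; ring
          · have := h.not_dvd (i := i + 2) (by omega) (by omega)
            rwa [show ((i + 1 : ℕ) : ℤ) * p + p = ((i + 2 : ℕ) : ℤ) * p by push_cast; ring]
      have e4 := ih (by omega)
      rw [e3] at e2
      rw [show j + ((i + 1 : ℕ) : ℤ) * p = j + i * p + p by push_cast; ring, pow_succ', mul_assoc, ← e4]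
      linarith
  have fl := h.floor_iterate hM h0 h1 hf (i := k - 2) (by omega)
  have efl : ((k - 2 + 1 : ℕ) : ℤ) * p / k = p - 1 := by
    rw [Int.ediv_eq_iff_of_pos hk', show ((k - 2 + 1 : ℕ) : ℤ) = k - 1 by omega]
    constructor <;> nlinarith
  rw [efl] at fl
  obtain ⟨f, hy⟩ : ∃ f, (plateauMap M hM t)^[k - 2] t = ((p - 1 : ℤ) : ℝ) + f :=
    ⟨_, (add_sub_cancel _ _).symm⟩
  have hf0 : 0 ≤ f := by linarith
  have hf1 : f ≤ 1 := by linarith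
  have hlast : plateauMap M hM t (plateauMap M hM t (((p - 1 : ℤ) : ℝ) + f)) = t + p := by
    obtain ⟨l, rfl⟩ : ∃ l, k = l + 2 := ⟨k - 2, by omega⟩
    rw [← hy, ← hf, Function.iterate_succ_apply', Function.iterate_succ_apply']
    rfl
  have htM : t / M < t := div_lt_self h0 (by linarith)
  have htM' : (1 - t) / M < 1 - t := div_lt_self (by linarith) (by linarith)
  have htM0 : 0 < t / M := div_pos h0 (by linarith)
  have htM0' : 0 < (1 - t) / M := div_pos (by linarith) (by linarith)
  have eM : M * (t / M) = t := mul_div_cancel₀ t (by linarith : M ≠ 0)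
  have eM' : M * ((1 - t) / M) = 1 - t := mul_div_cancel₀ _ (by linarith : M ≠ 0)
  have up : f ≤ branch M true (branch M false t) := by
    by_contra! hc
    obtain ⟨z, rfl⟩ : ∃ z, f = branch M true z := ⟨1 - M * (1 - f), by
      rw [branch_true]; field_simp [(by linarith : M ≠ 0)]; ring⟩
    rw [branch_lt_branch (by linarith), branch_false] at hc
    have hz1 : z ≤ 1 := by
      rw [← (branch_zero_one hM2).2.2.2.1] at hf1
      exact (branch_le_branch (by linarith) true).1 hf1
    rw [plateauMap_branch_true hM hM2 h0.le h1.le _ (by linarith) hz1] at hlast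
    have hs : t / M < min z t := lt_min hc htM
    have e : (((p - 1 : ℤ) : ℝ) + 1 + min z t) = ((p : ℤ) : ℝ) + min z t := by push_cast; ring
    rw [e, plateauMap_apply hM hM2 h0.le h1.le _ (by linarith)
      ((min_le_left _ _).trans hz1)] at hlast
    have h3 : t < M * min z t := by
      have := mul_lt_mul_of_pos_left hs (by linarith : 0 < M)
      linarith
    have h4 := lt_collapse h1 h3
    have h5 : t < min (collapse M (min z t)) (t + 1) := lt_min h4 (by linarith)
    have h6 := h5.trans_le (le_max_right t _)
    linarith
  have low : branch M false (branch M true t) ≤ f := by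
    by_contra! hc
    obtain ⟨z, rfl⟩ : ∃ z, f = branch M false z := ⟨M * f, by
      rw [branch_false]; field_simp [(by linarith : M ≠ 0)]⟩
    rw [branch_lt_branch (by linarith), branch_true] at hc
    have hz0 : 0 ≤ z := by
      rw [← (branch_zero_one hM2).2.2.1] at hf0
      exact (branch_le_branch (by linarith) false).1 hf0
    rw [plateauMap_branch_false hM hM2 h0.le h1.le _ hz0 (by linarith)] at hlast
    have hs : max t z < 1 - (1 - t) / M := max_lt (by linarith) hc
    rw [plateauMap_apply hM hM2 h0.le h1.le _ (h0.le.trans (le_max_left _ _)) (by linarith)] at hlast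
    have h3 : 1 - t < M * (1 - max t z) := by
      have := mul_lt_mul_of_pos_left (by linarith : (1 - t) / M < 1 - max t z) (by linarith : 0 < M)
      linarith
    have h4 := collapse_lt h0 h3
    have h6 : max t (min (collapse M (max t z)) (t + 1)) < 1 + t :=
      max_lt (by linarith) ((min_le_left _ _).trans_lt h4)
    push_cast at hlast
    linarith
  have d1 := diff p (Or.inl rfl) (k - 2) (by omega)
  have d2 := diff (p - 1) (Or.inr rfl) (k - 2) (by omega)
  have ek : ((k - 2 : ℕ) : ℤ) = k - 2 := by omega
  have x1 : rotPt M p k (p + ((k - 2 : ℕ) : ℤ) * p) =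
      branch M true (branch M false (rotPt M p k p)) + (p - 1 : ℤ) := by
    have e1 := h.eq_branch_true (r := k - p) (by omega) (by omega)
    have e2 := h.eq_branch_false (r := 0) (by omega) (by omega)
    rw [show (k : ℤ) - p + p - k = 0 by ring] at e1
    rw [zero_add] at e2
    rw [← e2, ← e1, ← h.add_eq, ek]
    congr 1; ring
  have x2 : rotPt M p k (p - 1 + ((k - 2 : ℕ) : ℤ) * p) =
      branch M false (branch M true (rotPt M p k (p - 1))) + (p - 1 : ℤ) := by
    have e1 := h.eq_branch_false (r := k - p - 1) (by omega) (by omega)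
    have e2 := h.eq_branch_true (r := k - 1) (by omega) (by omega)
    rw [show (k : ℤ) - p - 1 + p = k - 1 by ring] at e1
    rw [show (k : ℤ) - 1 + p - k = p - 1 by ring] at e2
    rw [← e2, ← e1, ← h.add_eq, ek]
    congr 1; ring
  rw [hy, x1] at d1
  rw [hy, x2] at d2
  have hdM : ∀ x : ℝ, branch M true (branch M false x) = 1 - 1 / M + x / M / M := fun x => by
    rw [branch_true, branch_false]; ring
  have hdM' : ∀ x : ℝ, branch M false (branch M true x) = (1 - 1 / M) / M + x / M / M := fun x => by
    rw [branch_true, branch_false]; ring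
  rw [hdM] at up d1
  rw [hdM'] at low d2
  have hsmall : ∀ d : ℝ, 0 < d → d / M / M < d := fun d hd =>
    (div_lt_self (div_pos hd (by linarith)) (by linarith)).trans (div_lt_self hd (by linarith))
  constructor
  · by_contra! hc
    have h3 := hsmall (rotPt M p k (p - 1) - t) (by linarith)
    rw [sub_div, sub_div] at h3
    nlinarith
  · by_contra! hc
    have h3 := hsmall (t - rotPt M p k p) (by linarith)
    rw [sub_div, sub_div] at h3
    nlinarith

end RotData

/-- If the plateau maps cut off at two points return these points with the same rotation number,
then the two points lie between the critical values of the same rotation set. -/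
theorem exists_rotData (hM : 4 ≤ M) {t₁ t₂ : ℝ} (h1 : 0 < t₁ ∧ t₁ < 1) (h2 : 0 < t₂ ∧ t₂ < 1) {e : ℕ}
    (he : 0 < e) {N : ℤ} (hf1 : (plateauMap M (by linarith) t₁)^[e] t₁ = t₁ + N)
    (hf2 : (plateauMap M (by linarith) t₂)^[e] t₂ = t₂ + N) :
    ∃ p k, RotData M p k ∧ (rotPt M p k (p - 1) ≤ t₁ ∧ t₁ ≤ rotPt M p k p) ∧
      (rotPt M p k (p - 1) ≤ t₂ ∧ t₂ ≤ rotPt M p k p) := by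
  have hM2 : 2 < M := by linarith
  have hM0 : 0 ≤ M := by linarith
  set g := Int.gcd N e with hg
  have hg0 : 0 < g := Int.gcd_pos_of_ne_zero_right _ (by omega)
  obtain ⟨p, hp⟩ : (g : ℤ) ∣ N := Int.gcd_dvd_left _ _
  obtain ⟨k', hk⟩ : (g : ℤ) ∣ e := Int.gcd_dvd_right _ _
  obtain ⟨k, rfl⟩ : ∃ k : ℕ, k' = k := by
    refine ⟨k'.toNat, (Int.toNat_of_nonneg ?_).symm⟩
    by_contra! hc
    nlinarith
  have hek : e = g * k := by exact_mod_cast hk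
  have hk0 : 0 < k := Nat.pos_of_ne_zero (by rintro rfl; omega)
  have key : ∀ {t : ℝ}, 0 < t ∧ t < 1 → (plateauMap M hM0 t)^[e] t = t + N →
      (plateauMap M hM0 t)^[k] t = t + p := by
    intro t ht hf
    rw [hek, mul_comm, Function.iterate_mul, ← CircleDeg1Lift.coe_pow, hp] at hf
    push_cast at hf
    rw [CircleDeg1Lift.iterate_pos_eq_iff _ hg0] at hf
    rwa [CircleDeg1Lift.coe_pow] at hf
  have q1 := key h1 hf1
  have q2 := key h2 hf2
  have hstep : plateauMap M hM0 t₁ t₁ = max t₁ (min (collapse M t₁) (t₁ + 1)) := by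
    have := plateauMap_apply hM0 hM2 h1.1.le h1.2.le 0 h1.1.le h1.2.le
    simpa using this
  have c1 : t₁ < collapse M t₁ := lt_collapse h1.2 (by nlinarith [h1.1])
  have c2 : collapse M t₁ < 1 + t₁ := collapse_lt h1.1 (by nlinarith [h1.2])
  rw [min_eq_left (by linarith), max_eq_right c1.le] at hstep
  have hp0 : 0 < p := by
    have h3 := (CircleDeg1Lift.lt_iterate_pos_iff (plateauMap M hM0 t₁) (x := t₁) (m := 0) hk0).2
      (by rw [hstep]; simpa using c1)
    rw [q1] at h3
    have : (0 : ℝ) < p := by simpa using h3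
    exact_mod_cast this
  have hpk : p < k := by
    have h3 := (CircleDeg1Lift.iterate_pos_lt_iff (plateauMap M hM0 t₁) (x := t₁) (m := 1) hk0).2
      (by rw [hstep]; push_cast; linarith)
    rw [q1] at h3
    have : (p : ℝ) < k := by simpa using h3
    exact_mod_cast this
  have hcop : IsCoprime p (k : ℤ) := by
    rw [Int.isCoprime_iff_gcd_eq_one]
    have h3 : Int.gcd (g * p) (g * k) = g * Int.gcd p k := by
      rw [Int.gcd_mul_left]; simp
    rw [← hp, ← hk, ← hg] at h3
    exact Nat.eq_of_mul_eq_mul_left hg0 (by omega)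
  have hr : RotData M p k := ⟨hM, hp0, hpk, hcop⟩
  exact ⟨p, k, hr, hr.mem_Icc_of_iterate hM0 h1.1 h1.2 q1, hr.mem_Icc_of_iterate hM0 h2.1 h2.2 q2⟩

end

/-! ### Parameter leaves in the wake of a leaf -/

/-- Of three nested parameter leaves the middle one separates the other two. -/
theorem separates_of_nested {α γ x₁ x₂ β₁ β₂ : ℝ} (h1 : α < x₁) (h2 : x₁ ≤ β₁) (h3 : β₁ < β₂)
    (h4 : β₂ ≤ x₂) (h5 : x₂ < γ) (h6 : γ < α + 1 / 2) (hne : x₁ < β₁ ∨ β₂ < x₂) :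
    Separates s((x₁ : Angle), (x₂ : Angle)) s((α : Angle), (γ : Angle))
      s((β₁ : Angle), (β₂ : Angle)) := by
  have hpos : ∀ {p q : ℝ}, α < p → p < γ → α < q → q < γ →
      seg s((p : Angle), (q : Angle)) ⊆ {z | 0 < side α γ z} := by
    intro p q a b c d
    refine seg_subset (convex_side_pos α γ) fun t ht => side_pt_pos (by linarith) ?_
    rcases Sym2.mem_iff.1 ht with rfl | rfl
    exacts [⟨_, a, b, rfl⟩, ⟨_, c, d, rfl⟩]
  have hneg : ∀ {p q : ℝ}, β₂ ≤ p + 1 → p ≤ β₁ → β₂ ≤ q → q ≤ β₁ + 1 →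
      seg s((p : Angle), (q : Angle)) ⊆ {z | side β₁ β₂ z ≤ 0} := by
    intro p q a b c d
    refine seg_subset (convex_side_nonpos β₁ β₂) fun t ht => side_pt_nonpos h3.le ?_
    rcases Sym2.mem_iff.1 ht with rfl | rfl
    exacts [⟨p + 1, a, by linarith, coe_add_one p⟩, ⟨q, c, d, rfl⟩]
  have hB := hpos (p := β₁) (q := β₂) (by linarith) (by linarith) (by linarith) (by linarith)
  have hx := hpos (p := x₁) (q := x₂) (by linarith) (by linarith) (by linarith) (by linarith)
  have hx' := hneg (p := x₁) (q := x₂) (by linarith) (by linarith) (by linarith) (by linarith)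
  have hS' := hneg (p := α) (q := γ) (by linarith) (by linarith) (by linarith) (by linarith)
  have mS : ∀ {z : ℂ}, z ∈ smallPart s((α : Angle), (γ : Angle)) ↔ ‖z‖ ≤ 1 ∧ 0 < side α γ z :=
    mem_smallPart (by linarith) h6
  have bS : ∀ {z : ℂ}, z ∈ bigPart s((α : Angle), (γ : Angle)) ↔ ‖z‖ ≤ 1 ∧ side α γ z < 0 :=
    mem_bigPart (by linarith) h6
  have mB : ∀ {z : ℂ}, z ∈ smallPart s((β₁ : Angle), (β₂ : Angle)) ↔
      ‖z‖ ≤ 1 ∧ 0 < side β₁ β₂ z := mem_smallPart h3 (by linarith)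
  have eB : pt (β₁ : Angle) ∈ seg s((β₁ : Angle), (β₂ : Angle)) := pt_mem_seg (by simp)
  have eB2 : pt (β₂ : Angle) ∈ seg s((β₁ : Angle), (β₂ : Angle)) := pt_mem_seg (by simp)
  have eS : pt (α : Angle) ∈ seg s((α : Angle), (γ : Angle)) := pt_mem_seg (by simp)
  have hdis : Disjoint (seg s((α : Angle), (γ : Angle))) (seg s((β₁ : Angle), (β₂ : Angle))) :=
    Set.disjoint_left.2 fun z hz hz' =>
      absurd (side_eq_zero_of_mem_seg hz) (show 0 < side α γ z from hB hz').ne'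
  -- an end of the middle leaf off the inner one, and an end of the inner one off the middle leaf
  obtain ⟨⟨z, hz, hzB⟩, w, hw, hwx⟩ :
      (∃ z ∈ seg s((x₁ : Angle), (x₂ : Angle)), side β₁ β₂ z < 0) ∧
      ∃ w ∈ seg s((β₁ : Angle), (β₂ : Angle)), 0 < side x₁ x₂ w := by
    rcases hne with h | h
    · exact ⟨⟨_, pt_mem_seg (Sym2.mem_mk_left _ _), side_pt_neg h3.le
        ⟨x₁ + 1, by linarith, by linarith, coe_add_one _⟩⟩,
        ⟨_, eB, side_pt_pos (by linarith) ⟨_, h, by linarith, rfl⟩⟩⟩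
    · exact ⟨⟨_, pt_mem_seg (Sym2.mem_mk_right _ _), side_pt_neg h3.le
        ⟨x₂, by linarith, by linarith, rfl⟩⟩,
        ⟨_, eB2, side_pt_pos (by linarith) ⟨_, by linarith, h, rfl⟩⟩⟩
  refine ⟨⟨hdis, fun v hv => ⟨norm_le_one_of_mem_seg hv, ?_, ?_⟩, z, hz, ?_, ?_⟩, ?_⟩
  · rintro (⟨-, h⟩ | ⟨h, -⟩)
    · exact absurd (bS.1 (h eB)).2 (not_lt.2 (show 0 < side α γ _ from hB eB).le)
    · exact absurd (bS.1 h).2 (not_lt.2 (show 0 < side α γ v from hx hv).le)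
  · rintro (⟨h, -⟩ | ⟨-, h⟩)
    · exact absurd (mB.1 h).2 (not_lt.2 (show side β₁ β₂ v ≤ 0 from hx' hv))
    · exact absurd (mB.1 (h eS)).2 (not_lt.2 (show side β₁ β₂ _ ≤ 0 from hS' eS))
  · exact fun h => absurd (side_eq_zero_of_mem_seg h) (show 0 < side α γ z from hx hz).ne'
  · exact fun h => absurd (side_eq_zero_of_mem_seg h) hzB.ne
  · rintro ⟨-, hstrip, -⟩
    refine (hstrip hw).2.2 (Or.inl ⟨?_, fun v hv => ?_⟩)
    · exact (mem_smallPart (by linarith) (by linarith)).2 ⟨norm_le_one_of_mem_seg hw, hwx⟩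
    · refine (mem_bigPart (by linarith) (by linarith)).2 ⟨norm_le_one_of_mem_seg hv, ?_⟩
      refine seg_subset (convex_side_neg x₁ x₂) (fun t ht => side_pt_neg (by linarith) ?_) hv
      rcases Sym2.mem_iff.1 ht with rfl | rfl
      exacts [⟨α + 1, by linarith, by linarith, coe_add_one α⟩, ⟨γ, h5, by linarith, rfl⟩]

/-- The image of the first branch moves to the right, that of the second one to the left. -/
theorem branch_false_le {M : ℝ} (hM : 2 < M) {z : ℝ} (h0 : 0 ≤ z) : branch M false z ≤ z := by
  rw [branch_false]
  exact div_le_self h0 (by linarith)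

theorem le_branch_true {M : ℝ} (hM : 2 < M) {z : ℝ} (h1 : z ≤ 1) : z ≤ branch M true z := by
  rw [branch_true]
  have := div_le_self (a := 1 - z) (by linarith) (by linarith : 1 ≤ M)
  linarith

/-- The half of an angle, with the digit `η`, lies in the quarter with the index `i` on one or the other
side of the leaf, according to the parity of `η - i`. -/
theorem side_of_quarter {β₁ β₂ x : ℝ} (h0 : 0 < β₂) (h1 : β₁ < 1) (hx0 : 0 < x) (hx1 : x < 1)
    {i η K : ℤ} (h : Quarter β₁ β₂ i (((x + η) / 2 + K : ℝ) : Angle)) :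
    ((η - i) % 2 = 0 ∧ x ≤ β₁) ∨ ((η - i) % 2 = 1 ∧ β₂ ≤ x) := by
  rw [quarter_coe_iff] at h
  obtain ⟨n, a, b⟩ := h
  have c1 : ((η + 2 * K - i - 2 * n : ℤ) : ℝ) < ((1 : ℤ) : ℝ) := by push_cast; linarith
  have c2 : ((-2 : ℤ) : ℝ) < ((η + 2 * K - i - 2 * n : ℤ) : ℝ) := by push_cast; linarith
  have c1 := Int.cast_lt.1 c1
  have c2 := Int.cast_lt.1 c2
  obtain e | e : η + 2 * K - i - 2 * n = 0 ∨ η + 2 * K - i - 2 * n = -1 := by omega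
  · have e' : (η : ℝ) + 2 * K - i - 2 * n = 0 := by exact_mod_cast e
    exact Or.inl ⟨by omega, by linarith⟩
  · have e' : (η : ℝ) + 2 * K - i - 2 * n = -1 := by exact_mod_cast e
    exact Or.inr ⟨by omega, by linarith⟩

namespace LeafData

variable {m : ℕ} {α γ : ℝ}

theorem bounds_of_behind (h : LeafData m α γ) {n : ℕ} {β₁ β₂ : ℝ} (hB : LeafData n β₁ β₂)
    (hb : Behind s((β₁ : Angle), (β₂ : Angle)) s((α : Angle), (γ : Angle))) : α ≤ β₁ ∧ β₂ ≤ γ := by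
  have h1 := ((behind_iff h.lt h.short).1 hb).1
  have key : ∀ {x : ℝ}, 0 < x → x < 1 → ClArc α γ (x : Angle) → α ≤ x ∧ x ≤ γ := by
    intro x h0 h1 hx
    obtain ⟨n, a, b⟩ := clArc_coe_iff.1 hx
    have c1 : ((n : ℤ) : ℝ) < ((1 : ℤ) : ℝ) := by push_cast; linarith [h.pos]
    have c2 : ((-1 : ℤ) : ℝ) < ((n : ℤ) : ℝ) := by push_cast; linarith [h.lt_one]
    have c1 := Int.cast_lt.1 c1
    have c2 := Int.cast_lt.1 c2
    obtain rfl : n = 0 := by omega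
    rw [Int.cast_zero, sub_zero] at a b
    exact ⟨a, b⟩
  have hlt := hB.lt
  exact ⟨(key hB.pos (by linarith [hB.lt_one]) (h1 _ (by simp))).1,
    (key (by linarith [hB.pos]) hB.lt_one (h1 _ (by simp))).2⟩

theorem exists_arcPt (h : LeafData m α γ) {x : ℝ} : ∃ t, x = arcPt α γ t := by
  refine ⟨(x - α) / (γ - α), ?_⟩
  have := h.lt
  unfold arcPt
  field_simp [(by linarith : γ - α ≠ 0)]
  ring

/-- A chord that is not linked with the largest gap leaf does not leave the middle gap at one end
only. -/
theorem gap_or_branch (h : LeafData m α γ) {u v : ℝ} (hu0 : 0 ≤ u) (hu1 : u ≤ 1) (hv0 : 0 ≤ v)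
    (hv1 : v ≤ 1)
    (hl : ¬ Linked s((arcPt α γ u : Angle), (arcPt α γ v : Angle)) (gapLeaf m α γ [])) :
    ((1 / 2 ^ m ≤ u ∧ u ≤ 1 - 1 / 2 ^ m) ∧ 1 / 2 ^ m ≤ v ∧ v ≤ 1 - 1 / 2 ^ m) ∨
      ∃ b z c w, (0 ≤ z ∧ z ≤ 1 ∧ u = branch (2 ^ m) b z) ∧ 0 ≤ w ∧ w ≤ 1 ∧ v = branch (2 ^ m) c w := by
  have hM := h.two_lt
  have hsh := h.short
  have key : ∀ {u v : ℝ}, 0 ≤ v → v ≤ 1 →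
      ¬ Linked s((arcPt α γ u : Angle), (arcPt α γ v : Angle)) (gapLeaf m α γ []) →
      (1 / 2 ^ m < u ∧ u < 1 - 1 / 2 ^ m) → 1 / 2 ^ m ≤ v ∧ v ≤ 1 - 1 / 2 ^ m := by
    intro u v hv0 hv1 hl hu
    have hb := h.gap_bounds []
    have b0 := h.arcPt_mem hv0 hv1
    have c1 := (arcPt_lt_arcPt h.lt).2 hu.1
    have c2 := (arcPt_lt_arcPt h.lt).2 hu.2
    by_contra hc
    refine hl (linked_of_opArc (W := (arcPt α γ v : Angle)) hb.2.1 (by linarith)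
      ⟨_, c1, c2, rfl⟩ ?_).symm
    rw [not_and_or, not_le, not_le] at hc
    rcases hc with hc | hc
    · have c3 : arcPt α γ v < gapL m α γ [] := (arcPt_lt_arcPt h.lt).2 hc
      exact ⟨arcPt α γ v + 1, by linarith, by linarith, coe_add_one _⟩
    · have c3 : gapR m α γ [] < arcPt α γ v := (arcPt_lt_arcPt h.lt).2 hc
      exact ⟨arcPt α γ v, by linarith, by linarith, rfl⟩
  by_cases hu : 1 / 2 ^ m < u ∧ u < 1 - 1 / 2 ^ m
  · exact Or.inl ⟨⟨hu.1.le, hu.2.le⟩, key hv0 hv1 hl hu⟩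
  by_cases hv : 1 / 2 ^ m < v ∧ v < 1 - 1 / 2 ^ m
  · exact Or.inl ⟨key hu0 hu1 (by rwa [Sym2.eq_swap]) hv, hv.1.le, hv.2.le⟩
  obtain ⟨b, z, hz⟩ := exists_branch_of_mem_Icc hM hu0 hu1 hu
  obtain ⟨c, w, hw⟩ := exists_branch_of_mem_Icc hM hv0 hv1 hv
  exact Or.inr ⟨b, z, c, w, hz, hw⟩

/-- The positions of the next returns of a parameter leaf relative to the leaf itself. -/
theorem sides_of_branches (h : LeafData m α γ) {n : ℕ} {t₁ t₂ : ℝ}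
    (hB : LeafData n (arcPt α γ t₁) (arcPt α γ t₂)) {j : ℕ} {b c : Bool} {z w : ℝ} (hz0 : 0 ≤ z)
    (hz1 : z ≤ 1) (hw0 : 0 ≤ w) (hw1 : w ≤ 1)
    (hu : ∃ N : ℤ, 2 ^ (j * m) * arcPt α γ t₁ = arcPt α γ (branch (2 ^ m) b z) + N)
    (hv : ∃ N : ℤ, 2 ^ (j * m) * arcPt α γ t₂ = arcPt α γ (branch (2 ^ m) c w) + N) :
    (b = c → (z ≤ t₁ ∧ w ≤ t₁) ∨ (t₂ ≤ z ∧ t₂ ≤ w)) ∧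
      (b ≠ c → (z ≤ t₁ ∧ t₂ ≤ w) ∨ (t₂ ≤ z ∧ w ≤ t₁)) := by
  obtain ⟨ε, hε, hK, hK', -⟩ := h.dotLeaf_eq
  obtain ⟨i, hi1, hi2⟩ := hB.same (j * m + (m - 1))
  have hBlt := hB.lt
  have key : ∀ {t z : ℝ} {b : Bool}, 0 ≤ z → z ≤ 1 →
      (∃ N : ℤ, 2 ^ (j * m) * arcPt α γ t = arcPt α γ (branch (2 ^ m) b z) + N) →
      Quarter (arcPt α γ t₁) (arcPt α γ t₂) i ((2 ^ (j * m + (m - 1)) * arcPt α γ t : ℝ) : Angle) →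
      (((if b then 1 - ε else ε : ℤ) - i) % 2 = 0 ∧ z ≤ t₁) ∨
        (((if b then 1 - ε else ε : ℤ) - i) % 2 = 1 ∧ t₂ ≤ z) := by
    intro t z b hz0 hz1 ⟨N, hN⟩ hq
    obtain ⟨K, hK2⟩ := h.image_last hK hK' b z
    have e : 2 ^ (j * m + (m - 1)) * arcPt α γ t = (arcPt α γ z +
        ((if b then 1 - ε else ε : ℤ) : ℝ)) / 2 + ((K + 2 ^ (m - 1) * N : ℤ) : ℝ) := by
      push_cast at hK2 ⊢
      rw [pow_add]
      linear_combination 2 ^ (m - 1) * hN + hK2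
    rw [e] at hq
    have hzm := h.arcPt_mem hz0 hz1
    have := side_of_quarter (by linarith [hB.pos]) (by linarith [hB.lt_one])
      (by linarith [h.pos]) (by linarith [h.lt_one]) hq
    rwa [arcPt_le_arcPt h.lt, arcPt_le_arcPt h.lt] at this
  have k1 := key hz0 hz1 hu hi1
  have k2 := key hw0 hw1 hv hi2
  constructor
  · rintro rfl
    rcases k1 with ⟨a, k1⟩ | ⟨a, k1⟩ <;> rcases k2 with ⟨a', k2⟩ | ⟨a', k2⟩
    · exact Or.inl ⟨k1, k2⟩
    · omega
    · omega
    · exact Or.inr ⟨k1, k2⟩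
  · intro hbc
    rcases k1 with ⟨a, k1⟩ | ⟨a, k1⟩ <;> rcases k2 with ⟨a', k2⟩ | ⟨a', k2⟩
    · cases b <;> cases c <;> simp at a a' hbc <;> omega
    · exact Or.inl ⟨k1, k2⟩
    · exact Or.inr ⟨k1, k2⟩
    · cases b <;> cases c <;> simp at a a' hbc <;> omega

end LeafData

/-! ### The rotation number of a leaf in the wake -/

namespace LeafData

variable {m : ℕ} {α γ : ℝ}

/-- The plateau map of a leaf, cut off at `θ`. -/
def leafMap (m : ℕ) (θ : ℝ) : CircleDeg1Lift := plateauMap (2 ^ m) (by positivity) θ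

/-- The plateau maps cut off at the two ends return these ends with the same rotation number. -/
def SameRotation (m : ℕ) (t₁ t₂ : ℝ) : Prop :=
  ∃ e : ℕ, 0 < e ∧ ∃ N : ℤ, (leafMap m t₁)^[e] t₁ = t₁ + N ∧ (leafMap m t₂)^[e] t₂ = t₂ + N

/-- The positions `u` and `v` of the `j`-th returns of the two ends of a leaf, whose orbits have not
met a plateau so far. Either the lifts of the returns have the same integer part, and they lie on the
same side of the leaf or are not too far apart; or their order is reversed, and they are far apart. -/
def Tracked (m : ℕ) (α γ t₁ t₂ : ℝ) (j : ℕ) : Prop :=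
  ∃ (u v : ℝ) (n n' : ℤ), (0 ≤ u ∧ u ≤ 1) ∧ (0 ≤ v ∧ v ≤ 1) ∧
    (leafMap m t₁)^[j] t₁ = n + u ∧ (leafMap m t₂)^[j] t₂ = n' + v ∧
    (∃ N : ℤ, 2 ^ (j * m) * arcPt α γ t₁ = arcPt α γ u + N) ∧
    (∃ N : ℤ, 2 ^ (j * m) * arcPt α γ t₂ = arcPt α γ v + N) ∧
    ((n' = n ∧ u < v ∧ (v ≤ t₁ ∨ t₂ ≤ u ∨ (u = t₁ ∧ v = t₂) ∨
        (2 ^ m + 1) * (v - u) ≤ 2 ^ m - 1)) ∨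
      (n' = n + 1 ∧ v ≤ t₁ ∧ t₂ ≤ u ∧ 2 ^ m - 1 ≤ (2 ^ m + 1) * (u - v)))

/-- If a chord joins the two sides of the middle gap and does not cross its next return, then the
return is the longer one of the two, hence the chord is not too long. -/
theorem short_of_not_linked (h : LeafData m α γ) {u v z w : ℝ} (hu0 : 0 ≤ u) (hu1 : u ≤ 1)
    (hv0 : 0 ≤ v) (hv1 : v ≤ 1) (hz0 : 0 ≤ z) (hz1 : z ≤ 1) (hw0 : 0 ≤ w) (hw1 : w ≤ 1)
    (ez : 2 ^ m * u = z) (ew : 2 ^ m * (1 - v) = 1 - w) (huv : u < v)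
    (hl : ¬ Linked s((arcPt α γ u : Angle), (arcPt α γ v : Angle))
      s((arcPt α γ z : Angle), (arcPt α γ w : Angle))) (huz : u ≤ z) (hwv : w ≤ v)
    (hpos : (v < z ∧ v < 1) ∨ (w < u ∧ 0 < u) ∨ v - u ≤ z - w ∨
      (2 ^ m + 1) * (v - u) ≤ 2 ^ m - 1) : (2 ^ m + 1) * (v - u) ≤ 2 ^ m - 1 := by
  have hM := h.two_lt
  have hlt := h.lt
  have hsh := h.short
  have huv' := (arcPt_lt_arcPt hlt).2 huv
  have bu := h.arcPt_mem hu0 hu1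
  have bv := h.arcPt_mem hv0 hv1
  have bz := h.arcPt_mem hz0 hz1
  have bw := h.arcPt_mem hw0 hw1
  have nest : v - u ≤ z - w → (2 ^ m + 1) * (v - u) ≤ 2 ^ m - 1 := fun hn => by linarith
  rcases hpos with ⟨hp, hv⟩ | ⟨hp, hu⟩ | hp | hp
  · refine nest ?_
    by_contra! hc
    have hwv : w < v := by
      refine lt_of_le_of_ne hwv fun e => ?_
      rw [e] at ew
      have := mul_lt_mul_of_pos_right (by linarith : (1 : ℝ) < 2 ^ m) (by linarith : 0 < 1 - v)
      linarith
    refine hl ((linked_iff huv' (by linarith) _ _).2 (Or.inr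
      ⟨⟨_, (arcPt_lt_arcPt hlt).2 (by linarith : u < w), (arcPt_lt_arcPt hlt).2 hwv, rfl⟩,
      ⟨_, (arcPt_lt_arcPt hlt).2 hp, by linarith, rfl⟩⟩))
  · refine nest ?_
    by_contra! hc
    have huz : u < z := by
      refine lt_of_le_of_ne huz fun e => ?_
      rw [← e] at ez
      have := mul_lt_mul_of_pos_right (by linarith : (1 : ℝ) < 2 ^ m) hu
      linarith
    have := (arcPt_lt_arcPt hlt).2 hp
    refine hl ((linked_iff huv' (by linarith) _ _).2 (Or.inl
      ⟨⟨_, (arcPt_lt_arcPt hlt).2 huz, (arcPt_lt_arcPt hlt).2 (by linarith : z < v), rfl⟩,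
      ⟨arcPt α γ w + 1, by linarith, by linarith, coe_add_one _⟩⟩))
  · exact nest hp
  · exact hp

/-- One more return keeps the two ends tracked, unless they meet a plateau; and if one of them meets a
plateau, then so does the other one, at the same place. -/
theorem tracked_step (h : LeafData m α γ) {n₀ : ℕ} {t₁ t₂ : ℝ} (h0 : 0 < t₁) (h12 : t₁ < t₂)
    (h1 : t₂ < 1) (hB : LeafData n₀ (arcPt α γ t₁) (arcPt α γ t₂)) {j : ℕ}
    (hj : Tracked m α γ t₁ t₂ j) : SameRotation m t₁ t₂ ∨ Tracked m α γ t₁ t₂ (j + 1) := by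
  have hM := h.two_lt
  have hM4 := h.four_le
  have hlt := h.lt
  have hsh := h.short
  have b1 := h.arcPt_mem_Ioo h0 (h12.trans h1)
  have b2 := h.arcPt_mem_Ioo (h0.trans h12) h1
  obtain ⟨u, v, n, n', ⟨hu0, hu1⟩, ⟨hv0, hv1⟩, hFu, hFv, hu, hv, hst⟩ := hj
  have hiter : iter (j * m) s((arcPt α γ t₁ : Angle), (arcPt α γ t₂ : Angle)) =
      s((arcPt α γ u : Angle), (arcPt α γ v : Angle)) := by
    rw [iter_mk]
    exact mk_coe_congr hu hv
  have hgap := h.not_linked_gapLeaf_nil hB b1.1.le b2.2.le (j * m)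
  rw [hiter] at hgap
  have hMpos : (0 : ℝ) < 2 ^ m := by linarith
  have hinv : (2 : ℝ) ^ m * (1 / 2 ^ m) = 1 := by field_simp
  rcases h.gap_or_branch hu0 hu1 hv0 hv1 hgap with ⟨⟨g1, g2⟩, g3, g4⟩ |
    ⟨b, z, c, w, ⟨hz0, hz1, rfl⟩, hw0, hw1, rfl⟩
  · -- both orbits meet the plateau of the middle gap
    rcases hst with ⟨rfl, -⟩ | ⟨rfl, -, -, hX⟩
    · refine Or.inl ⟨j + 1 + 1, by omega, n' + 1, ?_, ?_⟩
      · rw [Function.iterate_succ_apply', Function.iterate_succ_apply', hFu, leafMap,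
          plateauMap_gap _ hM h0.le (by linarith) n' g1 g2]
        have := plateauMap_int (M := 2 ^ m) (by positivity) hM h0.le (by linarith) (n' + 1)
        push_cast at this ⊢
        rw [this, add_comm]
      · rw [Function.iterate_succ_apply', Function.iterate_succ_apply', hFv, leafMap,
          plateauMap_gap _ hM (by linarith) h1.le n' g3 g4]
        have := plateauMap_int (M := 2 ^ m) (θ := t₂) (by positivity) hM (by linarith) h1.le (n' + 1)
        push_cast at this ⊢
        rw [this, add_comm]
    · exfalso
      have h3 : u - v ≤ 1 - 2 * (1 / 2 ^ m) := by linarith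
      have h4 : ((2 : ℝ) ^ m + 1) * (u - v) ≤ (2 ^ m + 1) * (1 - 2 * (1 / 2 ^ m)) := by gcongr
      have h5 : (0 : ℝ) < 1 / 2 ^ m := by positivity
      nlinarith
  · have hsides := h.sides_of_branches hB hz0 hz1 hw0 hw1 hu hv
    have nu : ∃ N : ℤ, 2 ^ ((j + 1) * m) * arcPt α γ t₁ = arcPt α γ z + N := by
      obtain ⟨N, hN⟩ := hu
      obtain ⟨N', hN'⟩ := h.return_branch b z
      refine ⟨N' + 2 ^ m * N, ?_⟩
      push_cast
      rw [add_mul, one_mul, pow_add]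
      linear_combination 2 ^ m * hN + hN'
    have nv : ∃ N : ℤ, 2 ^ ((j + 1) * m) * arcPt α γ t₂ = arcPt α γ w + N := by
      obtain ⟨N, hN⟩ := hv
      obtain ⟨N', hN'⟩ := h.return_branch c w
      refine ⟨N' + 2 ^ m * N, ?_⟩
      push_cast
      rw [add_mul, one_mul, pow_add]
      linear_combination 2 ^ m * hN + hN'
    have stepF : ∀ {θ : ℝ}, 0 ≤ θ → θ ≤ 1 → ∀ (l : ℤ) {x : ℝ}, 0 ≤ x → x ≤ 1 →
        leafMap m θ (l + branch (2 ^ m) false x) = l + max θ x := fun a b l x a' b' =>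
      plateauMap_branch_false _ hM a b l a' b'
    have stepT : ∀ {θ : ℝ}, 0 ≤ θ → θ ≤ 1 → ∀ (l : ℤ) {x : ℝ}, 0 ≤ x → x ≤ 1 →
        leafMap m θ (l + branch (2 ^ m) true x) = l + 1 + min x θ := fun a b l x a' b' =>
      plateauMap_branch_true _ hM a b l a' b'
    rcases hst with ⟨rfl, huv, hpos⟩ | ⟨rfl, hvt, hut, hX⟩
    · by_cases hbc : b = c
      · subst hbc
        have hzw : z < w := (branch_lt_branch hMpos b).1 huv
        cases b
        · rcases hsides.1 rfl with ⟨s1, s2⟩ | ⟨s1, s2⟩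
          · refine Or.inl ⟨j + 1, by omega, n', ?_, ?_⟩
            · rw [Function.iterate_succ_apply', hFu, stepF h0.le (by linarith) n' hz0 hz1,
                max_eq_left s1, add_comm]
            · rw [Function.iterate_succ_apply', hFv, stepF (by linarith) h1.le n' hw0 hw1,
                max_eq_left (by linarith), add_comm]
          · refine Or.inr ⟨z, w, n', n', ⟨hz0, hz1⟩, ⟨hw0, hw1⟩, ?_, ?_, nu, nv,
              Or.inl ⟨rfl, hzw, Or.inr (Or.inl s1)⟩⟩
            · rw [Function.iterate_succ_apply', hFu, stepF h0.le (by linarith) n' hz0 hz1,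
                max_eq_right (by linarith)]
            · rw [Function.iterate_succ_apply', hFv, stepF (by linarith) h1.le n' hw0 hw1,
                max_eq_right s2]
        · rcases hsides.1 rfl with ⟨s1, s2⟩ | ⟨s1, s2⟩
          · refine Or.inr ⟨z, w, n' + 1, n' + 1, ⟨hz0, hz1⟩, ⟨hw0, hw1⟩, ?_, ?_, nu, nv,
              Or.inl ⟨rfl, hzw, Or.inl s2⟩⟩
            · rw [Function.iterate_succ_apply', hFu, stepT h0.le (by linarith) n' hz0 hz1,
                min_eq_left s1]
              push_cast; rfl
            · rw [Function.iterate_succ_apply', hFv, stepT (by linarith) h1.le n' hw0 hw1,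
                min_eq_left (by linarith)]
              push_cast; rfl
          · refine Or.inl ⟨j + 1, by omega, n' + 1, ?_, ?_⟩
            · rw [Function.iterate_succ_apply', hFu, stepT h0.le (by linarith) n' hz0 hz1,
                min_eq_right (by linarith)]
              push_cast; ring
            · rw [Function.iterate_succ_apply', hFv, stepT (by linarith) h1.le n' hw0 hw1,
                min_eq_right s2]
              push_cast; ring
      · -- the ends lie on different sides of the middle gap
        obtain ⟨rfl, rfl⟩ : b = false ∧ c = true := by
          cases b <;> cases c <;> simp at hbc ⊢
          exact absurd huv (not_lt.2 (branch_false_lt_branch_true hM hw1 hz0).le)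
        have ez : 2 ^ m * branch (2 ^ m) false z = z := by rw [branch_false]; field_simp
        have ew : 2 ^ m * (1 - branch (2 ^ m) true w) = 1 - w := by
          rw [branch_true]; field_simp; ring
        have lez := branch_false_le hM hz0
        have lew := le_branch_true hM hw1
        rcases hsides.2 hbc with ⟨s1, s2⟩ | ⟨s1, s2⟩
        · -- this side is impossible
          exfalso
          rcases hpos with hp | hp | ⟨hp, -⟩ | hp
          · linarith
          · linarith
          · rw [hp] at ez
            nlinarith
          · nlinarith
        · have hnl : ¬ Linked s((arcPt α γ (branch (2 ^ m) false z) : Angle),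
              (arcPt α γ (branch (2 ^ m) true w) : Angle))
              s((arcPt α γ z : Angle), (arcPt α γ w : Angle)) := by
            have e : iter ((j + 1) * m) s((arcPt α γ t₁ : Angle), (arcPt α γ t₂ : Angle)) =
                s((arcPt α γ z : Angle), (arcPt α γ w : Angle)) := by
              rw [iter_mk]
              exact mk_coe_congr nu nv
            rw [← e, ← hiter]
            exact hB.not_linked_iter hB.same hB.avoid _ _
          have hX := h.short_of_not_linked hu0 hu1 hv0 hv1 hz0 hz1 hw0 hw1 ez ew huv hnl
            lez lew (by
              rcases hpos with hp | hp | ⟨hp, hp'⟩ | hp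
              · exact Or.inl ⟨by linarith, by linarith⟩
              · exact Or.inr (Or.inl ⟨by linarith, by linarith⟩)
              · exact Or.inr (Or.inr (Or.inl (by linarith)))
              · exact Or.inr (Or.inr (Or.inr hp)))
          refine Or.inr ⟨z, w, n', n' + 1, ⟨hz0, hz1⟩, ⟨hw0, hw1⟩, ?_, ?_, nu, nv,
            Or.inr ⟨rfl, s2, s1, ?_⟩⟩
          · rw [Function.iterate_succ_apply', hFu, stepF h0.le (by linarith) n' hz0 hz1,
              max_eq_right (by linarith)]
          · rw [Function.iterate_succ_apply', hFv, stepT (by linarith) h1.le n' hw0 hw1,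
              min_eq_left (by linarith)]
            push_cast; rfl
          · have := mul_le_mul_of_nonneg_left hX hMpos.le
            linear_combination (2 ^ m + 1) * (ez + ew) + this
    · by_cases hbc : b = c
      · exfalso
        subst hbc
        have h3 : 2 ^ m * (branch (2 ^ m) b z - branch (2 ^ m) b w) = z - w := by
          cases b
          · rw [branch_false, branch_false]; field_simp
          · rw [branch_true, branch_true]; field_simp; ring
        nlinarith
      · obtain ⟨rfl, rfl⟩ : b = true ∧ c = false := by
          cases b <;> cases c <;> simp at hbc ⊢
          have := branch_false_lt_branch_true hM hz1 hw0
          linarith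
        have ew : 2 ^ m * branch (2 ^ m) false w = w := by rw [branch_false]; field_simp
        have ez : 2 ^ m * (1 - branch (2 ^ m) true z) = 1 - z := by
          rw [branch_true]; field_simp; ring
        rcases hsides.2 hbc with ⟨s1, s2⟩ | ⟨s1, s2⟩
        · refine Or.inr ⟨z, w, n + 1, n + 1, ⟨hz0, hz1⟩, ⟨hw0, hw1⟩, ?_, ?_, nu, nv,
            Or.inl ⟨rfl, by linarith, Or.inr (Or.inr (Or.inr ?_))⟩⟩
          · rw [Function.iterate_succ_apply', hFu, stepT h0.le (by linarith) n hz0 hz1,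
              min_eq_left s1]
            push_cast; rfl
          · rw [Function.iterate_succ_apply', hFv, stepF (by linarith) h1.le (n + 1) hw0 hw1,
              max_eq_right s2]
          · have := mul_le_mul_of_nonneg_left hX hMpos.le
            linear_combination (-(2 ^ m + 1)) * (ez + ew) + this
        · refine Or.inl ⟨j + 1, by omega, n + 1, ?_, ?_⟩
          · rw [Function.iterate_succ_apply', hFu, stepT h0.le (by linarith) n hz0 hz1,
              min_eq_right (by linarith)]
            push_cast; ring
          · rw [Function.iterate_succ_apply', hFv, stepF (by linarith) h1.le (n + 1) hw0 hw1,
              max_eq_left (by linarith)]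
            push_cast; ring

/-- The ends of a parameter leaf whose period is a multiple of `m` have the same rotation number. -/
theorem sameRotation (h : LeafData m α γ) {q : ℕ} {t₁ t₂ : ℝ} (h0 : 0 < t₁) (h12 : t₁ < t₂)
    (h1 : t₂ < 1) (hB : LeafData (q * m) (arcPt α γ t₁) (arcPt α γ t₂)) : SameRotation m t₁ t₂ := by
  have key : ∀ j, SameRotation m t₁ t₂ ∨ Tracked m α γ t₁ t₂ j := by
    intro j
    induction j with
    | zero =>
      exact Or.inr ⟨t₁, t₂, 0, 0, ⟨h0.le, by linarith⟩, ⟨by linarith, h1.le⟩, by simp, by simp,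
        ⟨0, by simp⟩, ⟨0, by simp⟩, Or.inl ⟨rfl, h12, Or.inr (Or.inr (Or.inl ⟨rfl, rfl⟩))⟩⟩
    | succ j ih =>
      rcases ih with ih | ih
      · exact Or.inl ih
      · exact h.tracked_step h0 h12 h1 hB ih
  refine (key q).elim id ?_
  rintro ⟨u, v, n, n', ⟨hu0, hu1⟩, ⟨hv0, hv1⟩, hFu, hFv, hu, hv, hst⟩
  have eu : u = t₁ := by
    refine h.eq_of_coe_arcPt_eq hu0 hu1 h0.le (by linarith) ?_
    rw [← coe_eq_coe_iff.2 hu]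
    exact coe_eq_coe_iff.2 hB.per_left
  have ev : v = t₂ := by
    refine h.eq_of_coe_arcPt_eq hv0 hv1 (by linarith) h1.le ?_
    rw [← coe_eq_coe_iff.2 hv]
    exact coe_eq_coe_iff.2 hB.per_right
  subst eu ev
  rcases hst with ⟨rfl, -⟩ | ⟨-, hc, -⟩
  · exact ⟨q, Nat.pos_of_mul_pos_right (by linarith [hB.one_lt] : 0 < q * m), n', by rw [hFu, add_comm],
      by rw [hFv, add_comm]⟩
  · linarith

/-- A parameter leaf behind `S` that is immediately visible from `S` and whose period is a multiple of
the period of `S` is a satellite leaf. -/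
theorem eq_satellite (h : LeafData m α γ) {q : ℕ} {t₁ t₂ : ℝ} (h0 : 0 < t₁) (h12 : t₁ < t₂)
    (h1 : t₂ < 1) (hB : LeafData (q * m) (arcPt α γ t₁) (arcPt α γ t₂))
    (hvis : ¬ ∃ (k : ℕ) (L : Chord), IsParamLeaf k L ∧
      Separates L s((α : Angle), (γ : Angle)) s((arcPt α γ t₁ : Angle), (arcPt α γ t₂ : Angle))) :
    ∃ p, RotData (2 ^ m) p q ∧ t₁ = rotPt (2 ^ m) p q (p - 1) ∧ t₂ = rotPt (2 ^ m) p q p := by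
  obtain ⟨e, he, N, hf1, hf2⟩ := h.sameRotation h0 h12 h1 hB
  obtain ⟨p, k, hr, ⟨a1, a2⟩, a3, a4⟩ :=
    exists_rotData h.four_le ⟨h0, by linarith⟩ ⟨by linarith, h1⟩ he hf1 hf2
  have hp := hr.pos
  have hpk := hr.lt
  have hL := h.satellite hr
  have i1 := hr.mem_Ioo (r := p - 1) (by omega) (by omega)
  have i2 := hr.mem_Ioo hp.le hpk
  obtain ⟨e1, e2⟩ : rotPt (2 ^ m) p k (p - 1) = t₁ ∧ rotPt (2 ^ m) p k p = t₂ := by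
    by_contra hne
    refine hvis ⟨_, _, hL.isParamLeaf, separates_of_nested (h.arcPt_mem_Ioo i1.1 i1.2).1
      ((arcPt_le_arcPt h.lt).2 a1) hB.lt ((arcPt_le_arcPt h.lt).2 a4)
      (h.arcPt_mem_Ioo i2.1 i2.2).2 h.short ?_⟩
    rw [arcPt_lt_arcPt h.lt, arcPt_lt_arcPt h.lt]
    by_contra! hc
    exact hne ⟨le_antisymm a1 hc.1, le_antisymm hc.2 a4⟩
  have hper : k = q := by
    have hm := h.one_lt
    rw [e1, e2] at hL
    have l1 := minimalPeriod_coe (by linarith [hL.one_lt]) hL.per_left hL.exact_left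
    have l2 := minimalPeriod_coe (by linarith [hB.one_lt]) hB.per_left hB.exact_left
    exact Nat.eq_of_mul_eq_mul_right (by omega) (l1.symm.trans l2)
  subst hper
  exact ⟨p, hr, e1.symm, e2.symm⟩

end LeafData

/-! ### The gap leaf behind a satellite leaf -/

theorem word_sub_word {M : ℝ} (hM : 0 < M) (w : List Bool) (x y : ℝ) :
    (word M w y - word M w x) * M ^ w.length = y - x := by
  induction w with
  | nil => simp
  | cons b w ih =>
    rw [word_cons, word_cons, List.length_cons, pow_succ, ← ih]
    cases b
    · rw [branch_false, branch_false]; field_simp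
    · rw [branch_true, branch_true]; field_simp; ring

theorem word_le_word {M : ℝ} (hM : 0 < M) (w : List Bool) {x y : ℝ} :
    word M w x ≤ word M w y ↔ x ≤ y := by
  rw [← not_lt, ← not_lt, word_lt_word hM]

theorem exists_word_eq {M : ℝ} (hM : 0 < M) (w : List Bool) (y : ℝ) : ∃ x, word M w x = y := by
  refine ⟨(y - word M w 0) * M ^ w.length, ?_⟩
  have h := word_sub_word hM w 0 ((y - word M w 0) * M ^ w.length)
  rw [sub_zero] at h
  have := mul_right_cancel₀ (by positivity) h
  linarith

namespace RotData

variable {M : ℝ} {p : ℤ} {k : ℕ}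

/-- Unless the middle gap lies between two neighbouring points of the rotation set, they lie on the
same branch, and their images are neighbours again. -/
theorem branch_pair (h : RotData M p k) {r : ℤ} (h0 : 0 < r) (h1 : r < k) (hr : r ≠ k - p) :
    ∃ b, rotPt M p k (r - 1) = branch M b (rotPt M p k ((r + p) % k - 1)) ∧
      rotPt M p k r = branch M b (rotPt M p k ((r + p) % k)) := by
  have hp := h.pos
  have hpk := h.lt
  rcases lt_or_gt_of_ne hr with hc | hc
  · rw [Int.emod_eq_of_lt (by omega) (by omega)]
    refine ⟨false, ?_, h.eq_branch_false (by omega) (by omega)⟩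
    rw [h.eq_branch_false (r := r - 1) (by omega) (by omega)]
    congr 2; ring
  · rw [← Int.sub_emod_right, Int.emod_eq_of_lt (by omega) (by omega)]
    refine ⟨true, ?_, h.eq_branch_true (by omega) (by omega)⟩
    rw [h.eq_branch_true (r := r - 1) (by omega) (by omega)]
    congr 2; ring

/-- The neighbours of the middle gap in the rotation set, as images of the critical values. -/
theorem gap_neighbours (h : RotData M p k) :
    rotPt M p k (k - p - 1) = branch M false (branch M true (rotPt M p k (p - 1))) ∧
      rotPt M p k (k - p) = branch M true (branch M false (rotPt M p k p)) := by
  have hp := h.pos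
  have hpk := h.lt
  constructor
  · rw [h.eq_branch_false (r := k - p - 1) (by omega) (by omega),
      h.eq_branch_true (r := k - p - 1 + p) (by omega) (by omega)]
    congr 3; ring
  · rw [h.eq_branch_true (r := k - p) (by omega) (by omega),
      h.eq_branch_false (r := k - p + p - k) (by omega) (by omega)]
    congr 3; ring

/-- The index of the point whose orbit reaches the right neighbour of the middle gap after `l`
steps. -/
def back (p : ℤ) (k l : ℕ) : ℤ := (-((l + 1) * p)) % k

theorem dvd_of_back_eq (h : RotData M p k) {l l' : ℕ} (he : back p k l = back p k l') :
    (k : ℤ) ∣ (l : ℤ) - l' := by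
  have h1 : (k : ℤ) ∣ -((l' + 1) * p) - -((l + 1) * p) := Int.ModEq.dvd he
  rw [show -((l' + 1) * p) - -((l + 1) * p) = ((l : ℤ) - l') * p by ring] at h1
  exact h.coprime.symm.dvd_of_dvd_mul_right h1

theorem back_mem (h : RotData M p k) {l : ℕ} (hl : l + 1 < k) : 0 < back p k l ∧ back p k l < k := by
  have hk' : (0 : ℤ) < k := by omega
  refine ⟨lt_of_le_of_ne (Int.emod_nonneg _ hk'.ne') fun he => ?_, Int.emod_lt_of_pos _ hk'⟩
  have h1 : (k : ℤ) ∣ -((l + 1) * p) := Int.dvd_of_emod_eq_zero he.symm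
  rw [Int.dvd_neg] at h1
  have := Int.le_of_dvd (by omega) (h.coprime.symm.dvd_of_dvd_mul_right h1)
  omega

theorem back_zero (h : RotData M p k) : back p k 0 = k - p := by
  have hp := h.pos
  have hpk := h.lt
  unfold back
  rw [Nat.cast_zero, zero_add, one_mul, ← Int.add_emod_right, Int.emod_eq_of_lt (by omega) (by omega)]
  ring

theorem back_last (h : RotData M p k) : back p k (k - 2) = p := by
  have hk := h.two_le
  have hp := h.pos
  unfold back
  rw [show -((((k - 2 : ℕ) : ℤ) + 1) * p) = p + k * (-p) by push_cast [hk]; ring,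
    Int.add_mul_emod_self_left, Int.emod_eq_of_lt hp.le h.lt]

theorem back_succ (l : ℕ) : (back p k (l + 1) + p) % k = back p k l := by
  unfold back
  rw [Int.emod_add_emod]
  congr 1
  push_cast
  ring

/-- The last `n` digits of the itinerary of the critical values before the middle gap lies between
their images. -/
theorem exists_word_aux (h : RotData M p k) (n : ℕ) (hn : n + 2 ≤ k) :
    ∃ w : List Bool, w.length = n ∧ ∀ i ≤ n,
      rotPt M p k (back p k (n - i) - 1) = word M (w.drop i) (rotPt M p k (k - p - 1)) ∧
      rotPt M p k (back p k (n - i)) = word M (w.drop i) (rotPt M p k (k - p)) := by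
  induction n with
  | zero =>
    refine ⟨[], rfl, fun i _ => ?_⟩
    simp [h.back_zero]
  | succ n ih =>
    obtain ⟨w, hw, hi⟩ := ih (by omega)
    have hb := h.back_mem (l := n + 1) (by omega)
    have hne : back p k (n + 1) ≠ k - p := fun e => by
      have := Int.le_of_dvd (by omega) (h.dvd_of_back_eq (e.trans h.back_zero.symm))
      omega
    obtain ⟨b, h1, h2⟩ := h.branch_pair hb.1 hb.2 hne
    rw [back_succ] at h1 h2
    refine ⟨b :: w, by simp [hw], fun i hin => ?_⟩
    rcases i with _ | i
    · have := hi 0 (by omega)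
      simp only [Nat.sub_zero, List.drop_zero, word_cons] at this ⊢
      rw [h1, h2, this.1, this.2]
      exact ⟨rfl, rfl⟩
    · have := hi i (by omega)
      simpa using this

/-- The itinerary `w` of the critical values up to the time when the middle gap lies between them. At
no earlier time but the beginning, there is a point between the critical values whose image is
between them. -/
theorem exists_word (h : RotData M p k) : ∃ w : List Bool, w.length = k - 2 ∧
    rotPt M p k (p - 1) = word M w (rotPt M p k (k - p - 1)) ∧
    rotPt M p k p = word M w (rotPt M p k (k - p)) ∧
    ∀ i, 0 < i → i ≤ k - 2 → word M (w.drop i) (rotPt M p k (k - p)) ≤ rotPt M p k (p - 1) ∨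
      rotPt M p k p ≤ word M (w.drop i) (rotPt M p k (k - p - 1)) := by
  have hk := h.two_le
  obtain ⟨w, hw, hi⟩ := h.exists_word_aux (k - 2) (by omega)
  have h0 := hi 0 (by omega)
  rw [Nat.sub_zero, h.back_last, List.drop_zero] at h0
  refine ⟨w, hw, h0.1, h0.2, fun i hi0 hik => ?_⟩
  rw [← (hi i hik).1, ← (hi i hik).2]
  have hne : back p k (k - 2 - i) ≠ p := fun e => by
    have := h.dvd_of_back_eq (h.back_last.trans e.symm)
    have := Int.le_of_dvd (by omega) this
    omega
  rcases lt_or_gt_of_ne hne with hc | hc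
  · exact Or.inl (h.strictMono.monotone (by omega))
  · exact Or.inr (h.strictMono.monotone (by omega))

end RotData

namespace LeafData

variable {m : ℕ} {α γ : ℝ}

/-- An angle that follows an itinerary `w` has a period up to `w.length * m` only if it is met again
among the returns along `w`. -/
theorem not_periodic_word (h : LeafData m α γ) {w : List Bool} {s : ℝ} (hs0 : 0 ≤ s) (hs1 : s ≤ 1)
    (h0 : 0 < word (2 ^ m) w s) (h1 : word (2 ^ m) w s < 1)
    (hne : ∀ i, 0 < i → i ≤ w.length → word (2 ^ m) (w.drop i) s ≠ word (2 ^ m) w s) {n : ℕ}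
    (hn0 : 0 < n) (hn : n ≤ w.length * m) (N : ℤ) :
    2 ^ n * arcPt α γ (word (2 ^ m) w s) ≠ arcPt α γ (word (2 ^ m) w s) + N := by
  have hm : 0 < m := by linarith [h.one_lt]
  refine h.not_periodic_of_track (y := fun i => word (2 ^ m) (w.drop i) s)
    (fun i _ => word_mem h.two_lt _ hs0 hs1) (fun i hi => ⟨w[i], ?_⟩) h0 h1 hn ?_ N
  · show word _ (w.drop i) s = _
    rw [List.drop_eq_getElem_cons hi, word_cons]
  · rintro i rfl
    exact hne i (Nat.pos_of_mul_pos_right hn0) (Nat.le_of_mul_le_mul_right hn hm)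

/-- An angle between the critical values of a rotation set whose period is at most that of the
rotation set lies in the gap between the critical values. -/
theorem mem_gap_of_periodic (h : LeafData m α γ) {p : ℤ} {k : ℕ} (hr : RotData (2 ^ m) p k)
    {w : List Bool} (hw : w.length = k - 2)
    (e1 : rotPt (2 ^ m) p k (p - 1) = word (2 ^ m) w (rotPt (2 ^ m) p k (k - p - 1)))
    (e2 : rotPt (2 ^ m) p k p = word (2 ^ m) w (rotPt (2 ^ m) p k (k - p)))
    (hav : ∀ i, 0 < i → i ≤ k - 2 →
      word (2 ^ m) (w.drop i) (rotPt (2 ^ m) p k (k - p)) ≤ rotPt (2 ^ m) p k (p - 1) ∨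
      rotPt (2 ^ m) p k p ≤ word (2 ^ m) (w.drop i) (rotPt (2 ^ m) p k (k - p - 1)))
    {τ : ℝ} (ht1 : rotPt (2 ^ m) p k (p - 1) < τ) (ht2 : τ < rotPt (2 ^ m) p k p) {n : ℕ}
    (hn0 : 0 < n) (hn : n ≤ k * m) (hper : ∃ N : ℤ, 2 ^ n * arcPt α γ τ = arcPt α γ τ + N) :
    word (2 ^ m) w (1 / 2 ^ m) < τ ∧ τ < word (2 ^ m) w (1 - 1 / 2 ^ m) := by
  have hM := h.two_lt
  have hM0 : (0 : ℝ) < 2 ^ m := by linarith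
  have hk := hr.two_le
  have hp := hr.pos
  have hpk := hr.lt
  obtain ⟨b1, b2, b3, b4, -⟩ := branch_zero_one hM
  obtain ⟨g1, g2⟩ := hr.gap_neighbours
  have i1 := hr.mem_Ioo (r := p - 1) (by omega) (by omega)
  have i2 := hr.mem_Ioo hp.le hpk
  have c1 : rotPt (2 ^ m) p k p ≤ branch (2 ^ m) true (rotPt (2 ^ m) p k (p - 1)) := by
    have := hr.eq_branch_true (r := k - 1) (by omega) (by omega)
    rw [show (k : ℤ) - 1 + p - k = p - 1 by ring] at this
    rw [← this]
    exact hr.strictMono.monotone (by omega)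
  have c2 : branch (2 ^ m) false (rotPt (2 ^ m) p k p) ≤ rotPt (2 ^ m) p k (p - 1) := by
    have := hr.eq_branch_false (r := 0) (by omega) (by omega)
    rw [zero_add] at this
    rw [← this]
    exact hr.strictMono.monotone (by omega)
  set t₁ := rotPt (2 ^ m) p k (p - 1)
  set t₂ := rotPt (2 ^ m) p k p
  rw [g1] at e1 hav
  rw [g2] at e2 hav
  have hlen : ∀ a b, (w ++ [a, b]).length = k := fun a b => by simp [hw]; omega
  have expand : ∀ {x y : ℝ} {v : List Bool}, x = word (2 ^ m) v x → v.length = k →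
      x < word (2 ^ m) v y → word (2 ^ m) v y < y := by
    intro x y v hx hv hlt
    have h1 := word_sub_word hM0 v x y
    rw [hv, ← hx] at h1
    have h2 : (1 : ℝ) < (2 ^ m) ^ k := one_lt_pow₀ (by linarith) (by omega)
    nlinarith
  have expand' : ∀ {x y : ℝ} {v : List Bool}, x = word (2 ^ m) v x → v.length = k →
      word (2 ^ m) v y < x → y < word (2 ^ m) v y := by
    intro x y v hx hv hlt
    have h1 := word_sub_word hM0 v x y
    rw [hv, ← hx] at h1
    have h2 : (1 : ℝ) < (2 ^ m) ^ k := one_lt_pow₀ (by linarith) (by omega)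
    nlinarith
  obtain ⟨N, hN⟩ := hper
  have app : ∀ (v : List Bool) a b y, word (2 ^ m) (v ++ [a, b]) y =
      word (2 ^ m) v (branch (2 ^ m) a (branch (2 ^ m) b y)) := fun v a b y => by
    rw [word_append, word_cons, word_cons, word_nil]
  -- up to the time `k - 2` the image of `τ` lies between those of the critical values
  have early : ∀ {x : ℝ}, τ = word (2 ^ m) w x → ∀ i, 0 < i → i ≤ k - 2 →
      word (2 ^ m) (w.drop i) x ≠ τ := by
    intro x hx i hi0 hi e
    have a1 := ht1
    have a2 := ht2
    rw [e1, hx, word_lt_word hM0] at ht1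
    rw [e2, hx, word_lt_word hM0] at ht2
    rw [← word_lt_word hM0 (w.drop i), e] at ht1 ht2
    rcases hav i hi0 hi with hc | hc <;> linarith
  have drops : ∀ a b i, 0 < i → i ≤ k → (i ≤ k - 2 ∧ (w ++ [a, b]).drop i = w.drop i ++ [a, b]) ∨
      (w ++ [a, b]).drop i = [b] ∨ (w ++ [a, b]).drop i = [] := by
    intro a b i hi0 hik
    rcases Nat.lt_or_ge (k - 2) i with hi | hi
    · right
      rw [List.drop_append, List.drop_eq_nil_of_le (by omega), List.nil_append, hw]
      obtain hi' | hi' : i - (k - 2) = 1 ∨ i - (k - 2) = 2 := by omega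
      · exact Or.inl (by rw [hi']; rfl)
      · exact Or.inr (by rw [hi']; rfl)
    · exact Or.inl ⟨hi, by rw [List.drop_append_of_le_length (by omega)]⟩
  by_contra hc
  rw [not_and_or, not_lt, not_lt] at hc
  rcases hc with hc | hc
  · obtain ⟨s, hs⟩ := exists_word_eq hM0 (w ++ [false, true]) τ
    have hf : t₁ = word (2 ^ m) (w ++ [false, true]) t₁ := by rw [app]; exact e1
    have hs0 : t₁ < s := by rwa [← hs, hf, word_lt_word hM0] at ht1
    have hs1 : s ≤ 1 := by
      rw [← word_le_word hM0 (w ++ [false, true]), hs, app, b4, b1]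
      exact hc
    have hlt := expand hf (hlen _ _) (hs.symm ▸ ht1)
    refine h.not_periodic_word (by linarith) hs1 (hs.symm ▸ (by linarith)) (hs.symm ▸ (by linarith))
      ?_ hn0 ((hlen false true).symm ▸ hn) N (hs.symm ▸ hN)
    intro i hi0 hi
    rw [hlen] at hi
    rw [hs]
    rcases drops false true i hi0 hi with ⟨hi', e⟩ | e | e
    · rw [e, app]
      exact early (by rw [← app, hs]) i hi0 hi'
    · rw [e, word_cons, word_nil]
      have := (branch_lt_branch hM0 true).2 hs0
      linarith
    · rw [e, word_nil]
      rw [hs] at hlt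
      exact hlt.ne'
  · obtain ⟨s, hs⟩ := exists_word_eq hM0 (w ++ [true, false]) τ
    have hf : t₂ = word (2 ^ m) (w ++ [true, false]) t₂ := by rw [app]; exact e2
    have hs1 : s < t₂ := by rwa [← hs, hf, word_lt_word hM0] at ht2
    have hs0 : 0 ≤ s := by
      rw [← word_le_word hM0 (w ++ [true, false]), hs, app, b3, b2]
      exact hc
    have hlt := expand' hf (hlen _ _) (hs.symm ▸ ht2)
    refine h.not_periodic_word hs0 (by linarith) (hs.symm ▸ (by linarith)) (hs.symm ▸ (by linarith))
      ?_ hn0 ((hlen true false).symm ▸ hn) N (hs.symm ▸ hN)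
    intro i hi0 hi
    rw [hlen] at hi
    rw [hs]
    rcases drops true false i hi0 hi with ⟨hi', e⟩ | e | e
    · rw [e, app]
      exact early (by rw [← app, hs]) i hi0 hi'
    · rw [e, word_cons, word_nil]
      have := (branch_lt_branch hM0 false).2 hs1
      linarith
    · rw [e, word_nil]
      rw [hs] at hlt
      exact hlt.ne

end LeafData

/-! ### The boundary leaf of the critical value gap behind an immediately visible leaf -/

namespace LeafData

variable {m : ℕ} {α γ : ℝ}

/-- The last preimage of `S` in the orbit of a gap leaf is the one with preperiodic ends. -/
theorem isLeast_iter_gapLeaf (h : LeafData m α γ) (w : List Bool) :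
    IsLeast {n : ℕ | iter n (gapLeaf m α γ w) = s((α : Angle), (γ : Angle))}
      ((w.length + 1) * m) := by
  refine ⟨h.iter_gapLeaf w, fun n hn => ?_⟩
  by_contra! hlt
  have hm := h.one_lt
  obtain ⟨ε, hd, hdd⟩ := h.iter_gapLeaf_nil_last
  have hT : w.length * m + (m - 1) + 1 = (w.length + 1) * m := by rw [add_mul]; omega
  have e1 : iter (w.length * m + (m - 1)) (gapLeaf m α γ w) = quarterChord α γ (ε + 1) := by
    have := h.iter_gapLeaf_append w []
    rw [List.append_nil] at this
    rw [add_comm, iter_add, this, hdd]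
  -- a later image of `S` returns to itself after `m` steps
  have e2 : iter m (quarterChord α γ (ε + 1)) = quarterChord α γ (ε + 1) := by
    obtain ⟨l, hl⟩ : ∃ l, w.length * m + (m - 1) = l + n := ⟨w.length * m + (m - 1) - n, by omega⟩
    have hp := h.iter_period 1
    rw [one_mul] at hp
    rw [← e1, hl, iter_add l n, show iter n (gapLeaf m α γ w) = _ from hn, ← iter_add, add_comm,
      iter_add, hp]
  have e3 : iter m (quarterChord α γ (ε + 1)) = quarterChord α γ ε := by
    rw [← e1, ← iter_add, show m + (w.length * m + (m - 1)) = m - 1 + (w.length + 1) * m by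
      rw [add_mul]; omega, iter_add, h.iter_gapLeaf, ← hd]
    rfl
  have hdis := disjoint_seg_quarterChord h.lt h.short ε
  rw [← e3, e2] at hdis
  have hmem := pt_mem_seg (c := quarterChord α γ (ε + 1)) (Sym2.mem_mk_left _ _)
  exact Set.disjoint_left.1 hdis hmem hmem

/-- Two gaps of the same generation that meet coincide, and between two different ones there is not
enough room in an arc that is shorter than a branch of this generation. -/
theorem gap_unique (h : LeafData m α γ) {v w : List Bool} (hvw : v.length = w.length) {t₁ t₂ : ℝ}
    (ht : (t₂ - t₁) * (2 ^ m) ^ w.length < 1)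
    (hv1 : t₁ ≤ word (2 ^ m) v (1 / 2 ^ m)) (hv2 : word (2 ^ m) v (1 - 1 / 2 ^ m) ≤ t₂)
    (hw1 : t₁ ≤ word (2 ^ m) w (1 / 2 ^ m)) (hw2 : word (2 ^ m) w (1 - 1 / 2 ^ m) ≤ t₂) :
    gapLeaf m α γ v = gapLeaf m α γ w := by
  have hM := h.two_lt
  have hM4 := h.four_le
  have hM0 : (0 : ℝ) < 2 ^ m := by linarith
  have hP : (0 : ℝ) < (2 ^ m) ^ w.length := by positivity
  have gv := gap_subset hM v
  have gw := gap_subset hM w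
  have lv := word_sub_word hM0 v (1 / 2 ^ m) (1 - 1 / 2 ^ m)
  have lw := word_sub_word hM0 w (1 / 2 ^ m) (1 - 1 / 2 ^ m)
  rw [hvw] at lv
  have hq : (1 : ℝ) / 2 ^ m ≤ 1 / 4 := one_div_le_one_div_of_le (by norm_num) hM4
  have a1 := (gap_left_mem_cantor hM v).2.2 w
  have a2 := (gap_left_mem_cantor hM w).2.2 v
  set a := word (2 ^ m) v (1 / 2 ^ m)
  set b := word (2 ^ m) v (1 - 1 / 2 ^ m)
  set c := word (2 ^ m) w (1 / 2 ^ m)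
  set d := word (2 ^ m) w (1 - 1 / 2 ^ m)
  have close : a = c → gapLeaf m α γ v = gapLeaf m α γ w := fun e => by
    have e' : b = d := by
      have := mul_right_cancel₀ hP.ne' (lv.trans lw.symm)
      linarith
    unfold gapLeaf
    rw [show word (2 ^ m) v (1 / 2 ^ m) = word (2 ^ m) w (1 / 2 ^ m) from e,
      show word (2 ^ m) v (1 - 1 / 2 ^ m) = word (2 ^ m) w (1 - 1 / 2 ^ m) from e']
  rcases lt_trichotomy a c with hac | hac | hac
  · exfalso
    have hbc : b ≤ c := not_lt.1 fun hc => a2 ⟨hac, hc⟩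
    have := mul_le_mul_of_nonneg_right (by linarith : (b - a) + (d - c) ≤ t₂ - t₁) hP.le
    rw [add_mul, lv, lw] at this
    linarith
  · exact close hac
  · exfalso
    have hda : d ≤ a := not_lt.1 fun hc => a1 ⟨hac, hc⟩
    have := mul_le_mul_of_nonneg_right (by linarith : (b - a) + (d - c) ≤ t₂ - t₁) hP.le
    rw [add_mul, lv, lw] at this
    linarith

/-- A parameter leaf behind the satellite leaf that is visible from `S` has a period that is too small
for its ends to lie between the satellite leaf and the gap, and it cannot join an end of the satellite
leaf to an angle in the gap, since a later image would then cross the largest gap leaf. -/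
theorem behind_gapLeaf_of_visible (h : LeafData m α γ) {p : ℤ} {k : ℕ} (hr : RotData (2 ^ m) p k)
    {w : List Bool} (hw : w.length = k - 2)
    (e1 : rotPt (2 ^ m) p k (p - 1) = word (2 ^ m) w (rotPt (2 ^ m) p k (k - p - 1)))
    (e2 : rotPt (2 ^ m) p k p = word (2 ^ m) w (rotPt (2 ^ m) p k (k - p)))
    (hav : ∀ i, 0 < i → i ≤ k - 2 →
      word (2 ^ m) (w.drop i) (rotPt (2 ^ m) p k (k - p)) ≤ rotPt (2 ^ m) p k (p - 1) ∨
      rotPt (2 ^ m) p k p ≤ word (2 ^ m) (w.drop i) (rotPt (2 ^ m) p k (k - p - 1)))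
    {Q : Chord} (hQ : Visible s((α : Angle), (γ : Angle)) Q)
    (hQB : Behind Q s((arcPt α γ (rotPt (2 ^ m) p k (p - 1)) : Angle),
      (arcPt α γ (rotPt (2 ^ m) p k p) : Angle))) : Behind Q (gapLeaf m α γ w) := by
  have hM := h.two_lt
  have hM0 : (0 : ℝ) < 2 ^ m := by linarith
  have hp := hr.pos
  have hpk := hr.lt
  have hlt := h.lt
  have hB := h.satellite hr
  have i1 := hr.mem_Ioo (r := p - 1) (by omega) (by omega)
  have i2 := hr.mem_Ioo hp.le hpk
  have j1 := hr.mem_Ioo (r := k - p - 1) (by omega) (by omega)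
  have j2 := hr.mem_Ioo (r := k - p) (by omega) (by omega)
  obtain ⟨b1, b2, b3, b4, b5, b6, b7⟩ := branch_zero_one hM
  obtain ⟨n, hQl, hQS, hQv⟩ := hQ
  obtain ⟨φ₁, φ₂, rfl, hQ⟩ := hQl.exists_leafData
  obtain ⟨c1, c2⟩ := hB.bounds_of_behind hQ hQB
  obtain ⟨x, rfl⟩ := h.exists_arcPt (x := φ₁)
  obtain ⟨y, rfl⟩ := h.exists_arcPt (x := φ₂)
  have hxy := (arcPt_lt_arcPt hlt).1 hQ.lt
  have k1 : rotPt (2 ^ m) p k (k - p - 1) < 1 / 2 ^ m := by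
    rw [hr.eq_branch_false (r := k - p - 1) (by omega) (by omega), ← b1, branch_lt_branch hM0]
    exact (hr.mem_Ioo (by omega) (by omega)).2
  have k2 : 1 - 1 / 2 ^ m < rotPt (2 ^ m) p k (k - p) := by
    rw [hr.eq_branch_true (r := k - p) (by omega) (by omega), ← b2, branch_lt_branch hM0]
    exact (hr.mem_Ioo (by omega) (by omega)).1
  -- the chord is different from the satellite leaf
  have hne : rotPt (2 ^ m) p k (p - 1) < x ∨ y < rotPt (2 ^ m) p k p := by
    by_contra! hc
    rw [arcPt_le_arcPt hlt] at c1 c2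
    obtain ⟨t, ht, ho⟩ := ((behind_iff hB.lt hB.short).1 hQB).2
    have hsh := hB.short
    rw [le_antisymm hc.1 c1, le_antisymm c2 hc.2] at ht
    rcases Sym2.mem_iff.1 ht with e | e
    · exact ho.ne_left (by linarith) e
    · exact ho.ne_right (by linarith) e
  have hn : n ≤ k * m := by
    by_contra! hc
    refine hQv ⟨k * m, _, hc, hB.isParamLeaf, separates_of_nested (h.arcPt_mem_Ioo i1.1 i1.2).1 c1
      hQ.lt c2 (h.arcPt_mem_Ioo i2.1 i2.2).2 h.short ?_⟩
    rwa [arcPt_lt_arcPt hlt, arcPt_lt_arcPt hlt]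
  rw [arcPt_le_arcPt hlt] at c1 c2
  have hn0 : 0 < n := by linarith [hQ.one_lt]
  have hx : rotPt (2 ^ m) p k (p - 1) < x → _ := fun hc =>
    h.mem_gap_of_periodic hr hw e1 e2 hav hc (by linarith) hn0 hn hQ.per_left
  have hy : y < rotPt (2 ^ m) p k p → _ := fun hc =>
    h.mem_gap_of_periodic hr hw e1 e2 hav (by linarith) hc hn0 hn hQ.per_right
  -- at the time `k - 2`, the chord does not cross the largest gap leaf
  have cross : ∀ {u v : ℝ}, 0 ≤ u → u ≤ 1 → 0 ≤ v → v ≤ 1 → x = word (2 ^ m) w u →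
      y = word (2 ^ m) w v → ((1 / 2 ^ m ≤ u ∧ u ≤ 1 - 1 / 2 ^ m) ∧ 1 / 2 ^ m ≤ v ∧
        v ≤ 1 - 1 / 2 ^ m) ∨ ((u ≤ 1 / 2 ^ m ∨ 1 - 1 / 2 ^ m ≤ u) ∧
        (v ≤ 1 / 2 ^ m ∨ 1 - 1 / 2 ^ m ≤ v)) := by
    intro u v hu0 hu1 hv0 hv1 hu hv
    have hg := h.not_linked_gapLeaf_nil hQ (h.arcPt_mem_Ioo (by linarith) (by linarith)).1.le
      (h.arcPt_mem_Ioo (by linarith) (by linarith)).2.le (w.length * m)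
    rw [iter_mk, hu, hv, mk_coe_congr (h.return_word w u) (h.return_word w v)] at hg
    have hbr : ∀ b {z : ℝ}, 0 ≤ z → z ≤ 1 → branch (2 ^ m) b z ≤ 1 / 2 ^ m ∨
        1 - 1 / 2 ^ m ≤ branch (2 ^ m) b z := by
      intro b z hz0 hz1
      cases b
      · exact Or.inl (by rw [← b1, branch_le_branch hM0]; exact hz1)
      · exact Or.inr (by rw [← b2, branch_le_branch hM0]; exact hz0)
    rcases h.gap_or_branch hu0 hu1 hv0 hv1 hg with hc | ⟨b, z, c, z', ⟨hz0, hz1, rfl⟩, hz0', hz1', rfl⟩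
    · exact Or.inl hc
    · exact Or.inr ⟨hbr b hz0 hz1, hbr c hz0' hz1'⟩
  have hboth : rotPt (2 ^ m) p k (p - 1) < x ∧ y < rotPt (2 ^ m) p k p := by
    rcases hne with hc | hc
    · refine ⟨hc, lt_of_le_of_ne c2 fun hy2 => ?_⟩
      obtain ⟨u, rfl⟩ := exists_word_eq hM0 w x
      obtain ⟨d1, d2⟩ := hx hc
      rw [word_lt_word hM0] at d1 d2
      rcases cross (u := u) (v := rotPt (2 ^ m) p k (k - p)) (by linarith) (by linarith) j2.1.le
        j2.2.le rfl (hy2.trans e2) with ⟨-, -, hd⟩ | ⟨hd | hd, -⟩ <;> linarith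
    · refine ⟨lt_of_le_of_ne c1 fun hx1 => ?_, hc⟩
      obtain ⟨v, rfl⟩ := exists_word_eq hM0 w y
      obtain ⟨d1, d2⟩ := hy hc
      rw [word_lt_word hM0] at d1 d2
      rcases cross (u := rotPt (2 ^ m) p k (k - p - 1)) (v := v) j1.1.le j1.2.le (by linarith)
        (by linarith) (hx1.symm.trans e1) rfl with ⟨⟨hd, -⟩, -⟩ | ⟨-, hd | hd⟩ <;> linarith
  have d1 := (hx hboth.1).1
  have d2 := (hy hboth.2).2
  have hg := h.gap_bounds w
  have o : ∀ t ∈ (s((arcPt α γ x : Angle), (arcPt α γ y : Angle)) : Chord),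
      OpArc (gapL m α γ w) (gapR m α γ w) t := by
    intro t ht
    rcases Sym2.mem_iff.1 ht with rfl | rfl
    · exact ⟨_, (arcPt_lt_arcPt hlt).2 d1, (arcPt_lt_arcPt hlt).2 (hxy.trans d2), rfl⟩
    · exact ⟨_, (arcPt_lt_arcPt hlt).2 (d1.trans hxy), (arcPt_lt_arcPt hlt).2 d2, rfl⟩
  rw [gapLeaf_eq, behind_iff hg.2.1 hg.2.2.2]
  exact ⟨fun t ht => (o t ht).clArc, _, Sym2.mem_mk_left _ _, o _ (Sym2.mem_mk_left _ _)⟩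

/-- The boundary leaf is the gap leaf of the itinerary of the critical values of the rotation set that
belongs to the immediately visible leaf. -/
theorem existsUnique_boundaryLeaf (h : LeafData m α γ) {q : ℕ} {β₁ β₂ : ℝ}
    (hB : LeafData (q * m) β₁ β₂) (hq : 2 ≤ q)
    (hSB : ImmediatelyVisible s((α : Angle), (γ : Angle)) s((β₁ : Angle), (β₂ : Angle))) :
    ∃! R : Chord, IsBoundaryLeaf m s((α : Angle), (γ : Angle)) (closure (valueGap m α γ)) R ∧
      IsLeast {n : ℕ | iter n R = s((α : Angle), (γ : Angle))} ((q - 1) * m) ∧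
      Behind R s((β₁ : Angle), (β₂ : Angle)) ∧
      ∀ Q : Chord, Visible s((α : Angle), (γ : Angle)) Q →
        Behind Q s((β₁ : Angle), (β₂ : Angle)) → Behind Q R := by
  have hm := h.one_lt
  have hlt := h.lt
  have hM := h.two_lt
  have hM0 : (0 : ℝ) < 2 ^ m := by linarith
  obtain ⟨a1, a2⟩ := h.bounds_of_behind hB hSB.1
  have hmq : m < q * m := by nlinarith
  -- the ends of the two leaves are different, since their periods are
  have a1 : α < β₁ := lt_of_le_of_ne a1 fun e => by
    subst e
    obtain ⟨N, hN⟩ := h.per_left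
    exact hB.exact_left m (by omega) hmq N hN
  have a2 : β₂ < γ := lt_of_le_of_ne a2 fun e => by
    subst e
    obtain ⟨N, hN⟩ := h.per_right
    exact hB.exact_right m (by omega) hmq N hN
  obtain ⟨t₁, rfl⟩ := h.exists_arcPt (x := β₁)
  obtain ⟨t₂, rfl⟩ := h.exists_arcPt (x := β₂)
  have h0 : 0 < t₁ := by rwa [← arcPt_lt_arcPt hlt, arcPt_zero]
  have h1 : t₂ < 1 := by rwa [← arcPt_lt_arcPt hlt, arcPt_one]
  obtain ⟨p, hr, rfl, rfl⟩ := h.eq_satellite h0 ((arcPt_lt_arcPt hlt).1 hB.lt) h1 hB hSB.2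
  obtain ⟨w, hw, e1, e2, hav⟩ := hr.exists_word
  have hp := hr.pos
  have hpk := hr.lt
  have j1 := hr.mem_Ioo (r := q - p - 1) (by omega) (by omega)
  have j2 := hr.mem_Ioo (r := q - p) (by omega) (by omega)
  obtain ⟨b1, b2, b3, b4, b5, b6, b7⟩ := branch_zero_one hM
  have k1 : rotPt (2 ^ m) p q (p - 1) < word (2 ^ m) w (1 / 2 ^ m) := by
    rw [e1, word_lt_word hM0, hr.eq_branch_false (r := q - p - 1) (by omega) (by omega), ← b1,
      branch_lt_branch hM0]
    exact (hr.mem_Ioo (by omega) (by omega)).2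
  have k2 : word (2 ^ m) w (1 - 1 / 2 ^ m) < rotPt (2 ^ m) p q p := by
    rw [e2, word_lt_word hM0, hr.eq_branch_true (r := q - p) (by omega) (by omega), ← b2,
      branch_lt_branch hM0]
    exact (hr.mem_Ioo (by omega) (by omega)).1
  have kw := (word_lt_word hM0 w).2 b6
  have hlen : (w.length + 1) * m = (q - 1) * m := by rw [hw]; congr 1; omega
  refine ⟨gapLeaf m α γ w, ⟨h.gapLeaf_isBoundaryLeaf w, hlen ▸ h.isLeast_iter_gapLeaf w, ?_,
    fun Q hQ hQB => h.behind_gapLeaf_of_visible hr hw e1 e2 hav hQ hQB⟩, ?_⟩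
  · have o : ∀ t ∈ gapLeaf m α γ w, OpArc (arcPt α γ (rotPt (2 ^ m) p q (p - 1)))
        (arcPt α γ (rotPt (2 ^ m) p q p)) t := by
      intro t ht
      rcases Sym2.mem_iff.1 ht with rfl | rfl
      · exact ⟨_, (arcPt_lt_arcPt hlt).2 k1, (arcPt_lt_arcPt hlt).2 (kw.trans k2), rfl⟩
      · exact ⟨_, (arcPt_lt_arcPt hlt).2 (k1.trans kw), (arcPt_lt_arcPt hlt).2 k2, rfl⟩
    rw [behind_iff hB.lt hB.short]
    exact ⟨fun t ht => (o t ht).clArc, _, Sym2.mem_mk_left _ _, o _ (Sym2.mem_mk_left _ _)⟩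
  · rintro R ⟨hR, hleast, hRB, -⟩
    rcases h.eq_of_isBoundaryLeaf hR with rfl | ⟨v, rfl⟩
    · have := hleast.2 (show iter 0 _ = _ by simp [iter])
      have : 0 < (q - 1) * m := Nat.mul_pos (by omega) (by omega)
      omega
    · have hv := (h.isLeast_iter_gapLeaf v).unique hleast
      have hv := Nat.eq_of_mul_eq_mul_right (by omega) hv
      have hcl := ((behind_iff hB.lt hB.short).1 hRB).1
      have hBsh := hB.short
      have gv := h.gap_bounds v
      have hpos := h.pos
      have hl1 := h.lt_one
      have inside : ∀ {x : ℝ}, α < x → x < γ →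
          ClArc (arcPt α γ (rotPt (2 ^ m) p q (p - 1))) (arcPt α γ (rotPt (2 ^ m) p q p)) (x : Angle) →
          arcPt α γ (rotPt (2 ^ m) p q (p - 1)) ≤ x ∧ x ≤ arcPt α γ (rotPt (2 ^ m) p q p) := by
        rintro x hx1 hx2 ⟨r, hr1, hr2, hr3⟩
        rw [← eq_of_coe_eq hr3 (by linarith) (by linarith)]
        exact ⟨hr1, hr2⟩
      have c1 := (inside gv.1 (by linarith) (hcl _ (Sym2.mem_mk_left _ _))).1
      have c2 := (inside (by linarith) gv.2.2.1 (hcl _ (Sym2.mem_mk_right _ _))).2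
      rw [gapL, arcPt_le_arcPt hlt] at c1
      rw [gapR, arcPt_le_arcPt hlt] at c2
      refine h.gap_unique (by omega) ?_ c1 c2 k1.le k2.le
      rw [e1, e2, word_sub_word hM0]
      linarith

end LeafData

end QuadLam

end

theorem proposition3 (S B : QuadLam.Chord) (m q : ℕ)
    (hS : QuadLam.IsParamLeaf m S) (hq : 2 ≤ q)
    (hB : QuadLam.IsParamLeaf (q * m) B)
    (hSB : QuadLam.ImmediatelyVisible S B) :
    (∃! G : Set ℂ, QuadLam.IsCriticalValueGap m S G) ∧
    ∀ G : Set ℂ, QuadLam.IsCriticalValueGap m S G →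
      ∃! R : QuadLam.Chord,
        QuadLam.IsBoundaryLeaf m S G R ∧
        IsLeast {n : ℕ | QuadLam.Chord.iter n R = S} ((q - 1) * m) ∧
        QuadLam.Chord.Behind R B ∧
        ∀ Q : QuadLam.Chord, QuadLam.Visible S Q → QuadLam.Chord.Behind Q B →
          QuadLam.Chord.Behind Q R := by
  obtain ⟨α, γ, rfl, h⟩ := hS.exists_leafData
  obtain ⟨β₁, β₂, rfl, hB'⟩ := hB.exists_leafData
  refine ⟨⟨_, h.isCriticalValueGap, fun G hG => h.eq_of_isCriticalValueGap hG⟩, fun G hG => ?_⟩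
  rw [h.eq_of_isCriticalValueGap hG]
  exact h.existsUnique_boundaryLeaf hB' hq hSB
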